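/- **Setting.** Fix $N\ge 1$ units, unit $1$ being treated after a pre-treatment period, and let $y_{it}$ be the outcome of unit $i$ at time $t$. Put $x_t=(1,y_{2t},\dots,y_{Nt})'=(x_{t1},\dots,x_{tN})'$. In the pre-treatment periods $t=1,\dots,T_1$ the regression $$y_{1t}=\beta' x_t+\eta_{t},\qquad \beta\in\mathbb R^N,$$ holds. Let $X_0'=[x_1,\dots,x_{T_1}]$ and fix a tuning parameter $\alpha\ge 0$. **Assumption (A4).** The errors $\eta_t$ are independent and identically distributed with density $\frac1\sigma f(\eta/\sigma)$, $\sigma>0$, and the sequence $(\eta_t)$ is independent of the control outcomes, where $f$ is a density on $\mathbb R$ with mean zero, variance one and $M_f^{(\alpha)}=\int f^{1+\alpha}<\infty$. **Regularity of $f$.** $f$ is everywhere positive and twice continuously differentiable; with $u=f'/f$, the integrals $$M_{f,i,j}^{(\alpha)}=\int s^i u(s)^j f(s)^{1+\alpha}\,ds$$ are absolutely convergent for $i,j\in\{0,1,2\}$, as are those with $2\alpha$ in place of $\alpha$; and, with $\psi=f^\alpha u$, there are $\delta>0$ and a function $g$ with $\int g f<\infty$ such that $(1+r^2)|\psi'(r)|\le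 g(s)$ whenever $r=a+(1+b)s$, $|a|\le\delta$, $|b|\le\delta$. **Assumption (A5).** There are constants $C$ and $c>0$ such that, with probability tending to one as $T_1\to\infty$: for all $t\le T_1$ and all $j,k,l$, $|x_{tj}|\le C$, $|x_{tj}x_{tk}|\le C$, $T_1^{-1}\sum_{t\le T_1}|x_{tj}x_{tk}x_{tl}|\le C$, the smallest eigenvalue of $T_1^{-1}X_0'X_0$ is at least $c$, and $x_t'(X_0'X_0)^{-1}x_t\le C/T_1$. Moreover the non-random limits in probability $\Sigma_x=\operatorname{plim}T_1^{-1}X_0'X_0$ and $\mu_x=\operatorname{plim}T_1^{-1}X_0'\mathbf 1$ exist. **Estimating equations.** With $r_t=(y_{1t}-b'x_t)/\sqrt v$, a root $(b,v)\in\mathbb R^N\times(0,\infty)$ of the minimum density power divergence (DPD) estimating equations is a solution of $$\sum_{t=1}^{T_1}f(r_t)^\alpha u(r_t)\,x_t=0,\qquad \frac1{T_1}\sum_{t=1}^{T_1}\bigl[1+r_tu(r_t)\bigr]f(r_t)^\alpha=\frac{\alpha M_f^{(\alpha)}}{1+\alpha}.$$ **Theorem.** There are estimators $(\widehat\beta_\alpha,\widehat\sigma_\alpha^2)$,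 measurable functions of the data of the periods $1,\dots,T_1$, which with probability tending to one are a root of the minimum-DPD estimating equations, which are consistent for $(\beta,\sigma^2)$, and which are $\sqrt{T_1}$-consistent: $\sqrt{T_1}(\widehat\beta_\alpha-\beta)=O_p(1)$ and $\sqrt{T_1}(\widehat\sigma^2_\alpha-\sigma^2)=O_p(1)$. Moreover $\widetilde\Psi_\alpha$ below is invertible, $\sigma^2\widetilde\Psi_\alpha^{-1}\widetilde\Omega_\alpha\widetilde\Psi_\alpha^{-1}$ is positive semidefinite, and $$\sqrt{T_1}\begin{pmatrix}\widehat\beta_\alpha-\beta\\ \widehat\sigma_\alpha^2-\sigma^2\end{pmatrix}\xrightarrow{\ \mathcal D\ }\mathcal N_{N+1}\bigl(0,\ \sigma^2\widetilde\Psi_\alpha^{-1}\widetilde\Omega_\alpha\widetilde\Psi_\alpha^{-1}\bigr)\qquad (T_1\to\infty),$$ where $$\widetilde\Psi_\alpha=\begin{pmatrix}\zeta_{11,\alpha}\Sigma_x&\frac{\zeta_{12,\alpha}}{\sigma}\mu_x\\ \frac{\zeta_{12,\alpha}}{\sigma}\mu_x'&\frac{\zeta_{22,\alpha}}{\sigma^2}\end{pmatrix},\qquad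 \widetilde\Omega_\alpha=\begin{pmatrix}[\zeta_{11,2\alpha}-\phi_{1,\alpha}^2]\Sigma_x&\frac{\zeta_{12,2\alpha}-\phi_{1,\alpha}\phi_{2,\alpha}}{\sigma}\mu_x\\ \frac{\zeta_{12,2\alpha}-\phi_{1,\alpha}\phi_{2,\alpha}}{\sigma}\mu_x'&\frac{\zeta_{22,2\alpha}-\phi_{2,\alpha}^2}{\sigma^2}\end{pmatrix},$$ $\zeta_{11,\alpha}=M_{f,0,2}^{(\alpha)}$, $\zeta_{12,\alpha}=\tfrac12[M_{f,0,1}^{(\alpha)}+M_{f,1,2}^{(\alpha)}]$, $\zeta_{22,\alpha}=\tfrac14[M_{f,2,2}^{(\alpha)}+2M_{f,1,1}^{(\alpha)}+M_{f,0,0}^{(\alpha)}]$, $\phi_{1,\alpha}=-M_{f,0,1}^{(\alpha)}$ and $\phi_{2,\alpha}=-\tfrac12[M_{f,0,0}^{(\alpha)}+M_{f,1,1}^{(\alpha)}]$. -/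

import Mathlib

open MeasureTheory ProbabilityTheory Filter Topology
open scoped Matrix

noncomputable section

namespace HCW

/-! ### The error density -/

/-- The function `u = f' / f`. -/
def u (f : ℝ → ℝ) (s : ℝ) : ℝ := deriv f s / f s

/-- The integrand `sⁱ u(s)ʲ f(s)^(1+α)`. -/
def mIntegrand (f : ℝ → ℝ) (α : ℝ) (i j : ℕ) (s : ℝ) : ℝ :=
  s ^ i * u f s ^ j * f s ^ (1 + α)

/-- `M_{f,i,j}^{(α)} = ∫ sⁱ u(s)ʲ f(s)^(1+α) ds`; in particular `M f α 0 0 = ∫ f^(1+α)`. -/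
def M (f : ℝ → ℝ) (α : ℝ) (i j : ℕ) : ℝ := ∫ s, mIntegrand f α i j s

/-- `f` is a positive univariate probability density with mean zero and variance one
(`∫ s² f = 1` forces integrability of `s² f`, hence of `s f`), and `∫ f^(1+α) < ∞`. -/
structure IsErrorDensity (f : ℝ → ℝ) (α : ℝ) : Prop where
  pos : ∀ s, 0 < f s
  measurable : Measurable f
  mass : ∫ s, f s = 1
  mean : ∫ s, s * f s = 0
  variance : ∫ s, s ^ 2 * f s = 1
  integrable_power : Integrable (fun s => f s ^ (1 + α))

/-- Smoothness of the error density: `f` is twice continuously differentiable, the integrals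
`M_{f,i,j}^{(α)}` and `M_{f,i,j}^{(2α)}` with `i, j ≤ 2` are finite, and the first derivative of
`f^α u` (which carries the second order derivatives of the DPD loss in the parameters), with
weight `1 + r²`, is dominated by an integrable majorant locally uniformly under a shift and a
rescaling of the argument. -/
structure IsRegularDensity (f : ℝ → ℝ) (α : ℝ) : Prop where
  contDiff : ContDiff ℝ 2 f
  integrable : ∀ i ≤ 2, ∀ j ≤ 2, Integrable (mIntegrand f α i j)
  integrable_two : ∀ i ≤ 2, ∀ j ≤ 2, Integrable (mIntegrand f (2 * α) i j)
  dominated : ∃ δ > 0, ∃ g : ℝ → ℝ, Integrable (fun s => g s * f s) ∧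
    ∀ s a b : ℝ, |a| ≤ δ → |b| ≤ δ →
      (1 + (a + (1 + b) * s) ^ 2) *
        |deriv (fun r => f r ^ α * u f r) (a + (1 + b) * s)| ≤ g s

/-! ### The regression of the treated unit on the control units

There are `n + 1` units (`N = n + 1`); unit `0` is the treated one, units `1, …, n` are the
controls. The outcomes of all units in one period form a vector `w : Fin (n + 1) → ℝ`. -/

/-- The regressor `x = (1, ỹ')'`: the constant `1` followed by the outcomes of the controls. -/
def regressor {n : ℕ} (w : Fin (n + 1) → ℝ) : Fin (n + 1) → ℝ := Fin.cons 1 (Fin.tail w)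

/-- The standardized residual `(y₁ - β'x) / σ`, where `v` stands for `σ²`. -/
def resid {n : ℕ} (b : Fin (n + 1) → ℝ) (v : ℝ) (w : Fin (n + 1) → ℝ) : ℝ :=
  (w 0 - b ⬝ᵥ regressor w) / √v

/-- `(b, v)` is a root of the minimum-DPD estimating equations for `(β, σ²)` with tuning
parameter `α`, computed from the outcomes `D` of the `n + 1` units in `T` periods. -/
structure IsMDPDERoot (f : ℝ → ℝ) (α : ℝ) {n T : ℕ} (D : Fin T → Fin (n + 1) → ℝ)
    (b : Fin (n + 1) → ℝ) (v : ℝ) : Prop where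
  variance_pos : 0 < v
  intercept : ∑ t, f (resid b v (D t)) ^ α * u f (resid b v (D t)) = 0
  slope : ∑ t, (f (resid b v (D t)) ^ α * u f (resid b v (D t))) • Fin.tail (D t) = 0
  scale : (1 / (T : ℝ)) * ∑ t,
    (1 + resid b v (D t) * u f (resid b v (D t))) * f (resid b v (D t)) ^ α
      = α * M f α 0 0 / (1 + α)

/-- The first `T` periods of an outcome sequence. -/
def firstPeriods {n : ℕ} (y : ℕ → Fin (n + 1) → ℝ) (T : ℕ) : Fin T → Fin (n + 1) → ℝ :=
  fun t => y t

/-- The design matrix `X₀` with rows `x₁', …, x_T'`. -/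
def design {n T : ℕ} (D : Fin T → Fin (n + 1) → ℝ) : Matrix (Fin T) (Fin (n + 1)) ℝ :=
  Matrix.of fun t => regressor (D t)

/-- `T⁻¹ X₀'X₀`. -/
def gram {n T : ℕ} (D : Fin T → Fin (n + 1) → ℝ) : Matrix (Fin (n + 1)) (Fin (n + 1)) ℝ :=
  (T : ℝ)⁻¹ • ((design D)ᵀ * design D)

/-- `T⁻¹ X₀'1`. -/
def regressorMean {n T : ℕ} (D : Fin T → Fin (n + 1) → ℝ) : Fin (n + 1) → ℝ :=
  (T : ℝ)⁻¹ • ((design D)ᵀ *ᵥ 1)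

/-- The bounds on the regressors over `T` periods, with constants `C` and `c`. -/
structure DesignBounds (C c : ℝ) {n T : ℕ} (D : Fin T → Fin (n + 1) → ℝ) : Prop where
  entries : ∀ t j, |design D t j| ≤ C
  products : ∀ t j k, |design D t j * design D t k| ≤ C
  triples : ∀ j k l, (1 / (T : ℝ)) * ∑ t, |design D t j * design D t k * design D t l| ≤ C
  eigenvalues : ∀ lam ∈ spectrum ℝ (gram D), c ≤ lam
  leverage : ∀ t, design D t ⬝ᵥ (((design D)ᵀ * design D)⁻¹ *ᵥ design D t) ≤ C / (T : ℝ)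

/-! ### The asymptotic covariance matrix -/

def zeta11 (f : ℝ → ℝ) (α : ℝ) : ℝ := M f α 0 2
def zeta12 (f : ℝ → ℝ) (α : ℝ) : ℝ := (M f α 0 1 + M f α 1 2) / 2
def zeta22 (f : ℝ → ℝ) (α : ℝ) : ℝ := (M f α 2 2 + 2 * M f α 1 1 + M f α 0 0) / 4
def phi1 (f : ℝ → ℝ) (α : ℝ) : ℝ := -M f α 0 1
def phi2 (f : ℝ → ℝ) (α : ℝ) : ℝ := -(M f α 0 0 + M f α 1 1) / 2

/-- The matrix `Ψ̃_α`; the coordinate `Sum.inr ()` is the one of `σ²`. -/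
def Psi (f : ℝ → ℝ) (α σ : ℝ) {n : ℕ} (S : Matrix (Fin (n + 1)) (Fin (n + 1)) ℝ)
    (m : Fin (n + 1) → ℝ) : Matrix (Fin (n + 1) ⊕ Unit) (Fin (n + 1) ⊕ Unit) ℝ :=
  Matrix.fromBlocks
    (zeta11 f α • S)
    ((zeta12 f α / σ) • Matrix.replicateCol Unit m)
    ((zeta12 f α / σ) • Matrix.replicateRow Unit m)
    (Matrix.of fun _ _ => zeta22 f α / σ ^ 2)

/-- The matrix `Ω̃_α`. -/
def Omega (f : ℝ → ℝ) (α σ : ℝ) {n : ℕ} (S : Matrix (Fin (n + 1)) (Fin (n + 1)) ℝ)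
    (m : Fin (n + 1) → ℝ) : Matrix (Fin (n + 1) ⊕ Unit) (Fin (n + 1) ⊕ Unit) ℝ :=
  Matrix.fromBlocks
    ((zeta11 f (2 * α) - phi1 f α ^ 2) • S)
    (((zeta12 f (2 * α) - phi1 f α * phi2 f α) / σ) • Matrix.replicateCol Unit m)
    (((zeta12 f (2 * α) - phi1 f α * phi2 f α) / σ) • Matrix.replicateRow Unit m)
    (Matrix.of fun _ _ => (zeta22 f (2 * α) - phi2 f α ^ 2) / σ ^ 2)

/-- The asymptotic covariance matrix `σ² Ψ̃_α⁻¹ Ω̃_α Ψ̃_α⁻¹`. -/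
def asympCov (f : ℝ → ℝ) (α σ : ℝ) {n : ℕ} (S : Matrix (Fin (n + 1)) (Fin (n + 1)) ℝ)
    (m : Fin (n + 1) → ℝ) : Matrix (Fin (n + 1) ⊕ Unit) (Fin (n + 1) ⊕ Unit) ℝ :=
  σ ^ 2 • ((Psi f α σ S m)⁻¹ * Omega f α σ S m * (Psi f α σ S m)⁻¹)

/-- The vector `√T (b - β, v - σ²)`. -/
def scaledError {n : ℕ} (T : ℕ) (b β : Fin (n + 1) → ℝ) (v σ : ℝ) :
    EuclideanSpace ℝ (Fin (n + 1) ⊕ Unit) :=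
  WithLp.toLp 2 (Sum.elim (fun j => √(T : ℝ) * (b j - β j)) (fun _ => √(T : ℝ) * (v - σ ^ 2)))

/-- A sequence of real random variables is bounded in probability, `Z_T = O_p(1)`. -/
def BoundedInProbability {Ω : Type*} [MeasurableSpace Ω] (P : Measure Ω) (Z : ℕ → Ω → ℝ) :
    Prop :=
  ∀ ε : ENNReal, 0 < ε → ∃ K : ℝ, ∀ᶠ T in atTop, P {ω | K < |Z T ω|} ≤ ε

end HCW

end

noncomputable section

set_option linter.unusedSectionVars false

namespace HCW

/-! ### The law of the standardized errors -/

/-! The root is found near the truth by a simplified Newton iteration, and its law is that of the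
first step. In the local coordinates `φ = (γ, 2σκ)`, where `b = β - σ/(1+κ) γ` and `√v = σ/(1+κ)`,
the standardized residual is the affine function `γ'x + (1+κ)s` of the standardized error `s`. The
derivative of the averaged score `S` at `φ = 0` converges in probability to `-Ψ`
(`tendstoInMeasure_scoreDeriv`), and the domination of the derivative of `f^α u` makes the
linearization error small uniformly near zero (`exists_scoreTerm_majorant`). Hence `G(φ) = φ +
Ψ⁻¹S(φ)` is, with probability tending to one, Lipschitz with an arbitrarily small constant on a
fixed ball (`exists_tendsto_lipschitzNearZero`).

The score at zero is centred, by integration by parts. Conditionally on the regressors it is a sum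
of independent terms, so its characteristic function factors and `√T S(0)` is asymptotically `N(0,
Ω)` (`tendsto_charFun_localScore`). Thus `G(0) = Ψ⁻¹S(0)` has order `T^(-1/2)`, the contraction
principle yields a fixed point of `G`, i.e. a zero of the score, and this point differs from `G(0)`
by `o_p(T^(-1/2))`. As `(b - β, v - σ²) = -σφ + O(‖φ‖²)`, the covariance `σ²Ψ⁻¹ΩΨ⁻¹` follows by
Slutsky's argument (`tendstoInDistribution_ofLocal`). The fixed point is the limit of the iterates
started at zero, hence a measurable function of the data.

For the limiting matrices, the constant regressor makes `μₓ` the first column of `Σₓ`, with first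
entry one. The quadratic forms of `Ψ` and `Ω` are therefore integrals over `s` of the quadratic form
of `Σₓ` at a vector depending on `s` (`posDef_Psi`, `posSemidef_Omega`), and `Σₓ` is positive
definite because the eigenvalue bound passes to the limit. -/

/-- The probability measure with density `f`. -/
def errorLaw (f : ℝ → ℝ) : Measure ℝ := volume.withDensity fun s => ENNReal.ofReal (f s)

/-- The function `ψ = f^α u` in the estimating equation for the slopes. -/
def psi (f : ℝ → ℝ) (α : ℝ) (r : ℝ) : ℝ := f r ^ α * u f r

/-- The function `(1 + r u(r)) f(r)^α` in the estimating equation for the scale. -/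
def scaleScore (f : ℝ → ℝ) (α : ℝ) (r : ℝ) : ℝ := (1 + r * u f r) * f r ^ α

/-- The derivative of `scaleScore`. -/
def scaleScoreDeriv (f : ℝ → ℝ) (α : ℝ) (r : ℝ) : ℝ :=
  (1 + α) * psi f α r + r * deriv (psi f α) r

/-- `scaleScore` centred at its mean under `errorLaw`. -/
def centredScaleScore (f : ℝ → ℝ) (α : ℝ) (r : ℝ) : ℝ :=
  scaleScore f α r - α * M f α 0 0 / (1 + α)

variable {f : ℝ → ℝ} {α : ℝ}

namespace IsErrorDensity

lemma integrable (hf : IsErrorDensity f α) : Integrable f := by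
  by_contra h
  have := hf.mass
  -- The Bochner integral of a non-integrable function is zero by convention, which contradicts
  -- total mass one.
  rw [integral_undef h] at this
  exact zero_ne_one this

lemma isProbabilityMeasure (hf : IsErrorDensity f α) : IsProbabilityMeasure (errorLaw f) := by
  constructor
  rw [errorLaw, withDensity_apply _ MeasurableSet.univ, Measure.restrict_univ,
    ← ofReal_integral_eq_lintegral_ofReal hf.integrable (ae_of_all _ fun s => (hf.pos s).le),
    hf.mass, ENNReal.ofReal_one]

lemma integral_errorLaw (hf : IsErrorDensity f α) (k : ℝ → ℝ) :
    ∫ s, k s ∂(errorLaw f) = ∫ s, k s * f s := by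
  rw [errorLaw, integral_withDensity_eq_integral_toReal_smul hf.measurable.ennreal_ofReal
    (ae_of_all _ fun s => ENNReal.ofReal_lt_top)]
  congr 1; ext s
  rw [ENNReal.toReal_ofReal (hf.pos s).le, smul_eq_mul, mul_comm]

lemma integrable_errorLaw_iff (hf : IsErrorDensity f α) {k : ℝ → ℝ} :
    Integrable k (errorLaw f) ↔ Integrable fun s => k s * f s := by
  rw [errorLaw, integrable_withDensity_iff_integrable_smul' hf.measurable.ennreal_ofReal
    (ae_of_all _ fun s => ENNReal.ofReal_lt_top)]
  refine integrable_congr (ae_of_all _ fun s => ?_)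
  simp only [ENNReal.toReal_ofReal (hf.pos s).le, smul_eq_mul, mul_comm]

end IsErrorDensity

/-! ### Smoothness of the score functions. -/

section Smoothness

variable (hf : IsErrorDensity f α) (hreg : IsRegularDensity f α)
include hf hreg

lemma hasDerivAt_density (s : ℝ) : HasDerivAt f (u f s * f s) s := by
  have h : DifferentiableAt ℝ f s := hreg.contDiff.contDiffAt.differentiableAt (by norm_num)
  have := h.hasDerivAt
  rwa [show deriv f s = u f s * f s by rw [u, div_mul_cancel₀ _ (hf.pos s).ne']] at this

lemma contDiff_u : ContDiff ℝ 1 (u f) := by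
  have h1 : ContDiff ℝ 1 (deriv f) :=
    ((contDiff_succ_iff_deriv (n := 1)).1 (by simpa [one_add_one_eq_two] using hreg.contDiff)).2.2
  exact h1.div (hreg.contDiff.of_le (by norm_num)) fun s => (hf.pos s).ne'

lemma contDiff_psi : ContDiff ℝ 1 (psi f α) :=
  ((hreg.contDiff.of_le (by norm_num)).rpow_const_of_ne fun s => (hf.pos s).ne').mul
    (contDiff_u hf hreg)

lemma continuous_deriv_psi : Continuous (deriv (psi f α)) :=
  (contDiff_psi hf hreg).continuous_deriv le_rfl

lemma continuous_psi : Continuous (psi f α) := (contDiff_psi hf hreg).continuous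

lemma hasDerivAt_psi (s : ℝ) : HasDerivAt (psi f α) (deriv (psi f α) s) s :=
  ((contDiff_psi hf hreg).differentiable (by norm_num) s).hasDerivAt

lemma scaleScore_eq (s : ℝ) : scaleScore f α s = f s ^ α + s * psi f α s := by
  simp only [scaleScore, psi]; ring

/-- Since `scaleScore = f^α + sψ` and `(f^α)' = α f^α u = αψ`, the second derivative of `f` enters
only through `ψ'`. -/
lemma hasDerivAt_scaleScore (s : ℝ) :
    HasDerivAt (scaleScore f α) (scaleScoreDeriv f α s) s := by
  have h1 : HasDerivAt (fun s => f s ^ α) (α * psi f α s) s := by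
    have := (hasDerivAt_density hf hreg s).rpow_const (p := α) (Or.inl (hf.pos s).ne')
    convert! this using 1
    have h := Real.rpow_sub_one (hf.pos s).ne' α
    rw [h, psi]
    have := (hf.pos s).ne'
    field_simp
  have h2 := h1.add ((hasDerivAt_id s).mul (hasDerivAt_psi hf hreg s))
  convert! h2 using 1
  · ext r; simp [scaleScore_eq hf hreg]
  · simp [scaleScoreDeriv]; ring

lemma continuous_scaleScore : Continuous (scaleScore f α) :=
  continuous_iff_continuousAt.2 fun s => (hasDerivAt_scaleScore hf hreg s).continuousAt

lemma continuous_scaleScoreDeriv : Continuous (scaleScoreDeriv f α) := by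
  have := continuous_psi hf hreg
  have := continuous_deriv_psi hf hreg
  unfold scaleScoreDeriv
  fun_prop

end Smoothness

/-! ### Moments of the score functions and of their derivatives under the error law. -/

section Moments

variable (hf : IsErrorDensity f α) (hreg : IsRegularDensity f α)
include hf hreg

lemma pow_mul_psi_mul_density (i : ℕ) (s : ℝ) :
    s ^ i * psi f α s * f s = mIntegrand f α i 1 s := by
  rw [mIntegrand, psi, Real.rpow_add (hf.pos s), Real.rpow_one]; ring

lemma psi_mul_psi_mul_density (s : ℝ) (i : ℕ) :
    s ^ i * psi f α s * (u f s * f s) = mIntegrand f α i 2 s := by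
  rw [mIntegrand, psi, Real.rpow_add (hf.pos s), Real.rpow_one]; ring

/-- `(1 + s²) |ψ'(s)|` is integrable against the density. -/
lemma integrable_deriv_psi (i : ℕ) (hi : i ≤ 2) :
    Integrable fun s => s ^ i * deriv (psi f α) s * f s := by
  obtain ⟨δ, hδ, g, hg, hdom⟩ := hreg.dominated
  refine hg.mono' ?_ (ae_of_all _ fun s => ?_)
  · have := continuous_deriv_psi hf hreg
    have := hreg.contDiff.continuous
    exact (by fun_prop : Continuous fun s => s ^ i * deriv (psi f α) s * f s).aestronglyMeasurable
  -- Without shift and rescaling the domination hypothesis bounds `(1 + s²)|ψ'(s)|`, and `|s|^i ≤ 1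
  -- + s²` for `i ≤ 2`.
  · have h := hdom s 0 0 (by simpa using hδ.le) (by simpa using hδ.le)
    simp only [add_zero, zero_add, one_mul] at h
    rw [Real.norm_eq_abs, abs_mul, abs_mul, abs_of_pos (hf.pos s)]
    refine mul_le_mul_of_nonneg_right (le_trans ?_ h) (hf.pos s).le
    refine mul_le_mul_of_nonneg_right ?_ (abs_nonneg _)
    rw [abs_pow]
    have h2 := sq_abs s
    interval_cases i <;> nlinarith [sq_nonneg (|s| - 1), abs_nonneg s]

/-- Integration by parts against the density. -/
lemma integral_pow_mul_deriv_psi (i : ℕ) (hi : i ≤ 2) :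
    ∫ s, s ^ i * deriv (psi f α) s * f s = -(i * M f α (i - 1) 1) - M f α i 2 := by
  have hd : ∀ s, HasDerivAt (fun s => s ^ i * psi f α s * f s)
      ((i * mIntegrand f α (i - 1) 1 s + s ^ i * deriv (psi f α) s * f s)
        + mIntegrand f α i 2 s) s := fun s => by
    have := ((hasDerivAt_pow i s).mul (hasDerivAt_psi hf hreg s)).mul (hasDerivAt_density hf hreg s)
    convert! this using 1
    rw [← pow_mul_psi_mul_density hf hreg, ← psi_mul_psi_mul_density hf hreg]
    simp only [Pi.mul_apply]
    ring
  -- For `i = 0` the truncated `i - 1` equals `0`, which is harmless because of the factor `i`.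
  have i1 := (hreg.integrable (i - 1) (by omega) 1 (by norm_num)).const_mul (i : ℝ)
  have i2 := integrable_deriv_psi hf hreg i hi
  have i3 := hreg.integrable i hi 2 le_rfl
  have h0 : Integrable fun s => s ^ i * psi f α s * f s := by
    simp only [pow_mul_psi_mul_density hf hreg]
    exact hreg.integrable i hi 1 (by norm_num)
  have i12 : Integrable fun s =>
      i * mIntegrand f α (i - 1) 1 s + s ^ i * deriv (psi f α) s * f s := i1.add i2
  -- An integrable function with integrable derivative has no boundary terms at infinity.
  have := integral_eq_zero_of_hasDerivAt_of_integrable hd (i12.add i3) h0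
  rw [integral_add i12 i3, integral_add i1 i2, integral_const_mul] at this
  simp only [M]
  linarith

/-- The derivative of `s^i f^(1+α)` integrates to zero. This is Fisher consistency of the estimating
equations: `i = 0` centres the slope score, and `i = 1` identifies the constant in the scale
equation. -/
lemma integral_by_parts_power (i : ℕ) (hi : i ≤ 1) :
    (1 + α) * M f α i 1 = -(i * M f α 0 0) := by
  have hp : ∀ s, HasDerivAt (fun s => f s ^ (1 + α)) ((1 + α) * mIntegrand f α 0 1 s) s :=
    fun s => by
      have := (hasDerivAt_density hf hreg s).rpow_const (p := 1 + α) (Or.inl (hf.pos s).ne')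
      convert! this using 1
      rw [mIntegrand, Real.rpow_sub_one (hf.pos s).ne']
      have := (hf.pos s).ne'
      field_simp
  have hd : ∀ s, HasDerivAt (fun s => s ^ i * f s ^ (1 + α))
      (i * mIntegrand f α 0 0 s + (1 + α) * mIntegrand f α i 1 s) s := fun s => by
    have := (hasDerivAt_pow i s).mul (hp s)
    convert! this using 1
    simp only [mIntegrand]
    interval_cases i
    · simp
    · simp; ring
  have i1 := (hreg.integrable 0 (by omega) 0 (by norm_num)).const_mul (i : ℝ)
  have i2 := (hreg.integrable i (by omega) 1 (by norm_num)).const_mul (1 + α)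
  have h0 : Integrable fun s => s ^ i * f s ^ (1 + α) := by
    refine (hreg.integrable i (by omega) 0 (by norm_num)).congr (ae_of_all _ fun s => ?_)
    simp [mIntegrand]
  have := integral_eq_zero_of_hasDerivAt_of_integrable hd (i1.add i2) h0
  rw [integral_add i1 i2, integral_const_mul, integral_const_mul] at this
  simp only [M]
  linarith

lemma M_zero_one (hα : 0 ≤ α) : M f α 0 1 = 0 := by
  have := integral_by_parts_power hf hreg 0 (by norm_num)
  simp only [Nat.cast_zero, zero_mul, neg_zero, mul_eq_zero] at this
  rcases this with h | h
  · linarith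
  · exact h

lemma M_one_one : (1 + α) * M f α 1 1 = -M f α 0 0 := by
  simpa using integral_by_parts_power hf hreg 1 le_rfl

lemma integrable_psi_errorLaw (i : ℕ) (hi : i ≤ 2) :
    Integrable (fun s => s ^ i * psi f α s) (errorLaw f) := by
  rw [hf.integrable_errorLaw_iff]
  simp only [pow_mul_psi_mul_density hf hreg]
  exact hreg.integrable i hi 1 (by norm_num)

lemma integral_pow_mul_psi_errorLaw (i : ℕ) :
    ∫ s, s ^ i * psi f α s ∂(errorLaw f) = M f α i 1 := by
  rw [hf.integral_errorLaw]
  simp only [pow_mul_psi_mul_density hf hreg]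
  rfl

lemma integral_psi_errorLaw (hα : 0 ≤ α) : ∫ s, psi f α s ∂(errorLaw f) = 0 := by
  simpa [M_zero_one hf hreg hα] using integral_pow_mul_psi_errorLaw hf hreg 0

lemma integrable_scaleScore_errorLaw : Integrable (scaleScore f α) (errorLaw f) := by
  rw [hf.integrable_errorLaw_iff]
  refine ((hreg.integrable 0 (by norm_num) 0 (by norm_num)).add
    (hreg.integrable 1 (by norm_num) 1 (by norm_num))).congr (ae_of_all _ fun s => ?_)
  simp only [Pi.add_apply, mIntegrand, scaleScore, Real.rpow_add (hf.pos s), Real.rpow_one]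
  ring

/-- The mean is `M₀₀ + M₁₁` with `(1+α)M₁₁ = -M₀₀`, which is exactly the right side of the scale
equation. -/
lemma integral_scaleScore_errorLaw (hα : 0 ≤ α) :
    ∫ s, scaleScore f α s ∂(errorLaw f) = α * M f α 0 0 / (1 + α) := by
  have h1 := M_one_one hf hreg
  have : ∫ s, scaleScore f α s ∂(errorLaw f) = M f α 0 0 + M f α 1 1 := by
    rw [hf.integral_errorLaw, M, M, ← integral_add (hreg.integrable 0 (by norm_num) 0 (by norm_num))
      (hreg.integrable 1 (by norm_num) 1 (by norm_num))]
    congr 1; ext s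
    simp only [mIntegrand, scaleScore, Real.rpow_add (hf.pos s), Real.rpow_one]
    ring
  rw [this, eq_div_iff (by linarith)]
  linarith

lemma integral_centredScaleScore_errorLaw (hα : 0 ≤ α) :
    ∫ s, centredScaleScore f α s ∂(errorLaw f) = 0 := by
  have := hf.isProbabilityMeasure
  simp only [centredScaleScore]
  rw [integral_sub (integrable_scaleScore_errorLaw hf hreg) (integrable_const _),
    integral_scaleScore_errorLaw hf hreg hα]
  simp

lemma integrable_deriv_psi_errorLaw (i : ℕ) (hi : i ≤ 2) :
    Integrable (fun s => s ^ i * deriv (psi f α) s) (errorLaw f) := by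
  rw [hf.integrable_errorLaw_iff]
  exact integrable_deriv_psi hf hreg i hi

lemma integral_deriv_psi_errorLaw :
    ∫ s, deriv (psi f α) s ∂(errorLaw f) = -zeta11 f α := by
  have := integral_pow_mul_deriv_psi hf hreg 0 (by norm_num)
  rw [hf.integral_errorLaw, zeta11]
  simpa using this

lemma integral_mul_deriv_psi_errorLaw :
    ∫ s, s * deriv (psi f α) s ∂(errorLaw f) = -(2 * zeta12 f α) := by
  have := integral_pow_mul_deriv_psi hf hreg 1 (by norm_num)
  rw [hf.integral_errorLaw, zeta12]
  simp only [pow_one, Nat.cast_one, Nat.sub_self] at this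
  rw [this]; ring

lemma pow_mul_scaleScoreDeriv (i : ℕ) (s : ℝ) : s ^ i * scaleScoreDeriv f α s =
    (1 + α) * (s ^ i * psi f α s) + s ^ (i + 1) * deriv (psi f α) s := by
  rw [scaleScoreDeriv]; ring

lemma integrable_scaleScoreDeriv_errorLaw (i : ℕ) (hi : i ≤ 1) :
    Integrable (fun s => s ^ i * scaleScoreDeriv f α s) (errorLaw f) := by
  simp only [pow_mul_scaleScoreDeriv hf hreg]
  exact ((integrable_psi_errorLaw hf hreg i (by omega)).const_mul _).add
    (integrable_deriv_psi_errorLaw hf hreg (i + 1) (by omega))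

/-- The two summands of `scaleScoreDeriv` are handled by the two integrations by parts above. The
values at `i = 0, 1` are `-2ζ₁₂` and `-4ζ₂₂`; the scaling `κ = φ/(2σ)` of the variance coordinate
and the division of the scale score by `2σ` turn them into entries of `-Ψ`. -/
lemma integral_scaleScoreDeriv_errorLaw (i : ℕ) (hi : i ≤ 1) :
    ∫ s, s ^ i * scaleScoreDeriv f α s ∂(errorLaw f) =
      -(i * M f α 0 0) - ((i + 1) * M f α i 1) - M f α (i + 1) 2 := by
  simp only [pow_mul_scaleScoreDeriv hf hreg]
  rw [integral_add ((integrable_psi_errorLaw hf hreg i (by omega)).const_mul _)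
    (integrable_deriv_psi_errorLaw hf hreg (i + 1) (by omega)), integral_const_mul,
    integral_pow_mul_psi_errorLaw hf hreg, integral_by_parts_power hf hreg i hi,
    hf.integral_errorLaw, integral_pow_mul_deriv_psi hf hreg (i + 1) (by omega)]
  push_cast
  ring_nf

lemma integral_scaleScoreDeriv_zero :
    ∫ s, scaleScoreDeriv f α s ∂(errorLaw f) = -(2 * zeta12 f α) := by
  have := integral_scaleScoreDeriv_errorLaw hf hreg 0 (by norm_num)
  simp only [pow_zero, one_mul] at this
  rw [this, zeta12]
  push_cast; ring_nf

lemma integral_scaleScoreDeriv_one :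
    ∫ s, s * scaleScoreDeriv f α s ∂(errorLaw f) = -(4 * zeta22 f α) := by
  have := integral_scaleScoreDeriv_errorLaw hf hreg 1 (by norm_num)
  simp only [pow_one] at this
  rw [this, zeta22]
  push_cast; ring_nf

lemma sq_rpow_mul_density (s : ℝ) : (f s ^ α) ^ 2 * f s = f s ^ (1 + 2 * α) := by
  rw [Real.rpow_add (hf.pos s), Real.rpow_one, two_mul, Real.rpow_add (hf.pos s)]; ring

lemma integrable_psi_sq : Integrable (fun s => psi f α s ^ 2) (errorLaw f) := by
  rw [hf.integrable_errorLaw_iff]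
  refine (hreg.integrable_two 0 (by norm_num) 2 le_rfl).congr (ae_of_all _ fun s => ?_)
  simp only [mIntegrand, psi, ← sq_rpow_mul_density hf hreg]; ring

lemma integral_psi_sq : ∫ s, psi f α s ^ 2 ∂(errorLaw f) = zeta11 f (2 * α) := by
  rw [hf.integral_errorLaw, zeta11, M]
  congr 1; ext s
  simp only [mIntegrand, psi, ← sq_rpow_mul_density hf hreg]; ring

lemma integrable_psi_mul_scaleScore :
    Integrable (fun s => psi f α s * scaleScore f α s) (errorLaw f) := by
  rw [hf.integrable_errorLaw_iff]
  refine ((hreg.integrable_two 0 (by norm_num) 1 (by norm_num)).add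
    (hreg.integrable_two 1 (by norm_num) 2 (by norm_num))).congr (ae_of_all _ fun s => ?_)
  simp only [Pi.add_apply, mIntegrand, psi, scaleScore, ← sq_rpow_mul_density hf hreg]; ring

lemma integral_psi_mul_scaleScore :
    ∫ s, psi f α s * scaleScore f α s ∂(errorLaw f) = 2 * zeta12 f (2 * α) := by
  rw [hf.integral_errorLaw, zeta12, M, M,
    ← integral_add (hreg.integrable_two 0 (by norm_num) 1 (by norm_num))
    (hreg.integrable_two 1 (by norm_num) 2 (by norm_num)), mul_div_cancel₀ _ two_ne_zero]
  congr 1; ext s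
  simp only [mIntegrand, psi, scaleScore, ← sq_rpow_mul_density hf hreg]; ring

lemma integrable_scaleScore_sq :
    Integrable (fun s => scaleScore f α s ^ 2) (errorLaw f) := by
  rw [hf.integrable_errorLaw_iff]
  refine (((hreg.integrable_two 0 (by norm_num) 0 (by norm_num)).add
    ((hreg.integrable_two 1 (by norm_num) 1 (by norm_num)).const_mul 2)).add
    (hreg.integrable_two 2 (by norm_num) 2 (by norm_num))).congr (ae_of_all _ fun s => ?_)
  simp only [Pi.add_apply, mIntegrand, scaleScore, ← sq_rpow_mul_density hf hreg]; ring

lemma integral_scaleScore_sq :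
    ∫ s, scaleScore f α s ^ 2 ∂(errorLaw f) = 4 * zeta22 f (2 * α) := by
  have i0 := hreg.integrable_two 0 (by norm_num) 0 (by norm_num)
  have i1 := (hreg.integrable_two 1 (by norm_num) 1 (by norm_num)).const_mul 2
  have i2 := hreg.integrable_two 2 (by norm_num) 2 (by norm_num)
  rw [hf.integral_errorLaw, zeta22, mul_div_cancel₀ _ four_ne_zero]
  simp only [M]
  have i21 : Integrable fun s => mIntegrand f (2 * α) 2 2 s + 2 * mIntegrand f (2 * α) 1 1 s :=
    i2.add i1
  rw [← integral_const_mul, ← integral_add i2 i1, ← integral_add i21 i0]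
  congr 1; ext s
  simp only [mIntegrand, scaleScore, ← sq_rpow_mul_density hf hreg]; ring

lemma integrable_psi_mul_centredScaleScore :
    Integrable (fun s => psi f α s * centredScaleScore f α s) (errorLaw f) := by
  simp only [centredScaleScore, mul_sub]
  have := integrable_psi_errorLaw hf hreg 0 (by norm_num)
  simp only [pow_zero, one_mul] at this
  exact (integrable_psi_mul_scaleScore hf hreg).sub (this.mul_const _)

/-- Centring changes nothing because `ψ` has mean zero; for the same reason `φ₁ = 0`, so the
correction `φ₁φ₂` vanishes. -/
lemma integral_psi_mul_centredScaleScore (hα : 0 ≤ α) :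
    ∫ s, psi f α s * centredScaleScore f α s ∂(errorLaw f) =
      2 * (zeta12 f (2 * α) - phi1 f α * phi2 f α) := by
  simp only [centredScaleScore, mul_sub]
  have := integrable_psi_errorLaw hf hreg 0 (by norm_num)
  simp only [pow_zero, one_mul] at this
  rw [integral_sub (integrable_psi_mul_scaleScore hf hreg) (this.mul_const _), integral_mul_const,
    integral_psi_errorLaw hf hreg hα, integral_psi_mul_scaleScore hf hreg, phi1,
    M_zero_one hf hreg hα]
  ring

lemma integrable_centredScaleScore_sq :
    Integrable (fun s => centredScaleScore f α s ^ 2) (errorLaw f) := by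
  have := hf.isProbabilityMeasure
  have h : (fun s => centredScaleScore f α s ^ 2) = fun s => scaleScore f α s ^ 2
      - 2 * (α * M f α 0 0 / (1 + α)) * scaleScore f α s + (α * M f α 0 0 / (1 + α)) ^ 2 := by
    ext s; simp only [centredScaleScore]; ring
  rw [h]
  exact ((integrable_scaleScore_sq hf hreg).sub
    ((integrable_scaleScore_errorLaw hf hreg).const_mul _)).add (integrable_const _)

lemma integral_centredScaleScore_sq (hα : 0 ≤ α) :
    ∫ s, centredScaleScore f α s ^ 2 ∂(errorLaw f) =
      4 * (zeta22 f (2 * α) - phi2 f α ^ 2) := by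
  have := hf.isProbabilityMeasure
  have h : (fun s => centredScaleScore f α s ^ 2) = fun s => (scaleScore f α s ^ 2
      - 2 * (α * M f α 0 0 / (1 + α)) * scaleScore f α s) + (α * M f α 0 0 / (1 + α)) ^ 2 := by
    ext s; simp only [centredScaleScore]; ring
  -- The centring constant is the mean `M₀₀ + M₁₁ = -2φ₂`, hence the variance is `4ζ₂₂ - 4φ₂²` with
  -- `ζ₂₂` taken at `2α`.
  have h2 : α * M f α 0 0 / (1 + α) = -2 * phi2 f α := by
    rw [phi2, div_eq_iff (by linarith)]
    linear_combination -M_one_one hf hreg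
  have i1 : Integrable (fun s => scaleScore f α s ^ 2
      - 2 * (α * M f α 0 0 / (1 + α)) * scaleScore f α s) (errorLaw f) :=
    (integrable_scaleScore_sq hf hreg).sub
      ((integrable_scaleScore_errorLaw hf hreg).const_mul _)
  rw [h, integral_add i1 (integrable_const _),
    integral_sub (integrable_scaleScore_sq hf hreg)
    ((integrable_scaleScore_errorLaw hf hreg).const_mul _), integral_const_mul,
    integral_scaleScore_errorLaw hf hreg hα, integral_scaleScore_sq hf hreg, h2]
  simp
  ring

lemma continuous_centredScaleScore : Continuous (centredScaleScore f α) :=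
  (continuous_scaleScore hf hreg).sub continuous_const

lemma integrable_centredScaleScore_errorLaw :
    Integrable (centredScaleScore f α) (errorLaw f) := by
  have := hf.isProbabilityMeasure
  exact (integrable_scaleScore_errorLaw hf hreg).sub (integrable_const _)

end Moments

/-! ### Local majorants for the derivatives of the score functions -/

/-- The mean value inequality along an affine family of arguments `a + (1 + b) s`. -/
lemma abs_sub_sub_le_of_deriv_bound {k k' : ℝ → ℝ} (hk : ∀ x, HasDerivAt k (k' x) x)
    {s a b a' b' D B : ℝ} (hB : ∀ τ ∈ Set.Icc (0 : ℝ) 1,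
      |k' ((a' + τ * (a - a')) + (1 + (b' + τ * (b - b'))) * s) - D| ≤ B) :
    |k (a + (1 + b) * s) - k (a' + (1 + b') * s) - D * ((a - a') + (b - b') * s)| ≤
      B * (1 + |s|) * (|a - a'| + |b - b'|) := by
  set d := (a - a') + (b - b') * s with hd
  have hB0 : 0 ≤ B := (abs_nonneg _).trans (hB 0 (by simp))
  have hline : ∀ τ : ℝ, HasDerivAt
      (fun τ => (a' + τ * (a - a')) + (1 + (b' + τ * (b - b'))) * s) d τ := fun τ => by
    have h1 := (((hasDerivAt_id τ).mul_const (a - a')).const_add a')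
    have h2 := (((((hasDerivAt_id τ).mul_const (b - b')).const_add b').const_add 1).mul_const s)
    convert! h1.add h2 using 1
    rw [hd]; ring
  -- Subtracting `τ D d` along the segment leaves the derivative `(k' - D) d`, to which the bound
  -- `B` applies.
  have hder : ∀ τ ∈ Set.Icc (0 : ℝ) 1, HasDerivWithinAt
      (fun τ => k ((a' + τ * (a - a')) + (1 + (b' + τ * (b - b'))) * s) - τ * (D * d))
      ((k' ((a' + τ * (a - a')) + (1 + (b' + τ * (b - b'))) * s) - D) * d)
      (Set.Icc 0 1) τ := fun τ _ => by
    have h1 := (hk ((a' + τ * (a - a')) + (1 + (b' + τ * (b - b'))) * s)).comp τ (hline τ)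
    have h2 := h1.sub ((hasDerivAt_id τ).mul_const (D * d))
    convert! h2.hasDerivWithinAt using 1
    ring
  have hd1 : |d| ≤ (1 + |s|) * (|a - a'| + |b - b'|) := by
    have := abs_add_le (a - a') ((b - b') * s)
    rw [abs_mul] at this
    nlinarith [abs_nonneg s, abs_nonneg (a - a'), abs_nonneg (b - b')]
  have := norm_image_sub_le_of_norm_deriv_le_segment_01' hder
    (C := B * ((1 + |s|) * (|a - a'| + |b - b'|))) fun τ hτ => by
      rw [Real.norm_eq_abs, abs_mul]
      exact mul_le_mul (hB τ ⟨hτ.1, hτ.2.le⟩) hd1 (abs_nonneg _) hB0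
  rw [Real.norm_eq_abs] at this
  convert! this using 1
  · congr 1; ring_nf
  · ring

/-- A function `k` is dominated along small shifts and rescalings of its argument, with the
weight `1 + |s|`, by a function integrable with respect to `ν`. -/
def LocallyDominated (ν : Measure ℝ) (k : ℝ → ℝ) : Prop :=
  ∃ δ > 0, ∃ G : ℝ → ℝ, Integrable G ν ∧ ∀ s a b : ℝ, |a| ≤ δ → |b| ≤ δ →
    (1 + |s|) * |k (a + (1 + b) * s)| ≤ G s

/-- With `r = a + (1 + b)s` one has `|s| ≤ |r| + |a| + |b||s|`, and `|b| ≤ 1/2` absorbs the last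
term. This trades weights in the perturbed argument for weights in `s`. -/
lemma one_add_abs_le {δ s a b : ℝ} (hδ : δ ≤ 1 / 2) (ha : |a| ≤ δ) (hb : |b| ≤ δ) :
    1 + |s| ≤ 2 * (1 + |a + (1 + b) * s|) := by
  have h1 : s = (a + (1 + b) * s) - a - b * s := by ring
  have h2 : |s| ≤ |a + (1 + b) * s| + |a| + |b| * |s| := by
    conv_lhs => rw [h1]
    rw [← abs_mul]
    exact (abs_sub _ _).trans (add_le_add_left (abs_sub _ _) _)
  nlinarith [abs_nonneg s]

section

variable {f : ℝ → ℝ} {α : ℝ} (hf : IsErrorDensity f α) (hreg : IsRegularDensity f α)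
include hf hreg

/-- Uses `(1 + |r|)² ≤ 2(1 + r²)`; shrinking `δ` to at most `1/2` makes `one_add_abs_le` available.
-/
lemma exists_quadratic_majorant : ∃ δ > 0, δ ≤ 1 / 2 ∧ ∃ G : ℝ → ℝ, Integrable G (errorLaw f) ∧
    ∀ s a b : ℝ, |a| ≤ δ → |b| ≤ δ →
      (1 + |a + (1 + b) * s|) ^ 2 * |deriv (psi f α) (a + (1 + b) * s)| ≤ G s := by
  obtain ⟨δ, hδ, g, hg, hdom⟩ := hreg.dominated
  refine ⟨min δ (1 / 2), by positivity, min_le_right _ _, fun s => 2 * g s, ?_,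
    fun s a b ha hb => ?_⟩
  · exact (hf.integrable_errorLaw_iff.2 hg).const_mul 2
  · have h := hdom s a b (ha.trans (min_le_left _ _)) (hb.trans (min_le_left _ _))
    refine le_trans ?_ (mul_le_mul_of_nonneg_left h zero_le_two)
    rw [← mul_assoc]
    refine mul_le_mul_of_nonneg_right ?_ (abs_nonneg _)
    nlinarith [sq_nonneg (|a + (1 + b) * s| - 1), sq_abs (a + (1 + b) * s)]

lemma locallyDominated_deriv_psi : LocallyDominated (errorLaw f) (deriv (psi f α)) := by
  obtain ⟨δ, hδ, hδ2, G, hG, hdom⟩ := exists_quadratic_majorant hf hreg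
  refine ⟨δ, hδ, fun s => 2 * G s, hG.const_mul 2, fun s a b ha hb => ?_⟩
  refine le_trans ?_ (mul_le_mul_of_nonneg_left (hdom s a b ha hb) zero_le_two)
  rw [← mul_assoc]
  refine mul_le_mul_of_nonneg_right ((one_add_abs_le hδ2 ha hb).trans ?_) (abs_nonneg _)
  nlinarith [abs_nonneg (a + (1 + b) * s)]

/-- The perturbation displaces `s` by at most `(1 + |s|)(|a| + |b|)`, while `ψ'` is bounded by
`4G/(1 + |s|)²` along the way. So `ψ` changes by at most `4G/(1 + |s|)`, which still leaves one
power for the weight. -/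
lemma locallyDominated_psi : LocallyDominated (errorLaw f) (psi f α) := by
  obtain ⟨δ, hδ, hδ2, G, hG, hdom⟩ := exists_quadratic_majorant hf hreg
  have i0 := (integrable_psi_errorLaw hf hreg 0 (by norm_num)).abs
  have i1 := (integrable_psi_errorLaw hf hreg 1 (by norm_num)).abs
  refine ⟨δ, hδ, fun s => (|s ^ 0 * psi f α s| + |s ^ 1 * psi f α s|) + 4 * G s,
    (i0.add i1).add (hG.const_mul 4), fun s a b ha hb => ?_⟩
  have hs : 0 < 1 + |s| := by positivity
  -- `D = 0` gives the plain mean value inequality, and the constant `4` is the square of the factor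
  -- in `one_add_abs_le`.
  have h := abs_sub_sub_le_of_deriv_bound (hasDerivAt_psi hf hreg) (s := s) (a := a) (b := b)
    (a' := 0) (b' := 0) (D := 0) (B := 4 * G s / (1 + |s|) ^ 2) fun τ hτ => by
      have hτa : |τ * a| ≤ δ := by
        rw [abs_mul, abs_of_nonneg hτ.1]; nlinarith [abs_nonneg a, hτ.2]
      have hτb : |τ * b| ≤ δ := by
        rw [abs_mul, abs_of_nonneg hτ.1]; nlinarith [abs_nonneg b, hτ.2]
      simp only [sub_zero, zero_add]
      rw [le_div_iff₀ (by positivity)]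
      have h1 := hdom s _ _ hτa hτb
      have h2 := pow_le_pow_left₀ hs.le (one_add_abs_le (s := s) hδ2 hτa hτb) 2
      nlinarith [mul_le_mul_of_nonneg_right h2
        (abs_nonneg (deriv (psi f α) (τ * a + (1 + τ * b) * s)))]
  simp only [sub_zero, zero_mul, add_zero, one_mul, zero_add] at h
  have hG0 : 0 ≤ G s := le_trans (by positivity) (hdom s a b ha hb)
  have h3 : |psi f α (a + (1 + b) * s)| ≤ |psi f α s| + 4 * G s / (1 + |s|) := by
    have h4 : 4 * G s / (1 + |s|) ^ 2 * (1 + |s|) * (|a| + |b|) ≤ 4 * G s / (1 + |s|) := by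
      have : 4 * G s / (1 + |s|) ^ 2 * (1 + |s|) = 4 * G s / (1 + |s|) := by field_simp
      rw [this]
      exact mul_le_of_le_one_right (by positivity) (by linarith)
    have := abs_sub_abs_le_abs_sub (psi f α (a + (1 + b) * s)) (psi f α s)
    linarith
  calc (1 + |s|) * |psi f α (a + (1 + b) * s)|
      ≤ (1 + |s|) * (|psi f α s| + 4 * G s / (1 + |s|)) := mul_le_mul_of_nonneg_left h3 hs.le
    _ = _ := by rw [mul_add, mul_div_cancel₀ _ hs.ne']; simp only [abs_mul]; simp; ring

/-- In the term `rψ'(r)` the factor `r` uses one power of the quadratic weight and `1 + |s|` the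
other; the term in `ψ` is already dominated. -/
lemma locallyDominated_scaleScoreDeriv :
    LocallyDominated (errorLaw f) (scaleScoreDeriv f α) := by
  obtain ⟨δ, hδ, hδ2, G, hG, hdom⟩ := exists_quadratic_majorant hf hreg
  obtain ⟨δ', hδ', G', hG', hdom'⟩ := locallyDominated_psi hf hreg
  refine ⟨min δ δ', by positivity, fun s => |1 + α| * G' s + 2 * G s,
    (hG'.const_mul _).add (hG.const_mul 2), fun s a b ha hb => ?_⟩
  have ha1 := ha.trans (min_le_left δ δ')
  have hb1 := hb.trans (min_le_left δ δ')
  have h1 := hdom s a b ha1 hb1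
  have h2 := hdom' s a b (ha.trans (min_le_right _ _)) (hb.trans (min_le_right _ _))
  have h3 := one_add_abs_le (s := s) hδ2 ha1 hb1
  set r := a + (1 + b) * s
  have h4 : |scaleScoreDeriv f α r| ≤ |1 + α| * |psi f α r| + |r| * |deriv (psi f α) r| := by
    rw [← abs_mul, ← abs_mul]; exact abs_add_le _ _
  have hs : 0 ≤ 1 + |s| := by positivity
  have h5 : (1 + |s|) * (|r| * |deriv (psi f α) r|) ≤ 2 * G s := by
    rw [← mul_assoc]
    refine le_trans ?_ (mul_le_mul_of_nonneg_left h1 zero_le_two)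
    rw [← mul_assoc]
    refine mul_le_mul_of_nonneg_right ?_ (abs_nonneg _)
    nlinarith [mul_le_mul_of_nonneg_right h3 (abs_nonneg r), abs_nonneg r]
  calc (1 + |s|) * |scaleScoreDeriv f α r|
      ≤ (1 + |s|) * (|1 + α| * |psi f α r| + |r| * |deriv (psi f α) r|) :=
        mul_le_mul_of_nonneg_left h4 hs
    _ = |1 + α| * ((1 + |s|) * |psi f α r|) + (1 + |s|) * (|r| * |deriv (psi f α) r|) := by ring
    _ ≤ _ := add_le_add (mul_le_mul_of_nonneg_left h2 (abs_nonneg _)) h5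

end

/-- The oscillation of `k` over the arguments `ρ a + (1 + ρ b) s` with `|a|, |b| ≤ 1`. -/
def osc (k : ℝ → ℝ) (ρ s : ℝ) : ℝ :=
  sSup ((fun p : ℝ × ℝ => |k (ρ * p.1 + (1 + ρ * p.2) * s) - k s|) ''
    (Set.Icc (-1) 1 ×ˢ Set.Icc (-1) 1))

/-! ### Small oscillation by dominated convergence. -/

section Oscillation

variable {k : ℝ → ℝ}

/-- The supremum runs over a fixed compact box, with `ρ` scaling the argument instead of the box, so
joint continuity is inherited. It yields measurability in `s` as well as the limit `ρ → 0`. -/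
lemma continuous_osc (hk : Continuous k) : Continuous fun x : ℝ × ℝ => osc k x.1 x.2 := by
  refine IsCompact.continuous_sSup (isCompact_Icc.prod isCompact_Icc) (f := fun x : ℝ × ℝ =>
    fun p : ℝ × ℝ => |k (x.1 * p.1 + (1 + x.1 * p.2) * x.2) - k x.2|) ?_
  simp only [Function.HasUncurry.uncurry, id]
  fun_prop

lemma le_osc (hk : Continuous k) {ρ s a b : ℝ} (hρ : 0 < ρ) (ha : |a| ≤ ρ) (hb : |b| ≤ ρ) :
    |k (a + (1 + b) * s) - k s| ≤ osc k ρ s := by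
  refine le_csSup ((isCompact_Icc.prod isCompact_Icc).image (by fun_prop)).bddAbove
    ⟨(a / ρ, b / ρ), ⟨?_, ?_⟩, ?_⟩
  · rw [Set.mem_Icc, ← abs_le, abs_div, abs_of_pos hρ]; exact (div_le_one hρ).2 ha
  · rw [Set.mem_Icc, ← abs_le, abs_div, abs_of_pos hρ]; exact (div_le_one hρ).2 hb
  · simp only [mul_div_cancel₀ _ hρ.ne']

lemma osc_nonneg (k : ℝ → ℝ) (ρ s : ℝ) : 0 ≤ osc k ρ s :=
  Real.sSup_nonneg (by rintro _ ⟨p, _, rfl⟩; exact abs_nonneg _)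

lemma osc_zero (k : ℝ → ℝ) (s : ℝ) : osc k 0 s = 0 := by
  have : (fun p : ℝ × ℝ => |k (0 * p.1 + (1 + 0 * p.2) * s) - k s|) = fun _ => 0 := by
    ext p; simp
  rw [osc, this]
  refine le_antisymm (Real.sSup_nonpos ?_) (Real.sSup_nonneg ?_) <;>
  · rintro _ ⟨p, _, rfl⟩; exact le_rfl

/-- The weighted oscillation tends to zero pointwise as `ρ → 0` and stays below `2G`, so dominated
convergence makes its integral small; it serves as `W`. -/
lemma exists_oscillation_majorant {ν : Measure ℝ} (hk : Continuous k)
    (hdom : LocallyDominated ν k) {ε : ℝ} (hε : 0 < ε) :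
    ∃ ρ > 0, ∃ W : ℝ → ℝ, Continuous W ∧ (∀ s, 0 ≤ W s) ∧ Integrable W ν ∧ ∫ s, W s ∂ν < ε ∧
      ∀ s a b : ℝ, |a| ≤ ρ → |b| ≤ ρ → |k (a + (1 + b) * s) - k s| * (1 + |s|) ≤ W s := by
  obtain ⟨δ, hδ, G, hG, hdom⟩ := hdom
  have hcont : ∀ ρ, Continuous fun s => (1 + |s|) * osc k ρ s := fun ρ => by
    have := (continuous_osc hk).comp (Continuous.prodMk (continuous_const (y := ρ)) continuous_id)
    exact (by fun_prop : Continuous fun s : ℝ => 1 + |s|).mul this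
  have hbd : ∀ ρ ∈ Set.Icc 0 δ, ∀ s, ‖(1 + |s|) * osc k ρ s‖ ≤ 2 * G s := fun ρ hρ s => by
    rw [Real.norm_of_nonneg (mul_nonneg (by positivity) (osc_nonneg k ρ s)),
      ← le_div_iff₀' (by positivity)]
    have key : ∀ a b, |a| ≤ δ → |b| ≤ δ → |k (a + (1 + b) * s)| ≤ G s / (1 + |s|) :=
      fun a b ha hb => (le_div_iff₀' (by positivity)).2 (hdom s a b ha hb)
    have h0 : |k s| ≤ G s / (1 + |s|) := by
      simpa using key 0 0 (by simpa using hδ.le) (by simpa using hδ.le)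
    refine Real.sSup_le ?_ ?_
    · rintro _ ⟨p, ⟨hp1, hp2⟩, rfl⟩
      have h1 := key (ρ * p.1) (ρ * p.2)
        (by rw [abs_mul, abs_of_nonneg hρ.1]; nlinarith [abs_le.2 hp1, hρ.1, hρ.2])
        (by rw [abs_mul, abs_of_nonneg hρ.1]; nlinarith [abs_le.2 hp2, hρ.1, hρ.2])
      refine (abs_sub _ _).trans ?_
      rw [mul_div_assoc]; linarith
    · rw [mul_div_assoc]; linarith [abs_nonneg (k s)]
  have hlim : Tendsto (fun ρ => ∫ s, (1 + |s|) * osc k ρ s ∂ν) (𝓝[>] 0) (𝓝 0) := by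
    have h0 : ∫ s, (1 + |s|) * osc k 0 s ∂ν = 0 := by simp [osc_zero]
    suffices h : Tendsto (fun ρ => ∫ s, (1 + |s|) * osc k ρ s ∂ν) (𝓝[>] 0)
        (𝓝 (∫ s, (1 + |s|) * osc k 0 s ∂ν)) by rwa [h0] at h
    refine tendsto_integral_filter_of_dominated_convergence (fun s => 2 * G s) ?_ ?_
      (hG.const_mul 2) ?_
    · exact Eventually.of_forall fun ρ => (hcont ρ).aestronglyMeasurable
    · filter_upwards [Ioc_mem_nhdsGT hδ] with ρ hρ
      exact ae_of_all _ (hbd ρ ⟨hρ.1.le, hρ.2⟩)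
    · refine ae_of_all _ fun s => tendsto_nhdsWithin_of_tendsto_nhds ?_
      have := (continuous_osc hk).comp (Continuous.prodMk continuous_id (continuous_const (y := s)))
      exact (continuous_const.mul this).tendsto 0
  obtain ⟨ρ, hρε, hρ⟩ := ((hlim.eventually_lt_const hε).and (Ioc_mem_nhdsGT hδ)).exists
  refine ⟨ρ, hρ.1, fun s => (1 + |s|) * osc k ρ s, hcont ρ, fun s =>
    mul_nonneg (by positivity) (osc_nonneg k ρ s), ?_, hρε, fun s a b ha hb => ?_⟩
  · exact (hG.const_mul 2).mono' (hcont ρ).aestronglyMeasurable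
      (ae_of_all _ (hbd ρ ⟨hρ.1.le, hρ.2⟩))
  · rw [mul_comm]
    exact mul_le_mul_of_nonneg_left (le_osc hk hρ.1 ha hb) (by positivity)

/-- A function with continuous and locally dominated derivative is approximated by its
linearization, uniformly under small shifts and rescalings, up to a small integrable factor. -/
lemma exists_linearization_majorant {k k' : ℝ → ℝ} {ν : Measure ℝ}
    (hk : ∀ x, HasDerivAt k (k' x) x) (hk' : Continuous k') (hdom : LocallyDominated ν k')
    {ε : ℝ} (hε : 0 < ε) :
    ∃ ρ > 0, ∃ W : ℝ → ℝ, Continuous W ∧ (∀ s, 0 ≤ W s) ∧ Integrable W ν ∧ ∫ s, W s ∂ν < ε ∧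
      ∀ s a b a' b' : ℝ, |a| ≤ ρ → |b| ≤ ρ → |a'| ≤ ρ → |b'| ≤ ρ →
        |k (a + (1 + b) * s) - k (a' + (1 + b') * s) - k' s * ((a - a') + (b - b') * s)| ≤
          W s * (|a - a'| + |b - b'|) := by
  obtain ⟨ρ, hρ, W, hW, hW0, hWi, hWε, hosc⟩ := exists_oscillation_majorant hk' hdom hε
  refine ⟨ρ, hρ, W, hW, hW0, hWi, hWε, fun s a b a' b' ha hb ha' hb' => ?_⟩
  have hconv : ∀ {x x' : ℝ}, |x| ≤ ρ → |x'| ≤ ρ → ∀ τ ∈ Set.Icc (0 : ℝ) 1,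
      |x' + τ * (x - x')| ≤ ρ := fun {x x'} hx hx' τ hτ => by
    rw [abs_le] at *
    constructor <;> nlinarith [hτ.1, hτ.2]
  have h := abs_sub_sub_le_of_deriv_bound hk (s := s) (a := a) (b := b) (a' := a') (b' := b')
    (D := k' s) (B := W s / (1 + |s|)) fun τ hτ => by
      rw [le_div_iff₀ (by positivity)]
      exact hosc s _ _ (hconv ha ha' τ hτ) (hconv hb hb' τ hτ)
  rwa [div_mul_cancel₀ _ (by positivity)] at h

end Oscillation

/-! ### Convergence in probability -/

section InMeasure

variable {Ω : Type*} [MeasurableSpace Ω] {P : Measure Ω}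

lemma tendstoInMeasure_real_iff {Z : ℕ → Ω → ℝ} {c : ℝ} :
    TendstoInMeasure P Z atTop (fun _ => c) ↔
      ∀ ε, 0 < ε → Tendsto (fun T => P {ω | ε ≤ |Z T ω - c|}) atTop (𝓝 0) := by
  simp only [tendstoInMeasure_iff_norm, Real.norm_eq_abs]

lemma tendsto_measure_zero_of_subset_union {A B C : ℕ → Set Ω}
    (hB : Tendsto (fun T => P (B T)) atTop (𝓝 0)) (hC : Tendsto (fun T => P (C T)) atTop (𝓝 0))
    (h : ∀ T, A T ⊆ B T ∪ C T) : Tendsto (fun T => P (A T)) atTop (𝓝 0) := by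
  have := hB.add hC
  rw [add_zero] at this
  exact tendsto_of_tendsto_of_tendsto_of_le_of_le tendsto_const_nhds this (fun _ => zero_le)
    fun T => (measure_mono (h T)).trans (measure_union_le _ _)

lemma tendstoInMeasure_add {X Y : ℕ → Ω → ℝ} {c d : ℝ}
    (hX : TendstoInMeasure P X atTop fun _ => c) (hY : TendstoInMeasure P Y atTop fun _ => d) :
    TendstoInMeasure P (fun T ω => X T ω + Y T ω) atTop fun _ => c + d := by
  rw [tendstoInMeasure_real_iff] at *
  refine fun ε hε => tendsto_measure_zero_of_subset_union (hX (ε / 2) (by positivity))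
    (hY (ε / 2) (by positivity)) fun T ω hω => ?_
  simp only [Set.mem_union, Set.mem_ofPred_eq] at *
  by_contra! h
  have := abs_add_le (X T ω - c) (Y T ω - d)
  rw [show X T ω - c + (Y T ω - d) = X T ω + Y T ω - (c + d) by ring] at this
  linarith

lemma tendstoInMeasure_const (c : ℝ) :
    TendstoInMeasure P (fun (_ : ℕ) (_ : Ω) => c) atTop fun _ => c := by
  rw [tendstoInMeasure_real_iff]
  intro ε hε
  simp [not_le.2 hε]

lemma tendstoInMeasure_const_mul {X : ℕ → Ω → ℝ} {c : ℝ} (a : ℝ)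
    (hX : TendstoInMeasure P X atTop fun _ => c) :
    TendstoInMeasure P (fun T ω => a * X T ω) atTop fun _ => a * c := by
  rcases eq_or_ne a 0 with rfl | ha
  · simpa using tendstoInMeasure_const 0
  rw [tendstoInMeasure_real_iff] at *
  intro ε hε
  refine (hX (ε / |a|) (by positivity)).congr fun T => ?_
  congr 1; ext ω
  simp only [Set.mem_ofPred_eq]
  rw [← mul_sub, abs_mul, div_le_iff₀' (by positivity)]

lemma tendstoInMeasure_sum {κ : Type*} (S : Finset κ) {X : κ → ℕ → Ω → ℝ} {c : κ → ℝ}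
    (hX : ∀ i ∈ S, TendstoInMeasure P (X i) atTop fun _ => c i) :
    TendstoInMeasure P (fun T ω => ∑ i ∈ S, X i T ω) atTop fun _ => ∑ i ∈ S, c i := by
  classical
  induction S using Finset.induction_on with
  | empty => simpa using tendstoInMeasure_const 0
  | insert i S hi ih =>
    simp only [Finset.sum_insert hi]
    exact tendstoInMeasure_add (hX i (by simp)) (ih fun j hj => hX j (by simp [hj]))

/-- If `c < a`, the events `A T` lie in `{a - c ≤ |X T - c|}`, whose probabilities vanish. -/
lemma le_of_tendstoInMeasure [IsProbabilityMeasure P] {X : ℕ → Ω → ℝ} {c a : ℝ} {A : ℕ → Set Ω}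
    (hX : TendstoInMeasure P X atTop fun _ => c) (hA : Tendsto (fun T => P (A T)) atTop (𝓝 1))
    (h : ∀ T, ∀ ω ∈ A T, a ≤ X T ω) : a ≤ c := by
  by_contra! hlt
  rw [tendstoInMeasure_real_iff] at hX
  have h0 := hX ((a - c)) (by linarith)
  have : Tendsto (fun T => P (A T)) atTop (𝓝 0) := by
    refine tendsto_measure_zero_of_subset_union h0 (C := fun _ => ∅) (by simp) fun T ω hω => ?_
    left
    have := h T ω hω
    simp only [Set.mem_ofPred_eq]
    rw [abs_of_nonneg (by linarith)]
    linarith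
  exact zero_ne_one (tendsto_nhds_unique this hA)

lemma tendstoInMeasure_zero_of_integral_abs {Z : ℕ → Ω → ℝ} (hZ : ∀ T, Integrable (Z T) P)
    (h : Tendsto (fun T => ∫ ω, |Z T ω| ∂P) atTop (𝓝 0)) :
    TendstoInMeasure P Z atTop fun _ => 0 := by
  rw [tendstoInMeasure_real_iff]
  intro ε hε
  have h1 : Tendsto (fun T => ENNReal.ofReal ((∫ ω, |Z T ω| ∂P) / ε)) atTop (𝓝 0) := by
    have := (ENNReal.continuous_ofReal.tendsto _).comp (h.div_const ε)
    rwa [zero_div, ENNReal.ofReal_zero] at this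
  refine tendsto_of_tendsto_of_tendsto_of_le_of_le tendsto_const_nhds h1 (fun _ => zero_le)
    fun T => ?_
  rw [ENNReal.ofReal_div_of_pos hε, ENNReal.le_div_iff_mul_le (Or.inl (by simpa using hε))
    (Or.inl ENNReal.ofReal_ne_top), mul_comm,
    ofReal_integral_eq_lintegral_ofReal (hZ T).abs (ae_of_all _ fun ω => abs_nonneg _)]
  have := mul_meas_ge_le_lintegral₀ (μ := P) (f := fun ω => ENNReal.ofReal |Z T ω|)
    (hZ T).abs.aemeasurable.ennreal_ofReal (ENNReal.ofReal ε)
  simpa [ENNReal.ofReal_le_ofReal_iff (abs_nonneg _)] using this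

end InMeasure

/-! ### A weak law of large numbers with random weights -/

section WeakLaw

variable {Ω : Type*} [MeasurableSpace Ω] {P : Measure Ω} [IsProbabilityMeasure P]
  {ν : Measure ℝ} {s p : ℕ → Ω → ℝ} {C : ℝ}

/-- The weights may depend on each other arbitrarily, but they are independent of the errors and
factor out of each cross moment. What remains is a product of two vanishing means, so only the
diagonal survives. -/
lemma integral_sq_weighted_sum_le (hs : ∀ t, Measurable (s t)) (hlaw : ∀ t, P.map (s t) = ν)
    (hind : iIndepFun s P) (hp : ∀ t, Measurable (p t))
    (hexo : IndepFun (fun ω t => p t ω) (fun ω t => s t ω) P)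
    (hC : ∀ t, ∀ᵐ ω ∂P, |p t ω| ≤ C) {k : ℝ → ℝ} (hk : Measurable k) {B : ℝ}
    (hB : ∀ x, |k x| ≤ B) (hk0 : ∫ x, k x ∂ν = 0) (T : ℕ) :
    ∫ ω, (∑ t ∈ Finset.range T, p t ω * k (s t ω)) ^ 2 ∂P ≤ T * (C * B) ^ 2 := by
  have hB0 : 0 ≤ B := (abs_nonneg _).trans (hB 0)
  have hbd : ∀ t, ∀ᵐ ω ∂P, ‖p t ω * k (s t ω)‖ ≤ C * B := fun t => by
    filter_upwards [hC t] with ω h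
    rw [Real.norm_eq_abs, abs_mul]
    exact mul_le_mul h (hB _) (abs_nonneg _) ((abs_nonneg _).trans h)
  have hmeas : ∀ t, Measurable fun ω => p t ω * k (s t ω) := fun t =>
    (hp t).mul (hk.comp (hs t))
  have hint : ∀ t t', Integrable (fun ω => p t ω * k (s t ω) * (p t' ω * k (s t' ω))) P :=
    fun t t' => by
      refine Integrable.of_bound ((hmeas t).mul (hmeas t')).aestronglyMeasurable
        ((C * B) * (C * B)) ?_
      filter_upwards [hbd t, hbd t'] with ω h h'
      rw [norm_mul]
      exact mul_le_mul h h' (norm_nonneg _) ((norm_nonneg _).trans h)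
  have hoff : ∀ t t', t ≠ t' → ∫ ω, p t ω * k (s t ω) * (p t' ω * k (s t' ω)) ∂P = 0 := by
    intro t t' htt
    have h1 : IndepFun (fun ω => p t ω * p t' ω) (fun ω => k (s t ω) * k (s t' ω)) P :=
      hexo.comp (φ := fun x : ℕ → ℝ => x t * x t') (ψ := fun x : ℕ → ℝ => k (x t) * k (x t'))
        (by fun_prop) (by fun_prop)
    have h2 : IndepFun (fun ω => k (s t ω)) (fun ω => k (s t' ω)) P :=
      (hind.indepFun htt).comp hk hk
    have h3 : ∫ ω, k (s t ω) ∂P = 0 := by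
      rw [← hk0, ← hlaw t, integral_map (hs t).aemeasurable hk.aestronglyMeasurable]
    calc _ = ∫ ω, (p t ω * p t' ω) * (k (s t ω) * k (s t' ω)) ∂P := by
          congr 1; ext ω; ring
      _ = (∫ ω, p t ω * p t' ω ∂P) * ∫ ω, k (s t ω) * k (s t' ω) ∂P :=
          h1.integral_fun_mul_eq_mul_integral ((hp t).mul (hp t')).aestronglyMeasurable
            ((hk.comp (hs t)).mul (hk.comp (hs t'))).aestronglyMeasurable
      _ = (∫ ω, p t ω * p t' ω ∂P) * ((∫ ω, k (s t ω) ∂P) * ∫ ω, k (s t' ω) ∂P) := by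
          rw [h2.integral_fun_mul_eq_mul_integral (hk.comp (hs t)).aestronglyMeasurable
            (hk.comp (hs t')).aestronglyMeasurable]
      _ = 0 := by rw [h3]; simp
  have hdiag : ∀ t, ∫ ω, p t ω * k (s t ω) * (p t ω * k (s t ω)) ∂P ≤ (C * B) ^ 2 := fun t => by
    have : ∫ _ω, (C * B) ^ 2 ∂P = (C * B) ^ 2 := by simp
    rw [← this]
    refine integral_mono_ae (hint t t) (integrable_const _) ?_
    filter_upwards [hbd t] with ω h
    have := pow_le_pow_left₀ (norm_nonneg _) h 2
    rw [Real.norm_eq_abs, sq_abs] at this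
    linarith
  have hsq : ∀ ω, (∑ t ∈ Finset.range T, p t ω * k (s t ω)) ^ 2 =
      ∑ t ∈ Finset.range T, ∑ t' ∈ Finset.range T,
        p t ω * k (s t ω) * (p t' ω * k (s t' ω)) := fun ω => by
    rw [sq, Finset.sum_mul_sum]
  simp_rw [hsq]
  rw [integral_finsetSum _ fun t _ => integrable_finsetSum _ fun t' _ => hint t t']
  calc _ ≤ ∑ _t ∈ Finset.range T, (C * B) ^ 2 := by
        refine Finset.sum_le_sum fun t ht => ?_
        rw [integral_finsetSum _ fun t' _ => hint t t',
          Finset.sum_eq_single_of_mem t ht fun t' _ h => hoff t t' h.symm]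
        exact hdiag t
    _ = _ := by simp

variable [IsProbabilityMeasure ν]

/-- Bounded continuous functions are dense in `L¹`. An approximation within `ε/2` of the centred `k`
has mean at most `ε/2`, so recentring costs another `ε/2`. -/
lemma exists_bounded_centred_approx {k : ℝ → ℝ} (hki : Integrable k ν) (hk0 : ∫ x, k x ∂ν = 0)
    {ε : ℝ} (hε : 0 < ε) : ∃ (g : ℝ → ℝ) (B : ℝ), Measurable g ∧ (∀ x, |g x| ≤ B) ∧
      ∫ x, g x ∂ν = 0 ∧ Integrable g ν ∧ ∫ x, |k x - g x| ∂ν ≤ ε := by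
  obtain ⟨g, hg, hgi⟩ := hki.exists_boundedContinuous_integral_sub_le (half_pos hε)
  have hm : |∫ x, g x ∂ν| ≤ ε / 2 := by
    have h1 : ∫ x, g x ∂ν = -∫ x, (k x - g x) ∂ν := by rw [integral_sub hki hgi, hk0]; simp
    rw [h1, abs_neg]
    exact (abs_integral_le_integral_abs).trans hg
  refine ⟨fun x => g x - ∫ y, g y ∂ν, ‖g‖ + |∫ y, g y ∂ν|, ?_, fun x => ?_, ?_,
    hgi.sub (integrable_const _), ?_⟩
  · exact g.continuous.measurable.sub measurable_const
  · exact (abs_sub _ _).trans (add_le_add_left (g.norm_coe_le_norm x) _)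
  · rw [integral_sub hgi (integrable_const _)]; simp
  · have h2 : ∀ x, |k x - (g x - ∫ y, g y ∂ν)| ≤ ‖k x - g x‖ + ε / 2 := fun x => by
      rw [Real.norm_eq_abs, ← sub_add]
      exact (abs_add_le _ _).trans (add_le_add_right hm _)
    have i1 : Integrable (fun x => ‖k x - g x‖) ν := (hki.sub hgi).norm
    calc _ ≤ ∫ x, (‖k x - g x‖ + ε / 2) ∂ν :=
          integral_mono (hki.sub (hgi.sub (integrable_const _))).abs
            (i1.add (integrable_const _)) h2
      _ = (∫ x, ‖k x - g x‖ ∂ν) + ε / 2 := by rw [integral_add i1 (integrable_const _)]; simp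
      _ ≤ ε := by linarith

lemma integral_abs_weighted_le (hs : ∀ t, Measurable (s t)) (hlaw : ∀ t, P.map (s t) = ν)
    (hp : ∀ t, Measurable (p t)) (hC : ∀ t, ∀ᵐ ω ∂P, |p t ω| ≤ C) {k : ℝ → ℝ} (hk : Measurable k)
    (hki : Integrable k ν) (t : ℕ) :
    Integrable (fun ω => p t ω * k (s t ω)) P ∧
      ∫ ω, |p t ω * k (s t ω)| ∂P ≤ C * ∫ x, |k x| ∂ν := by
  have h1 : Integrable (fun ω => k (s t ω)) P := by
    rw [← hlaw t] at hki
    exact hki.comp_measurable (hs t)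
  have h2 : Integrable (fun ω => p t ω * k (s t ω)) P :=
    h1.bdd_mul (c := C) (hp t).aestronglyMeasurable (hC t)
  refine ⟨h2, ?_⟩
  have h3 : ∫ x, |k x| ∂ν = ∫ ω, |k (s t ω)| ∂P := by
    rw [← hlaw t, integral_map (hs t).aemeasurable hk.abs.aestronglyMeasurable]
  rw [h3, ← integral_const_mul]
  refine integral_mono_ae h2.abs (h1.abs.const_mul _) ?_
  filter_upwards [hC t] with ω h
  rw [abs_mul]
  exact mul_le_mul_of_nonneg_right h (abs_nonneg _)

/-- Since `k` is only integrable, it is split into a bounded centred `g`, to which the second moment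
bound applies, and a remainder that is small in `L¹` uniformly in `T`. -/
lemma tendstoInMeasure_weighted_centred (hs : ∀ t, Measurable (s t))
    (hlaw : ∀ t, P.map (s t) = ν)
    (hind : iIndepFun s P) (hp : ∀ t, Measurable (p t))
    (hexo : IndepFun (fun ω t => p t ω) (fun ω t => s t ω) P)
    (hC : ∀ t, ∀ᵐ ω ∂P, |p t ω| ≤ C) {k : ℝ → ℝ} (hk : Measurable k) (hki : Integrable k ν)
    (hk0 : ∫ x, k x ∂ν = 0) :
    TendstoInMeasure P (fun (T : ℕ) ω => (T : ℝ)⁻¹ * ∑ t ∈ Finset.range T, p t ω * k (s t ω)) atTop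
      fun _ => 0 := by
  have hC0 : 0 ≤ C := by
    obtain ⟨ω, h⟩ := (hC 0).exists
    exact (abs_nonneg _).trans h
  have hint : ∀ T : ℕ, Integrable
      (fun ω => (T : ℝ)⁻¹ * ∑ t ∈ Finset.range T, p t ω * k (s t ω)) P := fun T =>
    (integrable_finsetSum _ fun t _ =>
      (integral_abs_weighted_le hs hlaw hp hC hk hki t).1).const_mul _
  refine tendstoInMeasure_zero_of_integral_abs hint ?_
  rw [Metric.tendsto_atTop]
  intro ε hε
  -- Chosen so that the remainder contributes `Cκ ≤ ε/4`; `T₀` below is chosen so that the bounded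
  -- part contributes at most `ε/8 + ε/4`.
  set κ := ε / (4 * (C + 1)) with hκ
  have hκ0 : 0 < κ := by positivity
  obtain ⟨g, B, hg, hgB, hg0, hgi, hgk⟩ := exists_bounded_centred_approx hki hk0 hκ0
  obtain ⟨T₀, hT₀⟩ := exists_nat_gt ((C * B) ^ 2 / (2 * (ε / 4) ^ 2))
  refine ⟨T₀ + 1, fun T hT => ?_⟩
  have hTpos : (0 : ℝ) < T := by exact_mod_cast (by omega : 0 < T)
  rw [dist_zero_right, Real.norm_of_nonneg (integral_nonneg fun ω => abs_nonneg _)]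
  set S₁ : Ω → ℝ := fun ω => ∑ t ∈ Finset.range T, p t ω * g (s t ω) with hS₁
  set S₂ : Ω → ℝ := fun ω => ∑ t ∈ Finset.range T, |p t ω * (k (s t ω) - g (s t ω))| with hS₂
  have hkg : Integrable (fun x => k x - g x) ν := hki.sub hgi
  have hd : ∀ t, Integrable (fun ω => p t ω * (k (s t ω) - g (s t ω))) P ∧
      ∫ ω, |p t ω * (k (s t ω) - g (s t ω))| ∂P ≤ C * ∫ x, |k x - g x| ∂ν := fun t =>
    integral_abs_weighted_le hs hlaw hp hC (hk.sub hg) hkg t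
  have hS₂i : Integrable S₂ P := integrable_finsetSum _ fun t _ => (hd t).1.abs
  have hS₂b : ∫ ω, S₂ ω ∂P ≤ T * (C * κ) := by
    simp only [hS₂]
    rw [integral_finsetSum _ fun t _ => (hd t).1.abs]
    calc _ ≤ ∑ _t ∈ Finset.range T, C * κ := Finset.sum_le_sum fun t _ =>
          (hd t).2.trans (mul_le_mul_of_nonneg_left hgk hC0)
      _ = _ := by simp
  have hgbd : ∀ᵐ ω ∂P, ‖S₁ ω‖ ≤ T * (C * B) := by
    filter_upwards [ae_all_iff.2 hC] with ω h
    refine (norm_sum_le _ _).trans ?_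
    calc _ ≤ ∑ _t ∈ Finset.range T, C * B := Finset.sum_le_sum fun t _ => by
          rw [Real.norm_eq_abs, abs_mul]
          exact mul_le_mul (h t) (hgB _) (abs_nonneg _) hC0
      _ = _ := by simp
  have hS₁m : Measurable S₁ := Finset.measurable_sum _ fun t _ => (hp t).mul (hg.comp (hs t))
  have hS₁i : Integrable (fun ω => S₁ ω ^ 2) P := by
    refine Integrable.of_bound (hS₁m.pow_const 2).aestronglyMeasurable ((T * (C * B)) ^ 2) ?_
    filter_upwards [hgbd] with ω h
    rw [norm_pow]; exact pow_le_pow_left₀ (norm_nonneg _) h 2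
  have hS₁b : ∫ ω, S₁ ω ^ 2 ∂P ≤ T * (C * B) ^ 2 :=
    integral_sq_weighted_sum_le hs hlaw hind hp hexo hC hg hgB hg0 T
  -- The inequality `|x| ≤ e/2 + x²/(2e)` with `e = ε/4` feeds the second moment bound into an
  -- estimate of the first absolute moment.
  have hpt : ∀ ω, |(T : ℝ)⁻¹ * ∑ t ∈ Finset.range T, p t ω * k (s t ω)| ≤
      (ε / 4 / 2 + (2 * (ε / 4))⁻¹ * ((T : ℝ)⁻¹ ^ 2 * S₁ ω ^ 2)) + (T : ℝ)⁻¹ * S₂ ω := fun ω => by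
    have h1 : ∑ t ∈ Finset.range T, p t ω * k (s t ω) =
        S₁ ω + ∑ t ∈ Finset.range T, p t ω * (k (s t ω) - g (s t ω)) := by
      rw [hS₁, ← Finset.sum_add_distrib]
      exact Finset.sum_congr rfl fun t _ => by ring
    have h2 : |∑ t ∈ Finset.range T, p t ω * (k (s t ω) - g (s t ω))| ≤ S₂ ω :=
      Finset.abs_sum_le_sum_abs _ _
    rw [h1, mul_add]
    refine (abs_add_le _ _).trans (add_le_add ?_ ?_)
    · rw [← mul_pow]
      set x := (T : ℝ)⁻¹ * S₁ ω
      have h3 : (2 * (ε / 4))⁻¹ * x ^ 2 = x ^ 2 / (2 * (ε / 4)) := by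
        rw [mul_comm, ← div_eq_mul_inv]
      have h4 : ε / 4 / 2 + x ^ 2 / (2 * (ε / 4)) - |x| = (|x| - ε / 4) ^ 2 / (2 * (ε / 4)) := by
        rw [← sq_abs x]; field_simp; ring
      have h5 : 0 ≤ (|x| - ε / 4) ^ 2 / (2 * (ε / 4)) := by positivity
      rw [h3]; linarith
    · rw [abs_mul, abs_of_pos (inv_pos.2 hTpos)]
      exact mul_le_mul_of_nonneg_left h2 (inv_pos.2 hTpos).le
  have i1 : Integrable (fun ω => ε / 4 / 2 + (2 * (ε / 4))⁻¹ * ((T : ℝ)⁻¹ ^ 2 * S₁ ω ^ 2)) P :=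
    (integrable_const _).add ((hS₁i.const_mul _).const_mul _)
  calc ∫ ω, |(T : ℝ)⁻¹ * ∑ t ∈ Finset.range T, p t ω * k (s t ω)| ∂P
      ≤ ∫ ω, ((ε / 4 / 2 + (2 * (ε / 4))⁻¹ * ((T : ℝ)⁻¹ ^ 2 * S₁ ω ^ 2))
          + (T : ℝ)⁻¹ * S₂ ω) ∂P :=
        integral_mono (hint T).abs (i1.add (hS₂i.const_mul _)) hpt
    _ = (ε / 4 / 2 + (2 * (ε / 4))⁻¹ * ((T : ℝ)⁻¹ ^ 2 * ∫ ω, S₁ ω ^ 2 ∂P))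
          + (T : ℝ)⁻¹ * ∫ ω, S₂ ω ∂P := by
        rw [integral_add i1 (hS₂i.const_mul _), integral_add (integrable_const _)
          ((hS₁i.const_mul _).const_mul _), integral_const_mul, integral_const_mul,
          integral_const_mul]
        simp
    _ ≤ (ε / 4 / 2 + (2 * (ε / 4))⁻¹ * ((T : ℝ)⁻¹ ^ 2 * (T * (C * B) ^ 2)))
          + (T : ℝ)⁻¹ * (T * (C * κ)) := by gcongr
    _ = ε / 4 / 2 + (2 * (ε / 4))⁻¹ * ((C * B) ^ 2 / T) + C * κ := by field_simp
    _ < ε := by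
        have h6 : (C * B) ^ 2 / T < 2 * (ε / 4) ^ 2 := by
          rw [div_lt_iff₀ hTpos, ← div_lt_iff₀' (by positivity)]
          exact hT₀.trans_le (by exact_mod_cast (by omega : T₀ ≤ T))
        have h7 : (2 * (ε / 4))⁻¹ * ((C * B) ^ 2 / T) ≤ (2 * (ε / 4))⁻¹ * (2 * (ε / 4) ^ 2) :=
          mul_le_mul_of_nonneg_left h6.le (by positivity)
        have h8 : (2 * (ε / 4))⁻¹ * (2 * (ε / 4) ^ 2) = ε / 4 := by field_simp
        have h9 : C * κ ≤ ε / 4 := by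
          rw [hκ, mul_div_assoc', div_le_div_iff₀ (by positivity) (by positivity)]
          nlinarith
        linarith

/-- The weak law of large numbers for `p_t k(s_t)`, where the `s_t` are iid, `k(s_t)` is
integrable, and the bounded weights `p_t` are independent of the `s_t` and have convergent
averages. -/
theorem tendstoInMeasure_weighted (hs : ∀ t, Measurable (s t)) (hlaw : ∀ t, P.map (s t) = ν)
    (hind : iIndepFun s P) (hp : ∀ t, Measurable (p t))
    (hexo : IndepFun (fun ω t => p t ω) (fun ω t => s t ω) P)
    (hC : ∀ t, ∀ᵐ ω ∂P, |p t ω| ≤ C) {k : ℝ → ℝ} (hk : Measurable k) (hki : Integrable k ν)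
    {m : ℝ} (hm : TendstoInMeasure P
      (fun (T : ℕ) ω => (T : ℝ)⁻¹ * ∑ t ∈ Finset.range T, p t ω) atTop fun _ => m) :
    TendstoInMeasure P (fun (T : ℕ) ω => (T : ℝ)⁻¹ * ∑ t ∈ Finset.range T, p t ω * k (s t ω)) atTop
      fun _ => m * ∫ x, k x ∂ν := by
  -- Splitting off the mean of `k` leaves a centred sum plus that mean times the average weight.
  have h1 := tendstoInMeasure_weighted_centred hs hlaw hind hp hexo hC
    (hk.sub measurable_const) (hki.sub (integrable_const (∫ x, k x ∂ν)))
    (by simp only [Pi.sub_apply]; rw [integral_sub hki (integrable_const _)]; simp)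
  have h2 := tendstoInMeasure_add h1 (tendstoInMeasure_const_mul (∫ x, k x ∂ν) hm)
  convert! h2 using 2 with T
  · ext ω
    simp only [Pi.sub_apply]
    rw [mul_left_comm, ← mul_add]
    congr 1
    rw [Finset.mul_sum, ← Finset.sum_add_distrib]
    exact Finset.sum_congr rfl fun t _ => by ring
  · ring

end WeakLaw

/-! ### A conditional central limit theorem -/

/-- Taylor's bound of order `|x|³` is used for `|x| ≤ 1` and the triangle inequality otherwise. The
factor `min 1 |x|` keeps the remainder integrable when only second moments exist. -/
lemma norm_exp_I_mul_sub_le (x : ℝ) :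
    ‖Complex.exp (Complex.I * x) - (1 + Complex.I * x - (x : ℂ) ^ 2 / 2)‖ ≤
      4 * (x ^ 2 * min 1 |x|) := by
  have hn : ‖Complex.I * (x : ℂ)‖ = |x| := by simp
  rcases le_total |x| 1 with h | h
  · have := Complex.exp_bound (x := Complex.I * x) (by rw [hn]; exact h) (n := 3) (by norm_num)
    rw [hn] at this
    have h2 : ∑ m ∈ Finset.range 3, (Complex.I * (x : ℂ)) ^ m / (m.factorial : ℂ) =
        1 + Complex.I * x - (x : ℂ) ^ 2 / 2 := by
      simp [Finset.sum_range_succ, mul_pow, Nat.factorial]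
      ring
    rw [h2] at this
    refine this.trans ?_
    rw [min_eq_right h, ← sq_abs x, ← pow_succ, mul_comm]
    gcongr
    norm_num [Nat.factorial]
  · rw [min_eq_left h, mul_one]
    have h1 : ‖Complex.exp (Complex.I * x)‖ = 1 := Complex.norm_exp_I_mul_ofReal x
    have h2 : ‖(x : ℂ) ^ 2 / 2‖ = x ^ 2 / 2 := by simp
    calc _ ≤ ‖Complex.exp (Complex.I * x)‖ + (‖(1 : ℂ)‖ + ‖Complex.I * (x : ℂ)‖
          + ‖(x : ℂ) ^ 2 / 2‖) := by
          refine (norm_sub_le _ _).trans (add_le_add_right ?_ _)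
          exact (norm_sub_le _ _).trans (add_le_add_left (norm_add_le _ _) _)
      _ ≤ _ := by
          rw [h1, hn, h2, norm_one, ← sq_abs x]
          nlinarith

/-- Telescoping: the factors are exchanged one at a time, and the others have modulus at most one.
-/
lemma norm_prod_sub_prod_le {κ : Type*} (S : Finset κ) {a b : κ → ℂ} (ha : ∀ i ∈ S, ‖a i‖ ≤ 1)
    (hb : ∀ i ∈ S, ‖b i‖ ≤ 1) :
    ‖∏ i ∈ S, a i - ∏ i ∈ S, b i‖ ≤ ∑ i ∈ S, ‖a i - b i‖ := by
  classical
  induction S using Finset.induction_on with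
  | empty => simp
  | insert i S hi ih =>
    rw [Finset.prod_insert hi, Finset.prod_insert hi, Finset.sum_insert hi]
    have hS := ih (fun j hj => ha j (by simp [hj])) fun j hj => hb j (by simp [hj])
    have h1 : ‖∏ j ∈ S, a j‖ ≤ 1 := by
      rw [norm_prod]
      exact Finset.prod_le_one (fun _ _ => norm_nonneg _) fun j hj => ha j (by simp [hj])
    calc _ = ‖(a i - b i) * ∏ j ∈ S, a j + b i * (∏ j ∈ S, a j - ∏ j ∈ S, b j)‖ := by
          congr 1; ring
      _ ≤ ‖a i - b i‖ * 1 + 1 * ‖∏ j ∈ S, a j - ∏ j ∈ S, b j‖ := by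
          refine (norm_add_le _ _).trans ?_
          rw [norm_mul, norm_mul]
          gcongr
          exact hb i (by simp)
      _ ≤ _ := by rw [mul_one, one_mul]; gcongr

lemma abs_exp_neg_sub_le {y : ℝ} (hy : 0 ≤ y) : |Real.exp (-y) - (1 - y)| ≤ y ^ 2 := by
  rcases le_total y 1 with h | h
  · have := Real.abs_exp_sub_one_sub_id_le (x := -y) (by rw [abs_neg, abs_of_nonneg hy]; exact h)
    rw [neg_sq] at this
    convert! this using 2
    ring
  · have h1 := Real.one_sub_le_exp_neg y
    have h2 : Real.exp (-y) ≤ 1 := Real.exp_le_one_iff.2 (by linarith)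
    rw [abs_of_nonneg (by linarith)]
    nlinarith

/-! ### Expansion of characteristic functions, uniform under a square integrable majorant. -/

section CharacteristicFunction

variable {ν : Measure ℝ} [IsProbabilityMeasure ν]

/-- Second order expansion of a characteristic function, with an explicit remainder. -/
lemma norm_integral_exp_sub_le {z G : ℝ → ℝ} (hz : Measurable z) (hG : Measurable G)
    (hzG : ∀ r, |z r| ≤ G r) (hG2 : Integrable (fun r => G r ^ 2) ν) (hz0 : ∫ r, z r ∂ν = 0)
    (τ : ℝ) :
    ‖∫ r, Complex.exp (Complex.I * (τ * z r : ℝ)) ∂ν -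
        (Real.exp (-(τ ^ 2 * (∫ r, z r ^ 2 ∂ν) / 2)) : ℂ)‖ ≤
      4 * τ ^ 2 * ∫ r, G r ^ 2 * min 1 (|τ| * G r) ∂ν + (τ ^ 2 * (∫ r, G r ^ 2 ∂ν) / 2) ^ 2 := by
  have hG0 : ∀ r, 0 ≤ G r := fun r => (abs_nonneg _).trans (hzG r)
  have hzsq : ∀ r, z r ^ 2 ≤ G r ^ 2 := fun r => by
    rw [← sq_abs]; exact pow_le_pow_left₀ (abs_nonneg _) (hzG r) 2
  have iz2 : Integrable (fun r => z r ^ 2) ν :=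
    hG2.mono' (hz.pow_const 2).aestronglyMeasurable (ae_of_all _ fun r => by
      rw [Real.norm_of_nonneg (sq_nonneg _)]; exact hzsq r)
  have iz : Integrable z ν := by
    refine ((integrable_const (1 : ℝ)).add hG2).mono' hz.aestronglyMeasurable
      (ae_of_all _ fun r => (hzG r).trans ?_)
    simp only [Pi.add_apply]
    nlinarith [sq_nonneg (G r - 1), hG0 r]
  have ie : Integrable (fun r => Complex.exp (Complex.I * (τ * z r : ℝ))) ν := by
    refine Integrable.of_bound (C := 1) ?_ (ae_of_all _ fun r => ?_)
    · exact (by fun_prop : Measurable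
        fun r => Complex.exp (Complex.I * (τ * z r : ℝ))).aestronglyMeasurable
    · rw [Complex.norm_exp_I_mul_ofReal]
  have iR : Integrable (fun r => G r ^ 2 * min 1 (|τ| * G r)) ν := by
    refine hG2.mono' (by fun_prop) (ae_of_all _ fun r => ?_)
    rw [Real.norm_of_nonneg (mul_nonneg (sq_nonneg _) (le_min zero_le_one
      (mul_nonneg (abs_nonneg _) (hG0 r))))]
    exact mul_le_of_le_one_right (sq_nonneg _) (min_le_left _ _)
  have ic1 : Integrable (fun r => Complex.I * ((τ * z r : ℝ) : ℂ)) ν :=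
    (iz.const_mul τ).ofReal.const_mul _
  have ic2 : Integrable (fun r => ((τ * z r : ℝ) : ℂ) ^ 2 / 2) ν := by
    have := (iz2.const_mul (τ ^ 2 / 2)).ofReal (𝕜 := ℂ)
    refine this.congr (ae_of_all _ fun r => ?_)
    simp only [Complex.coe_algebraMap, RCLike.ofReal_mul]
    push_cast; ring
  have ic : Integrable (fun r => 1 + Complex.I * ((τ * z r : ℝ) : ℂ)) ν :=
    (integrable_const _).add ic1
  have hquad : ∫ r, (1 + Complex.I * ((τ * z r : ℝ) : ℂ) - ((τ * z r : ℝ) : ℂ) ^ 2 / 2) ∂ν =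
      ((1 - τ ^ 2 * (∫ r, z r ^ 2 ∂ν) / 2 : ℝ) : ℂ) := by
    rw [integral_sub ic ic2, integral_add (integrable_const _) ic1, integral_const_mul,
      integral_complex_ofReal, integral_const_mul, hz0]
    have : ∫ r, ((τ * z r : ℝ) : ℂ) ^ 2 / 2 ∂ν = ((∫ r, τ ^ 2 / 2 * z r ^ 2 ∂ν : ℝ) : ℂ) := by
      rw [← integral_complex_ofReal]
      congr 1; ext r
      push_cast; ring
    rw [this, integral_const_mul]
    simp
    ring
  -- The quadratic polynomial `1 - τ²V/2`, with `V` the second moment of `z`, is the intermediate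
  -- point between the two exponentials. Both errors are bounded through `G` alone, hence uniformly
  -- over all `z` below `G`.
  have h1 : ‖∫ r, Complex.exp (Complex.I * (τ * z r : ℝ)) ∂ν -
      ((1 - τ ^ 2 * (∫ r, z r ^ 2 ∂ν) / 2 : ℝ) : ℂ)‖ ≤
      4 * τ ^ 2 * ∫ r, G r ^ 2 * min 1 (|τ| * G r) ∂ν := by
    have i12 : Integrable (fun r =>
        1 + Complex.I * ((τ * z r : ℝ) : ℂ) - ((τ * z r : ℝ) : ℂ) ^ 2 / 2) ν := ic.sub ic2
    rw [← hquad, ← integral_sub ie i12, ← integral_const_mul]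
    refine norm_integral_le_of_norm_le (iR.const_mul _) (ae_of_all _ fun r => ?_)
    refine (norm_exp_I_mul_sub_le _).trans ?_
    rw [mul_pow, abs_mul, mul_assoc, mul_assoc]
    have := hzG r
    have := hzsq r
    gcongr
  have h2 : ‖((1 - τ ^ 2 * (∫ r, z r ^ 2 ∂ν) / 2 : ℝ) : ℂ) -
      (Real.exp (-(τ ^ 2 * (∫ r, z r ^ 2 ∂ν) / 2)) : ℂ)‖ ≤
      (τ ^ 2 * (∫ r, G r ^ 2 ∂ν) / 2) ^ 2 := by
    have hV : 0 ≤ ∫ r, z r ^ 2 ∂ν := integral_nonneg fun r => sq_nonneg _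
    have hVG : ∫ r, z r ^ 2 ∂ν ≤ ∫ r, G r ^ 2 ∂ν := integral_mono iz2 hG2 hzsq
    rw [← Complex.ofReal_sub, Complex.norm_real, Real.norm_eq_abs, abs_sub_comm]
    refine (abs_exp_neg_sub_le (by positivity)).trans ?_
    gcongr
  calc _ ≤ _ := norm_sub_le_norm_sub_add_norm_sub _
        ((1 - τ ^ 2 * (∫ r, z r ^ 2 ∂ν) / 2 : ℝ) : ℂ) _
    _ ≤ _ := add_le_add h1 h2

/-- Dominated convergence with majorant `G²`; this plays the role of the Lindeberg condition. -/
lemma tendsto_integral_min_mul {G : ℝ → ℝ} (hG : Measurable G) (hG0 : ∀ r, 0 ≤ G r)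
    (hG2 : Integrable (fun r => G r ^ 2) ν) :
    Tendsto (fun τ : ℝ => ∫ r, G r ^ 2 * min 1 (|τ| * G r) ∂ν) (𝓝 0) (𝓝 0) := by
  have h0 : ∫ r, G r ^ 2 * min 1 (|(0 : ℝ)| * G r) ∂ν = 0 := by simp
  suffices h : Tendsto (fun τ : ℝ => ∫ r, G r ^ 2 * min 1 (|τ| * G r) ∂ν) (𝓝 0)
      (𝓝 (∫ r, G r ^ 2 * min 1 (|(0 : ℝ)| * G r) ∂ν)) by rwa [h0] at h
  refine tendsto_integral_filter_of_dominated_convergence (fun r => G r ^ 2)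
    (Eventually.of_forall fun τ => by fun_prop) (Eventually.of_forall fun τ =>
      ae_of_all _ fun r => ?_) hG2 (ae_of_all _ fun r => ?_)
  · rw [Real.norm_of_nonneg (mul_nonneg (sq_nonneg _) (le_min zero_le_one
      (mul_nonneg (abs_nonneg _) (hG0 r))))]
    exact mul_le_of_le_one_right (sq_nonneg _) (min_le_left _ _)
  · exact (by fun_prop : Continuous fun τ : ℝ => G r ^ 2 * min 1 (|τ| * G r)).tendsto 0

end CharacteristicFunction

section ConditionalCLT

variable {Ω : Type*} [MeasurableSpace Ω] {P : Measure Ω} [IsProbabilityMeasure P]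
  {ν : Measure ℝ} [IsProbabilityMeasure ν] {s : ℕ → Ω → ℝ}
  {X : Type*} [MeasurableSpace X] {x : ℕ → Ω → X}

/-- Every subsequence has a further subsequence that converges almost surely, along which bounded
convergence applies. -/
lemma tendsto_integral_comp_of_tendstoInMeasure {Y : ℕ → Ω → ℝ} {c : ℝ}
    (hY : TendstoInMeasure P Y atTop fun _ => c) (hYm : ∀ T, Measurable (Y T)) {g : ℝ → ℝ}
    (hg : Continuous g) {B : ℝ} (hB : ∀ y, |g y| ≤ B) :
    Tendsto (fun T => ∫ ω, g (Y T ω) ∂P) atTop (𝓝 (g c)) := by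
  refine tendsto_of_subseq_tendsto fun ns hns => ?_
  obtain ⟨ms, -, hms⟩ := (hY.comp hns).exists_seq_tendsto_ae'
  refine ⟨ms, ?_⟩
  have h1 : ∫ _ω, g c ∂P = g c := by simp
  rw [← h1]
  refine tendsto_integral_of_dominated_convergence (fun _ => B)
    (fun T => (hg.measurable.comp (hYm _)).aestronglyMeasurable) (integrable_const _)
    (fun T => ae_of_all _ fun ω => hB _) ?_
  filter_upwards [hms] with ω h
  exact (hg.tendsto c).comp h

/-- Conditionally on the `x_t`, the factors `w(x_t, s_t)` are independent. -/
lemma integral_prod_eq_integral_prod_integral (hs : ∀ t, Measurable (s t))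
    (hlaw : ∀ t, P.map (s t) = ν) (hind : iIndepFun s P) (hx : ∀ t, Measurable (x t))
    (hexo : IndepFun (fun ω t => x t ω) (fun ω t => s t ω) P) {w : X → ℝ → ℂ}
    (hw : Measurable (Function.uncurry w)) (hw1 : ∀ a r, ‖w a r‖ ≤ 1) (T : ℕ) :
    ∫ ω, ∏ t ∈ Finset.range T, w (x t ω) (s t ω) ∂P =
      ∫ ω, ∏ t ∈ Finset.range T, (∫ r, w (x t ω) r ∂ν) ∂P := by
  set xv : Ω → Fin T → X := fun ω i => x i ω
  set sv : Ω → Fin T → ℝ := fun ω i => s i ω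
  have hxv : Measurable xv := measurable_pi_lambda _ fun i => hx i
  have hsv : Measurable sv := measurable_pi_lambda _ fun i => hs i
  have hI : IndepFun xv sv P :=
    hexo.comp (φ := fun (a : ℕ → X) (i : Fin T) => a i) (ψ := fun (a : ℕ → ℝ) (i : Fin T) => a i)
      (by fun_prop) (by fun_prop)
  have hpi : P.map sv = Measure.pi fun _ => ν := by
    have := (iIndepFun_iff_map_fun_eq_pi_map (f := fun i : Fin T => s i)
      fun i => (hs i).aemeasurable).1 (hind.precomp Fin.val_injective)
    simp only [hlaw] at this
    exact this
  -- With this product law, Fubini integrates out the errors for frozen regressors; no conditional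
  -- expectations are needed.
  have hjoint : P.map (fun ω => (xv ω, sv ω)) = (P.map xv).prod (Measure.pi fun _ => ν) := by
    rw [(indepFun_iff_map_prod_eq_prod_map_map hxv.aemeasurable hsv.aemeasurable).1 hI, hpi]
  have := Measure.isProbabilityMeasure_map hxv.aemeasurable (μ := P)
  have hF : Measurable fun q : (Fin T → X) × (Fin T → ℝ) => ∏ i, w (q.1 i) (q.2 i) := by
    refine Finset.measurable_prod _ fun i _ => ?_
    have h1 : Measurable fun q : (Fin T → X) × (Fin T → ℝ) => (q.1 i, q.2 i) := by fun_prop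
    exact hw.comp h1
  have hφ : Measurable fun a : X => ∫ r, w a r ∂ν :=
    (hw.stronglyMeasurable.integral_prod_right (ν := ν)).measurable
  simp only [Finset.prod_range]
  calc ∫ ω, ∏ i : Fin T, w (x i ω) (s i ω) ∂P
      = ∫ q, ∏ i, w (q.1 i) (q.2 i) ∂(P.map fun ω => (xv ω, sv ω)) :=
        (integral_map (hxv.prodMk hsv).aemeasurable hF.aestronglyMeasurable).symm
    _ = ∫ a, ∫ b, ∏ i, w (a i) (b i) ∂(Measure.pi fun _ => ν) ∂(P.map xv) := by
        rw [hjoint, integral_prod]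
        refine Integrable.of_bound hF.aestronglyMeasurable 1 (ae_of_all _ fun q => ?_)
        rw [norm_prod]
        exact Finset.prod_le_one (fun _ _ => norm_nonneg _) fun i _ => hw1 _ _
    _ = ∫ a, ∏ i, (∫ r, w (a i) r ∂ν) ∂(P.map xv) := by
        congr 1; ext a
        exact integral_fintype_prod_eq_prod (μ := fun _ : Fin T => ν) fun i => w (a i)
    _ = _ := integral_map hxv.aemeasurable (Finset.measurable_prod _ fun i _ =>
        hφ.comp (measurable_pi_apply i)).aestronglyMeasurable

/-- If `s_t` are iid and independent of the `x_t`, the summands `z(x_t, s_t)` have conditional mean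
zero given `x_t` and a common square integrable majorant, and the averages of the conditional
variances converge in probability to `v`, then the characteristic functions of the normalized sums
converge to the one of the centred normal law with variance `v`. -/
theorem tendsto_integral_exp_weighted_sum (hs : ∀ t, Measurable (s t))
    (hlaw : ∀ t, P.map (s t) = ν) (hind : iIndepFun s P) (hx : ∀ t, Measurable (x t))
    (hexo : IndepFun (fun ω t => x t ω) (fun ω t => s t ω) P) {z : X → ℝ → ℝ}
    (hz : Measurable (Function.uncurry z)) {G : ℝ → ℝ} (hG : Measurable G)
    (hG2 : Integrable (fun r => G r ^ 2) ν) {K : Set X} (hzG : ∀ a ∈ K, ∀ r, |z a r| ≤ G r)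
    (hK : ∀ t, ∀ᵐ ω ∂P, x t ω ∈ K) (hz0 : ∀ a, ∫ r, z a r ∂ν = 0) {v : ℝ}
    (hv : TendstoInMeasure P (fun (T : ℕ) ω =>
      (T : ℝ)⁻¹ * ∑ t ∈ Finset.range T, ∫ r, z (x t ω) r ^ 2 ∂ν) atTop fun _ => v) :
    Tendsto (fun T : ℕ => ∫ ω, Complex.exp (Complex.I *
      ((√(T : ℝ))⁻¹ * ∑ t ∈ Finset.range T, z (x t ω) (s t ω) : ℝ)) ∂P) atTop
      (𝓝 (Complex.exp (-(v / 2 : ℝ)))) := by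
  set V : X → ℝ := fun a => ∫ r, z a r ^ 2 ∂ν with hV
  have hVm : Measurable V :=
    ((hz.pow_const 2).stronglyMeasurable.integral_prod_right (ν := ν)).measurable
  have hV0 : ∀ a, 0 ≤ V a := fun a => integral_nonneg fun r => sq_nonneg _
  have hG0 : ∀ r, 0 ≤ G r := by
    obtain ⟨ω, h⟩ := (hK 0).exists
    exact fun r => (abs_nonneg _).trans (hzG _ h r)
  have hv0 : 0 ≤ v := le_of_tendstoInMeasure hv (A := fun _ => Set.univ) (by simp)
    fun T ω _ => mul_nonneg (by positivity) (Finset.sum_nonneg fun t _ => hV0 _)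
  have hYm : ∀ T : ℕ, Measurable fun ω => (T : ℝ)⁻¹ * ∑ t ∈ Finset.range T, V (x t ω) :=
    fun T => (Finset.measurable_sum _ fun t _ => hVm.comp (hx t)).const_mul _
  -- the product of the conditional Gaussian factors
  have hb : Tendsto (fun T : ℕ => ∫ ω, ((Real.exp (-(|(T : ℝ)⁻¹ *
      ∑ t ∈ Finset.range T, V (x t ω)| / 2)) : ℝ) : ℂ) ∂P) atTop
      (𝓝 (Complex.exp (-(v / 2 : ℝ)))) := by
    -- The absolute value bounds the test function on all of `ℝ`; it has no effect on the
    -- nonnegative variances.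
    have := tendsto_integral_comp_of_tendstoInMeasure hv hYm
      (g := fun y => Real.exp (-(|y| / 2))) (by fun_prop) (B := 1) fun y => by
        rw [abs_of_pos (Real.exp_pos _)]
        exact Real.exp_le_one_iff.2 (by have := abs_nonneg y; linarith)
    rw [abs_of_nonneg hv0] at this
    have := (Complex.continuous_ofReal.tendsto _).comp this
    simp only [Function.comp_def, ← integral_complex_ofReal] at this
    simpa only [Complex.ofReal_exp, Complex.ofReal_neg] using this
  -- This is `T` times the error of a single factor at `τ = T^(-1/2)`.
  have hdiff : Tendsto (fun T : ℕ => 4 * (∫ r, G r ^ 2 * min 1 (|(√(T : ℝ))⁻¹| * G r) ∂ν) +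
      (T : ℝ)⁻¹ * ((∫ r, G r ^ 2 ∂ν) / 2) ^ 2) atTop (𝓝 0) := by
    have h1 : Tendsto (fun T : ℕ => (√(T : ℝ))⁻¹) atTop (𝓝 0) :=
      tendsto_inv_atTop_zero.comp (Real.tendsto_sqrt_atTop.comp tendsto_natCast_atTop_atTop)
    have h2 := ((tendsto_integral_min_mul hG hG0 hG2).comp h1).const_mul 4
    have h3 := (tendsto_inv_atTop_zero.comp (tendsto_natCast_atTop_atTop (R := ℝ))).mul_const
      (((∫ r, G r ^ 2 ∂ν) / 2) ^ 2)
    simpa using h2.add h3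
  have hw : ∀ τ : ℝ, Measurable (Function.uncurry fun (a : X) (r : ℝ) =>
      Complex.exp (Complex.I * (τ * z a r : ℝ))) := fun τ => by
    have : Measurable fun q : X × ℝ => z q.1 q.2 := hz
    simp only [Function.uncurry_def]
    fun_prop
  refine tendsto_of_tendsto_of_dist hb (squeeze_zero' (Eventually.of_forall fun _ => dist_nonneg)
    ?_ hdiff)
  filter_upwards [eventually_gt_atTop 0] with T hT
  have hTpos : (0 : ℝ) < T := by exact_mod_cast hT
  set τ := (√(T : ℝ))⁻¹ with hτ
  have hτ2 : τ ^ 2 = (T : ℝ)⁻¹ := by rw [hτ, inv_pow, Real.sq_sqrt hTpos.le]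
  have hc : ∫ ω, Complex.exp (Complex.I * (τ * ∑ t ∈ Finset.range T, z (x t ω) (s t ω) : ℝ)) ∂P =
      ∫ ω, ∏ t ∈ Finset.range T,
        (∫ r, Complex.exp (Complex.I * (τ * z (x t ω) r : ℝ)) ∂ν) ∂P := by
    rw [← integral_prod_eq_integral_prod_integral hs hlaw hind hx hexo (hw τ)
      (fun a r => (Complex.norm_exp_I_mul_ofReal _).le) T]
    congr 1; ext ω
    rw [← Complex.exp_sum, ← Finset.mul_sum, ← Complex.ofReal_sum, ← Finset.mul_sum]
  have hbT : ∀ ω, ((Real.exp (-(|(T : ℝ)⁻¹ * ∑ t ∈ Finset.range T, V (x t ω)| / 2)) : ℝ) : ℂ) =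
      ∏ t ∈ Finset.range T, ((Real.exp (-(τ ^ 2 * V (x t ω) / 2)) : ℝ) : ℂ) := fun ω => by
    rw [abs_of_nonneg (mul_nonneg (by positivity) (Finset.sum_nonneg fun t _ => hV0 _)),
      ← Complex.ofReal_prod, ← Real.exp_sum, hτ2, Finset.sum_neg_distrib, ← Finset.sum_div,
      ← Finset.mul_sum]
  have hφm : Measurable fun a : X => ∫ r, Complex.exp (Complex.I * (τ * z a r : ℝ)) ∂ν :=
    ((hw τ).stronglyMeasurable.integral_prod_right (ν := ν)).measurable
  have hφ1 : ∀ a : X, ‖∫ r, Complex.exp (Complex.I * (τ * z a r : ℝ)) ∂ν‖ ≤ 1 := fun a => by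
    refine (norm_integral_le_of_norm_le (integrable_const (1 : ℝ)) (ae_of_all _ fun r => ?_)).trans
      (by simp)
    exact (Complex.norm_exp_I_mul_ofReal _).le
  have hg1 : ∀ a : X, ‖((Real.exp (-(τ ^ 2 * V a / 2)) : ℝ) : ℂ)‖ ≤ 1 := fun a => by
    rw [Complex.norm_real, Real.norm_of_nonneg (Real.exp_pos _).le]
    exact Real.exp_le_one_iff.2 (by have := hV0 a; simp only [Left.neg_nonpos_iff]; positivity)
  have i1 : Integrable (fun ω => ∏ t ∈ Finset.range T,
      (∫ r, Complex.exp (Complex.I * (τ * z (x t ω) r : ℝ)) ∂ν)) P := by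
    refine Integrable.of_bound (Finset.measurable_prod _ fun t _ =>
      hφm.comp (hx t)).aestronglyMeasurable 1 (ae_of_all _ fun ω => ?_)
    rw [norm_prod]
    exact Finset.prod_le_one (fun _ _ => norm_nonneg _) fun _ _ => hφ1 _
  have i2 : Integrable (fun ω => ∏ t ∈ Finset.range T,
      ((Real.exp (-(τ ^ 2 * V (x t ω) / 2)) : ℝ) : ℂ)) P := by
    refine Integrable.of_bound (Finset.measurable_prod _ fun t _ => ?_).aestronglyMeasurable 1
      (ae_of_all _ fun ω => ?_)
    · have := hVm.comp (hx t)
      simp only [Function.comp_def] at this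
      fun_prop
    · rw [norm_prod]
      exact Finset.prod_le_one (fun _ _ => norm_nonneg _) fun _ _ => hg1 _
  rw [dist_comm, dist_eq_norm, hc]
  simp only [hbT]
  rw [← integral_sub i1 i2]
  have hE : ∀ᵐ ω ∂P, ‖∏ t ∈ Finset.range T,
      (∫ r, Complex.exp (Complex.I * (τ * z (x t ω) r : ℝ)) ∂ν) -
      ∏ t ∈ Finset.range T, ((Real.exp (-(τ ^ 2 * V (x t ω) / 2)) : ℝ) : ℂ)‖ ≤
      4 * (∫ r, G r ^ 2 * min 1 (|τ| * G r) ∂ν) +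
        (T : ℝ)⁻¹ * ((∫ r, G r ^ 2 ∂ν) / 2) ^ 2 := by
    filter_upwards [ae_all_iff.2 hK] with ω h
    refine (norm_prod_sub_prod_le _ (fun _ _ => hφ1 _) fun _ _ => hg1 _).trans ?_
    refine (Finset.sum_le_sum fun t _ => norm_integral_exp_sub_le
      (hz.comp measurable_prodMk_left) hG (hzG _ (h t)) hG2 (hz0 _) τ).trans (le_of_eq ?_)
    rw [Finset.sum_const, Finset.card_range, nsmul_eq_mul, hτ2]
    generalize ∫ r, G r ^ 2 * min 1 (|τ| * G r) ∂ν = A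
    generalize ∫ r, G r ^ 2 ∂ν = B
    field_simp
  exact (norm_integral_le_of_norm_le (integrable_const _) hE).trans (by simp)

end ConditionalCLT

/-! ### The design matrix -/

section Design

variable {n T : ℕ} (D : Fin T → Fin (n + 1) → ℝ)

lemma gram_apply (j k : Fin (n + 1)) :
    gram D j k = (T : ℝ)⁻¹ * ∑ t, regressor (D t) j * regressor (D t) k := by
  simp [gram, design, Matrix.mul_apply]

lemma regressorMean_apply (j : Fin (n + 1)) :
    regressorMean D j = (T : ℝ)⁻¹ * ∑ t, regressor (D t) j := by
  simp [regressorMean, design, Matrix.mulVec, dotProduct]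

lemma gram_symm (j k : Fin (n + 1)) : gram D j k = gram D k j := by
  simp [gram_apply, mul_comm]

lemma gram_zero (j : Fin (n + 1)) : gram D j 0 = regressorMean D j := by
  simp [gram_apply, regressorMean_apply, regressor]

lemma gram_zero_zero (hT : 0 < T) : gram D 0 0 = 1 := by
  have : (T : ℝ) ≠ 0 := by exact_mod_cast hT.ne'
  simp [gram_apply, regressor, this]

lemma isHermitian_gram : (gram D).IsHermitian := by
  ext j k
  simp [gram_symm D j k]

/-- Shifting by `c` shifts the spectrum, so `A - cI` has nonnegative eigenvalues and is positive
semidefinite. -/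
lemma le_dotProduct_mulVec_of_spectrum {ι : Type*} [Fintype ι] [DecidableEq ι]
    {A : Matrix ι ι ℝ} (hA : A.IsHermitian) {c : ℝ} (hc : ∀ lam ∈ spectrum ℝ A, c ≤ lam)
    (a : ι → ℝ) : c * (a ⬝ᵥ a) ≤ a ⬝ᵥ A *ᵥ a := by
  have hH : (A - algebraMap ℝ (Matrix ι ι ℝ) c).IsHermitian := by
    refine hA.sub ?_
    rw [Matrix.algebraMap_eq_diagonal]
    exact Matrix.isHermitian_diagonal _
  have h : (A - algebraMap ℝ (Matrix ι ι ℝ) c).PosSemidef := by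
    rw [hH.posSemidef_iff_eigenvalues_nonneg]
    intro i
    have := hH.eigenvalues_mem_spectrum_real i
    rw [← spectrum.sub_singleton_eq, Set.sub_singleton] at this
    obtain ⟨lam, hlam, heq⟩ := this
    have := hc lam hlam
    simp only [Pi.zero_apply]
    linarith
  have h2 := h.dotProduct_mulVec_nonneg a
  rw [Matrix.sub_mulVec, Algebra.algebraMap_eq_smul_one, Matrix.smul_mulVec, Matrix.one_mulVec,
    dotProduct_sub, dotProduct_smul, smul_eq_mul] at h2
  simp only [star_trivial] at h2
  linarith

end Design

/-! ### Quadratic forms of the limiting matrices -/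

section Block

variable {n : ℕ} {S : Matrix (Fin (n + 1)) (Fin (n + 1)) ℝ} {m : Fin (n + 1) → ℝ}

lemma dotProduct_block_mulVec (p q r : ℝ) (l : Fin (n + 1) ⊕ Unit → ℝ) :
    l ⬝ᵥ (Matrix.fromBlocks (p • S) (q • Matrix.replicateCol Unit m)
      (q • Matrix.replicateRow Unit m) (Matrix.of fun _ _ => r)) *ᵥ l =
    p * ((l ∘ Sum.inl) ⬝ᵥ S *ᵥ (l ∘ Sum.inl)) + 2 * q * l (Sum.inr ()) * ((l ∘ Sum.inl) ⬝ᵥ m)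
      + r * l (Sum.inr ()) ^ 2 := by
  simp only [dotProduct, Matrix.mulVec, Fintype.sum_sum_type, Matrix.fromBlocks_apply₁₁,
    Matrix.fromBlocks_apply₁₂, Matrix.fromBlocks_apply₂₁, Matrix.fromBlocks_apply₂₂,
    Matrix.smul_apply, Matrix.replicateCol_apply, Matrix.replicateRow_apply, Matrix.of_apply,
    smul_eq_mul, Finset.univ_unique, Finset.sum_singleton, Function.comp_apply,
    PUnit.default_eq_unit, mul_add, Finset.sum_add_distrib, Finset.mul_sum]
  rw [add_assoc, add_assoc]
  congr 1
  · exact Finset.sum_congr rfl fun i _ => Finset.sum_congr rfl fun j _ => by ring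
  rw [← add_assoc, ← Finset.sum_add_distrib]
  congr 1
  · exact Finset.sum_congr rfl fun i _ => by ring
  · ring

lemma isSymm_block (hS : S.IsSymm) (p q r : ℝ) :
    (Matrix.fromBlocks (p • S) (q • Matrix.replicateCol Unit m)
      (q • Matrix.replicateRow Unit m) (Matrix.of fun _ _ => r)).IsSymm := by
  refine Matrix.IsSymm.fromBlocks (hS.smul p) ?_ ?_
  · ext; simp
  · ext; simp [Matrix.transpose_apply]

/-- The quadratic form of `S` at `x a + y e₀`, when `S` is symmetric with first column `m` and
`S₀₀ = 1`. -/
lemma dotProduct_mulVec_add_single (hS : S.IsSymm) (hm : ∀ j, S j 0 = m j) (h1 : m 0 = 1)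
    (a : Fin (n + 1) → ℝ) (x y : ℝ) :
    (x • a + y • Pi.single 0 1) ⬝ᵥ S *ᵥ (x • a + y • Pi.single 0 1) =
      x ^ 2 * (a ⬝ᵥ S *ᵥ a) + 2 * x * y * (a ⬝ᵥ m) + y ^ 2 := by
  have hcol : S *ᵥ Pi.single 0 1 = m := by ext j; simp [hm]
  have hrow : Pi.single 0 1 ⬝ᵥ S *ᵥ a = a ⬝ᵥ m := by
    rw [Matrix.dotProduct_mulVec, ← Matrix.mulVec_transpose, hS.eq, hcol, dotProduct_comm]
  simp only [Matrix.mulVec_add, Matrix.mulVec_smul, dotProduct_add, add_dotProduct,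
    smul_dotProduct, dotProduct_smul, smul_eq_mul, hcol, hrow, single_dotProduct, h1]
  ring

end Block

section Definite

variable {n : ℕ} {S : Matrix (Fin (n + 1)) (Fin (n + 1)) ℝ} {m : Fin (n + 1) → ℝ}
  {f : ℝ → ℝ} {α σ : ℝ} (hf : IsErrorDensity f α) (hreg : IsRegularDensity f α)
include hf hreg

/-- As `m = S e₀` and `S₀₀ = 1`, the form at `l = (a, d)` is the mean over `s` of the form of `S` at
`ψ(s) a + h(s) d/(2σ) e₀`, where `h` is `centredScaleScore`. -/
lemma posSemidef_Omega (hα : 0 ≤ α) (hS : S.IsSymm) (hm : ∀ j, S j 0 = m j) (h1 : m 0 = 1)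
    (hpos : ∀ a, 0 ≤ a ⬝ᵥ S *ᵥ a) : (Omega f α σ S m).PosSemidef := by
  refine .of_dotProduct_mulVec_nonneg ?_ fun l => ?_
  · rw [Matrix.IsHermitian, Matrix.conjTranspose_eq_transpose_of_trivial]
    exact isSymm_block hS _ _ _
  have hphi : phi1 f α = 0 := by rw [phi1, M_zero_one hf hreg hα, neg_zero]
  rw [star_trivial, Omega, dotProduct_block_mulVec]
  set A := (l ∘ Sum.inl) ⬝ᵥ S *ᵥ (l ∘ Sum.inl)
  set B := (l ∘ Sum.inl) ⬝ᵥ m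
  set d := l (Sum.inr ())
  have hint : (zeta11 f (2 * α) - phi1 f α ^ 2) * A +
      2 * ((zeta12 f (2 * α) - phi1 f α * phi2 f α) / σ) * d * B +
      (zeta22 f (2 * α) - phi2 f α ^ 2) / σ ^ 2 * d ^ 2 =
      ∫ s, (psi f α s ^ 2 * A + psi f α s * centredScaleScore f α s * (d * B / σ) +
        centredScaleScore f α s ^ 2 * (d ^ 2 / (4 * σ ^ 2))) ∂(errorLaw f) := by
    have i1 := (integrable_psi_sq hf hreg).mul_const A
    have i2 := (integrable_psi_mul_centredScaleScore hf hreg).mul_const (d * B / σ)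
    have i3 := (integrable_centredScaleScore_sq hf hreg).mul_const (d ^ 2 / (4 * σ ^ 2))
    have i12 : Integrable (fun s => psi f α s ^ 2 * A +
        psi f α s * centredScaleScore f α s * (d * B / σ)) (errorLaw f) := i1.add i2
    rw [integral_add i12 i3, integral_add i1 i2, integral_mul_const, integral_mul_const,
      integral_mul_const, integral_psi_sq hf hreg, integral_psi_mul_centredScaleScore hf hreg hα,
      integral_centredScaleScore_sq hf hreg hα, hphi]
    field_simp
    ring
  rw [hint]
  refine integral_nonneg fun s => ?_
  have := hpos (psi f α s • (l ∘ Sum.inl) +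
    (centredScaleScore f α s * d / (2 * σ)) • Pi.single 0 1)
  rw [dotProduct_mulVec_add_single hS hm h1] at this
  simp only [Pi.zero_apply]
  convert! this using 1
  ring

/-- Otherwise the density would be a positive constant, which is not integrable on the line. -/
lemma exists_u_ne_zero : ∃ s, u f s ≠ 0 := by
  by_contra! h
  have hder : ∀ s, HasDerivAt f 0 s := fun s => by
    simpa [h s] using hasDerivAt_density hf hreg s
  have hconst : ∀ s, f s = f 0 := fun s =>
    is_const_of_deriv_eq_zero (fun s => (hder s).differentiableAt) (fun s => (hder s).deriv) s 0
  have h1 := hf.integrable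
  rw [show f = fun _ => f 0 from funext hconst] at h1
  rcases integrable_const_iff.1 h1 with h2 | h2
  · exact (hf.pos 0).ne' h2
  · exact absurd h2.measure_univ_lt_top (by simp)

/-- The form at `(a, d)` is the integral of the form of `S` at `v(s) = u(s) a + (1 + s u(s)) d/(2σ)
e₀` against `f^(1+α)`. The integrand is continuous and nonnegative, so it suffices that `v` does not
vanish identically. -/
lemma posDef_Psi (hσ : 0 < σ) (hS : S.IsSymm) (hm : ∀ j, S j 0 = m j)
    (h1 : m 0 = 1) (hpos : ∀ a, a ≠ 0 → 0 < a ⬝ᵥ S *ᵥ a) : (Psi f α σ S m).PosDef := by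
  refine .of_dotProduct_mulVec_pos ?_ fun l hl => ?_
  · rw [Matrix.IsHermitian, Matrix.conjTranspose_eq_transpose_of_trivial]
    exact isSymm_block hS _ _ _
  have hpos' : ∀ a, 0 ≤ a ⬝ᵥ S *ᵥ a := fun a => by
    rcases eq_or_ne a 0 with rfl | ha
    · simp
    · exact (hpos a ha).le
  rw [star_trivial, Psi, dotProduct_block_mulVec]
  set a := l ∘ Sum.inl with ha
  set A := a ⬝ᵥ S *ᵥ a with hA
  set B := a ⬝ᵥ m with hB
  set d := l (Sum.inr ()) with hd
  set v : ℝ → Fin (n + 1) → ℝ := fun s =>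
    u f s • a + ((1 + s * u f s) * d / (2 * σ)) • Pi.single 0 1 with hv
  set Q : ℝ → ℝ := fun s => (v s ⬝ᵥ S *ᵥ v s) * f s ^ (1 + α) with hQ
  have hQeq : ∀ s, Q s = mIntegrand f α 0 2 s * A +
      (mIntegrand f α 0 1 s + mIntegrand f α 1 2 s) * (d * B / σ) +
      (mIntegrand f α 2 2 s + 2 * mIntegrand f α 1 1 s + mIntegrand f α 0 0 s) *
        (d ^ 2 / (4 * σ ^ 2)) := fun s => by
    simp only [hQ, hv]
    rw [dotProduct_mulVec_add_single hS hm h1]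
    simp only [mIntegrand]
    field_simp
    ring
  have hi := fun i (hi : i ≤ 2) j (hj : j ≤ 2) => hreg.integrable i hi j hj
  have i1 := (hi 0 (by norm_num) 2 le_rfl).mul_const A
  have i2' := (hi 0 (by norm_num) 1 (by norm_num)).add (hi 1 (by norm_num) 2 le_rfl)
  have i2 : Integrable fun s => (mIntegrand f α 0 1 s + mIntegrand f α 1 2 s) * (d * B / σ) :=
    i2'.mul_const _
  have i3'' : Integrable fun s => mIntegrand f α 2 2 s + 2 * mIntegrand f α 1 1 s :=
    (hi 2 le_rfl 2 le_rfl).add ((hi 1 (by norm_num) 1 (by norm_num)).const_mul 2)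
  have i3' : Integrable fun s =>
      mIntegrand f α 2 2 s + 2 * mIntegrand f α 1 1 s + mIntegrand f α 0 0 s :=
    i3''.add (hi 0 (by norm_num) 0 (by norm_num))
  have i3 := i3'.mul_const (d ^ 2 / (4 * σ ^ 2))
  have i12 : Integrable fun s => mIntegrand f α 0 2 s * A +
      (mIntegrand f α 0 1 s + mIntegrand f α 1 2 s) * (d * B / σ) := i1.add i2
  have hQi : Integrable Q := by
    rw [show Q = _ from funext hQeq]
    exact i12.add i3
  have hint : zeta11 f α * A + 2 * (zeta12 f α / σ) * d * B + zeta22 f α / σ ^ 2 * d ^ 2 =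
      ∫ s, Q s := by
    simp only [hQeq]
    rw [integral_add i12 i3, integral_add i1 i2, integral_mul_const, integral_mul_const,
      integral_mul_const, integral_add (hi 0 (by norm_num) 1 (by norm_num))
      (hi 1 (by norm_num) 2 le_rfl), integral_add i3'' (hi 0 (by norm_num) 0 (by norm_num)),
      integral_add (hi 2 le_rfl 2 le_rfl) ((hi 1 (by norm_num) 1 (by norm_num)).const_mul 2),
      integral_const_mul]
    simp only [zeta11, zeta12, zeta22, M]
    field_simp
  have hucont := (contDiff_u hf hreg).continuous
  have hQc : Continuous Q := by
    have hfc : Continuous fun s => f s ^ (1 + α) :=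
      hreg.contDiff.continuous.rpow_const fun s => Or.inl (hf.pos s).ne'
    have hvc : Continuous v := by simp only [hv]; fun_prop
    exact (hvc.dotProduct (continuous_const.matrix_mulVec hvc)).mul hfc
  have hvne : ∃ s, v s ≠ 0 := by
    by_contra! h
    have h0 : ∀ s, u f s * a 0 + (1 + s * u f s) * d / (2 * σ) = 0 := fun s => by
      have := congrFun (h s) 0
      simpa [hv] using this
    have hd0 : d = 0 := by
      by_contra hdne
      -- At this `s` the two terms containing `u(s)` cancel and `d/(2σ)` remains.
      have h2 := h0 (-(2 * σ * a 0 / d))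
      field_simp at h2
      have h3 : d = 0 := by linear_combination h2
      exact hdne h3
    obtain ⟨s, hs⟩ := exists_u_ne_zero hf hreg
    have ha0 : a = 0 := by
      have := h s
      simp only [hv, hd0, mul_zero, zero_div, zero_smul, add_zero] at this
      exact (smul_eq_zero.1 this).resolve_left hs
    apply hl
    ext i
    rcases i with j | j
    · exact congrFun ha0 j
    · exact hd0
  obtain ⟨s, hs⟩ := hvne
  rw [hint]
  exact integral_pos_of_integrable_nonneg_nonzero hQc hQi
    (fun s => mul_nonneg (hpos' _) (Real.rpow_nonneg (hf.pos s).le _))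
    (mul_pos (hpos _ hs) (Real.rpow_pos_of_pos (hf.pos s) _)).ne'

lemma posSemidef_asympCov (hα : 0 ≤ α) (hS : S.IsSymm) (hm : ∀ j, S j 0 = m j)
    (h1 : m 0 = 1) (hpos : ∀ a, 0 ≤ a ⬝ᵥ S *ᵥ a) : (asympCov f α σ S m).PosSemidef := by
  refine Matrix.PosSemidef.smul ?_ (sq_nonneg σ)
  have h := (posSemidef_Omega (σ := σ) hf hreg hα hS hm h1 hpos).mul_mul_conjTranspose_same
    (Psi f α σ S m)⁻¹
  have hsymm : (Psi f α σ S m).IsSymm := isSymm_block hS _ _ _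
  rwa [Matrix.conjTranspose_eq_transpose_of_trivial, Matrix.transpose_nonsing_inv, hsymm.eq] at h

end Definite

/-! ### Fixed points of random local contractions -/

section FixedPoint

variable {E : Type*} [NormedAddCommGroup E] [CompleteSpace E]

/-- The limit of the iterates of `G` started at zero. -/
def iterLimit (G : E → E) : E := limUnder atTop fun k => G^[k] 0

/-- `G` is `K`-Lipschitz on the closed ball of radius `ρ` around zero. -/
def LipschitzNearZero (G : E → E) (ρ K : ℝ) : Prop :=
  ∀ x y, ‖x‖ ≤ ρ → ‖y‖ ≤ ρ → ‖G x - G y‖ ≤ K * ‖x - y‖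

/-- The limit of the iterates is a fixed point close to `G 0`. -/
structure IsGoodFixedPoint (G : E → E) (K : ℝ) : Prop where
  fixed : G (iterLimit G) = iterLimit G
  norm_le : ‖iterLimit G‖ ≤ 2 * ‖G 0‖
  norm_sub_le : ‖iterLimit G - G 0‖ ≤ 2 * K * ‖G 0‖

/-- From `‖G x‖ ≤ Kρ + ρ/2 ≤ ρ` the ball is mapped into itself and the contraction principle
applies. The fixed point `y` satisfies `‖y - G 0‖ ≤ K‖y‖`, whence `‖y‖ ≤ 2‖G 0‖`. -/
lemma LipschitzNearZero.isGoodFixedPoint {G : E → E} {ρ K : ℝ} (hG : LipschitzNearZero G ρ K)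
    (hK0 : 0 ≤ K) (hK : K ≤ 1 / 2) (h0 : ‖G 0‖ ≤ ρ / 2) : IsGoodFixedPoint G K := by
  obtain ⟨K, rfl⟩ : ∃ K' : NNReal, (K' : ℝ) = K := ⟨K.toNNReal, Real.coe_toNNReal K hK0⟩
  have hρ : 0 ≤ ρ := by linarith [norm_nonneg (G 0)]
  have hmaps : Set.MapsTo G (Metric.closedBall 0 ρ) (Metric.closedBall 0 ρ) := fun x hx => by
    rw [mem_closedBall_zero_iff] at *
    have h1 := hG x 0 hx (by simpa using hρ)
    rw [sub_zero] at h1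
    have h2 : ‖G x‖ ≤ ‖G x - G 0‖ + ‖G 0‖ := by simpa using norm_add_le (G x - G 0) (G 0)
    nlinarith [norm_nonneg x]
  have hcontr : ContractingWith K (hmaps.restrict G _ _) := by
    refine ⟨?_, LipschitzWith.of_dist_le_mul fun x y => ?_⟩
    · rw [← NNReal.coe_lt_coe, NNReal.coe_one]
      linarith
    · have := hG x y (mem_closedBall_zero_iff.1 x.2) (mem_closedBall_zero_iff.1 y.2)
      simpa [Subtype.dist_eq, dist_eq_norm] using this
  obtain ⟨y, hy, hfix, hlim, -⟩ := hcontr.exists_fixedPoint' Metric.isClosed_closedBall.isComplete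
    hmaps (x := 0) (by simpa using hρ) (edist_ne_top _ _)
  have hyl : iterLimit G = y := hlim.limUnder_eq
  rw [mem_closedBall_zero_iff] at hy
  have hyG : ‖y - G 0‖ ≤ K * ‖y‖ := by
    have := hG y 0 hy (by simpa using hρ)
    rwa [hfix.eq, sub_zero] at this
  have hle : ‖y‖ ≤ 2 * ‖G 0‖ := by
    have h2 : ‖y‖ ≤ ‖y - G 0‖ + ‖G 0‖ := by simpa using norm_add_le (y - G 0) (G 0)
    nlinarith [norm_nonneg y]
  refine ⟨by rw [hyl, hfix.eq], by rw [hyl]; exact hle, ?_⟩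
  rw [hyl]
  nlinarith [norm_nonneg y]

end FixedPoint

/-! ### Stochastic order of the random fixed point. -/

section RandomFixedPoint

variable {Ω : Type*} [MeasurableSpace Ω] {P : Measure Ω}

lemma BoundedInProbability.tendsto_measure_lt {Z : ℕ → Ω → ℝ}
    (hZ : BoundedInProbability P fun T ω => √(T : ℝ) * Z T ω) {ρ : ℝ} (hρ : 0 < ρ) :
    Tendsto (fun T => P {ω | ρ ≤ |Z T ω|}) atTop (𝓝 0) := by
  rw [ENNReal.tendsto_nhds_zero]
  intro ε hε
  obtain ⟨K, hK⟩ := hZ ε hε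
  have h1 : ∀ᶠ T : ℕ in atTop, K < √(T : ℝ) * ρ :=
    ((Real.tendsto_sqrt_atTop.comp tendsto_natCast_atTop_atTop).atTop_mul_const
      hρ).eventually_gt_atTop K
  filter_upwards [hK, h1] with T hT h1T
  refine (measure_mono fun ω hω => ?_).trans hT
  simp only [Set.mem_ofPred_eq] at *
  rw [abs_mul, abs_of_nonneg (Real.sqrt_nonneg _)]
  exact h1T.trans_le (mul_le_mul_of_nonneg_left hω (Real.sqrt_nonneg _))

variable {E : Type*} [NormedAddCommGroup E] [CompleteSpace E] {G : ℕ → Ω → E → E}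
  (hLip : ∀ K, 0 < K → ∃ ρ > 0,
    Tendsto (fun T => P {ω | ¬ LipschitzNearZero (G T ω) ρ K}) atTop (𝓝 0))
  (hO : BoundedInProbability P fun T ω => √(T : ℝ) * ‖G T ω 0‖)
include hLip hO

lemma tendsto_measure_not_isGoodFixedPoint {K : ℝ} (hK0 : 0 < K) (hK : K ≤ 1 / 2) :
    Tendsto (fun T => P {ω | ¬ IsGoodFixedPoint (G T ω) K}) atTop (𝓝 0) := by
  obtain ⟨ρ, hρ, h⟩ := hLip K hK0
  refine tendsto_measure_zero_of_subset_union h (hO.tendsto_measure_lt (half_pos hρ))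
    fun T ω hω => ?_
  simp only [Set.mem_union, Set.mem_ofPred_eq] at *
  by_contra! hcon
  rw [abs_norm] at hcon
  exact hω (hcon.1.isGoodFixedPoint hK0.le hK hcon.2.le)

lemma boundedInProbability_iterLimit :
    BoundedInProbability P fun T ω => √(T : ℝ) * ‖iterLimit (G T ω)‖ := by
  intro ε hε
  obtain ⟨K, hK⟩ := hO (ε / 2) (ENNReal.half_pos hε.ne')
  have h2 := ENNReal.tendsto_nhds_zero.1
    (tendsto_measure_not_isGoodFixedPoint hLip hO (by norm_num) le_rfl) (ε / 2)
    (ENNReal.half_pos hε.ne')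
  refine ⟨2 * K, ?_⟩
  filter_upwards [hK, h2] with T hT h2T
  rw [← ENNReal.add_halves ε]
  refine (measure_mono (t := {ω | K < |√(T : ℝ) * ‖G T ω 0‖|} ∪
    {ω | ¬ IsGoodFixedPoint (G T ω) (1 / 2)}) fun ω hω => ?_).trans
    ((measure_union_le _ _).trans (add_le_add hT h2T))
  simp only [Set.mem_union, Set.mem_ofPred_eq] at *
  by_contra! hcon
  have h3 := hcon.2.norm_le
  rw [abs_of_nonneg (by positivity)] at hω hcon
  have h4 := mul_le_mul_of_nonneg_left h3 (Real.sqrt_nonneg T)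
  linarith [hcon.1]

/-- The distance to the first step is at most `2K‖G 0‖`, where `K` may be taken arbitrarily small
while `√T ‖G 0‖` stays bounded in probability. -/
lemma tendsto_measure_iterLimit_sub {ε : ℝ} (hε : 0 < ε) :
    Tendsto (fun T : ℕ => P {ω | ε ≤ √(T : ℝ) * ‖iterLimit (G T ω) - G T ω 0‖}) atTop (𝓝 0) := by
  rw [ENNReal.tendsto_nhds_zero]
  intro δ hδ
  obtain ⟨M, hM⟩ := hO (δ / 2) (ENNReal.half_pos hδ.ne')
  set K := min (1 / 2) (ε / (4 * (|M| + 1))) with hKdef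
  have hK0 : 0 < K := by positivity
  have h2 := ENNReal.tendsto_nhds_zero.1
    (tendsto_measure_not_isGoodFixedPoint hLip hO hK0 (min_le_left _ _)) (δ / 2)
    (ENNReal.half_pos hδ.ne')
  filter_upwards [hM, h2] with T hT h2T
  rw [← ENNReal.add_halves δ]
  refine (measure_mono (t := {ω | M < |√(T : ℝ) * ‖G T ω 0‖|} ∪
    {ω | ¬ IsGoodFixedPoint (G T ω) K}) fun ω hω => ?_).trans
    ((measure_union_le _ _).trans (add_le_add hT h2T))
  simp only [Set.mem_union, Set.mem_ofPred_eq] at *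
  by_contra! hcon
  have h3 := hcon.2.norm_sub_le
  rw [abs_of_nonneg (by positivity)] at hcon
  have h4 := mul_le_mul_of_nonneg_left h3 (Real.sqrt_nonneg T)
  have h5 : K * (4 * (|M| + 1)) ≤ ε := by
    rw [← le_div_iff₀ (by positivity)]; exact min_le_right _ _
  nlinarith [hcon.1, le_abs_self M, mul_le_mul_of_nonneg_left (hcon.1.trans (le_abs_self M)) hK0.le]

end RandomFixedPoint

/-! ### The score in local coordinates

The parameter `(b, v)` is replaced by `φ = (γ, 2σκ)`, where `b = β - σ / (1 + κ) γ` and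
`v = (σ / (1 + κ))²`, in which the standardized residual is affine. -/

section LocalScore

variable {n : ℕ}

/-- The standardized residual at the local parameter `φ`. -/
def localResid (σ : ℝ) (x : Fin (n + 1) → ℝ) (s : ℝ) (φ : Fin (n + 1) ⊕ Unit → ℝ) : ℝ :=
  (φ ∘ Sum.inl) ⬝ᵥ x + (1 + φ (Sum.inr ()) / (2 * σ)) * s

/-- The contribution of one period to the score. -/
def scoreTerm (f : ℝ → ℝ) (α σ : ℝ) (x : Fin (n + 1) → ℝ) (s : ℝ)
    (φ : Fin (n + 1) ⊕ Unit → ℝ) : Fin (n + 1) ⊕ Unit → ℝ :=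
  Sum.elim (fun j => psi f α (localResid σ x s φ) * x j)
    (fun _ => centredScaleScore f α (localResid σ x s φ) / (2 * σ))

/-- The derivative of `scoreTerm` at the true parameter. -/
def scoreDeriv (f : ℝ → ℝ) (α σ : ℝ) (x : Fin (n + 1) → ℝ) (s : ℝ) :
    Matrix (Fin (n + 1) ⊕ Unit) (Fin (n + 1) ⊕ Unit) ℝ :=
  Matrix.fromBlocks
    (Matrix.of fun j k => x j * x k * deriv (psi f α) s)
    (Matrix.of fun j _ => x j * (s * deriv (psi f α) s / (2 * σ)))
    (Matrix.of fun _ k => x k * (scaleScoreDeriv f α s / (2 * σ)))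
    (Matrix.of fun _ _ => s * scaleScoreDeriv f α s / (4 * σ ^ 2))

variable {f : ℝ → ℝ} {α σ C : ℝ}

lemma localResid_zero (x : Fin (n + 1) → ℝ) (s : ℝ) : localResid σ x s 0 = s := by
  simp [localResid, dotProduct]

lemma abs_dotProduct_le {ι : Type*} [Fintype ι] {a x : ι → ℝ} (hx : ∀ j, |x j| ≤ C) :
    |a ⬝ᵥ x| ≤ (∑ j, |a j|) * C := by
  rw [dotProduct, Finset.sum_mul]
  refine (Finset.abs_sum_le_sum_abs _ _).trans (Finset.sum_le_sum fun j _ => ?_)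
  rw [abs_mul]
  exact mul_le_mul_of_nonneg_left (hx j) (abs_nonneg _)

lemma abs_comp_dotProduct_le (φ : Fin (n + 1) ⊕ Unit → ℝ) {x : Fin (n + 1) → ℝ}
    (hx : ∀ j, |x j| ≤ C) : |(φ ∘ Sum.inl) ⬝ᵥ x| ≤ (n + 1) * C * ‖φ‖ := by
  have hC : 0 ≤ C := (abs_nonneg _).trans (hx 0)
  refine (abs_dotProduct_le hx).trans ?_
  have : ∑ j, |(φ ∘ Sum.inl) j| ≤ ∑ _j : Fin (n + 1), ‖φ‖ :=
    Finset.sum_le_sum fun j _ => norm_le_pi_norm φ (Sum.inl j)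
  simp only [Finset.sum_const, Finset.card_univ, Fintype.card_fin, nsmul_eq_mul] at this
  push_cast at this
  nlinarith

lemma scoreDeriv_mulVec_inl (x : Fin (n + 1) → ℝ) (s : ℝ) (d : Fin (n + 1) ⊕ Unit → ℝ)
    (j : Fin (n + 1)) : (scoreDeriv f α σ x s *ᵥ d) (Sum.inl j) =
      deriv (psi f α) s * ((d ∘ Sum.inl) ⬝ᵥ x + d (Sum.inr ()) / (2 * σ) * s) * x j := by
  simp only [scoreDeriv, Matrix.mulVec, dotProduct, Fintype.sum_sum_type,
    Matrix.fromBlocks_apply₁₁, Matrix.fromBlocks_apply₁₂, Matrix.of_apply, Finset.univ_unique,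
    Finset.sum_singleton, Function.comp_apply, PUnit.default_eq_unit, mul_add, add_mul,
    Finset.mul_sum, Finset.sum_mul]
  congr 1
  · exact Finset.sum_congr rfl fun k _ => by ring
  · ring

lemma scoreDeriv_mulVec_inr (x : Fin (n + 1) → ℝ) (s : ℝ) (d : Fin (n + 1) ⊕ Unit → ℝ) :
    (scoreDeriv f α σ x s *ᵥ d) (Sum.inr ()) =
      scaleScoreDeriv f α s * ((d ∘ Sum.inl) ⬝ᵥ x + d (Sum.inr ()) / (2 * σ) * s) / (2 * σ) := by
  simp only [scoreDeriv, Matrix.mulVec, dotProduct, Fintype.sum_sum_type,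
    Matrix.fromBlocks_apply₂₁, Matrix.fromBlocks_apply₂₂, Matrix.of_apply, Finset.univ_unique,
    Finset.sum_singleton, Function.comp_apply, PUnit.default_eq_unit, mul_add, add_div,
    Finset.mul_sum, Finset.sum_div]
  congr 1
  · exact Finset.sum_congr rfl fun k _ => by ring
  · ring

/-- The linearization of one term of the score, uniformly over a small ball. -/
lemma exists_scoreTerm_majorant (hf : IsErrorDensity f α) (hreg : IsRegularDensity f α)
    (hσ : 0 < σ) (hC : 0 ≤ C) {ε : ℝ} (hε : 0 < ε) :
    ∃ ρ > 0, ∃ W : ℝ → ℝ, Continuous W ∧ Integrable W (errorLaw f) ∧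
      ∫ s, W s ∂(errorLaw f) < ε ∧
      ∀ (x : Fin (n + 1) → ℝ) (s : ℝ), (∀ j, |x j| ≤ C) → ∀ φ φ', ‖φ‖ ≤ ρ → ‖φ'‖ ≤ ρ → ∀ i,
        |scoreTerm f α σ x s φ i - scoreTerm f α σ x s φ' i
          - (scoreDeriv f α σ x s *ᵥ (φ - φ')) i| ≤ W s * ‖φ - φ'‖ := by
  -- `L` converts the sup norm of a parameter increment into a bound for the sum of shift and
  -- rescaling of the residual. The factor `C + 1/(2σ)` below covers the outer factors `x j` and
  -- `1/(2σ)` of the score coordinates.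
  set L : ℝ := (n + 1) * C + 1 / (2 * σ) with hL
  have hL0 : 0 < L := by positivity
  have hBL : 0 < (C + 1 / (2 * σ)) * L := by positivity
  set ε' := ε / (2 * ((C + 1 / (2 * σ)) * L)) with hε'
  have hε'0 : 0 < ε' := by positivity
  have hd : ∀ r, HasDerivAt (centredScaleScore f α) (scaleScoreDeriv f α r) r := fun r =>
    (hasDerivAt_scaleScore hf hreg r).sub_const _
  obtain ⟨ρ₁, hρ₁, W₁, hW₁, hW₁0, hW₁i, hW₁ε, hlin₁⟩ := exists_linearization_majorant
    (hasDerivAt_psi hf hreg) (continuous_deriv_psi hf hreg)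
    (locallyDominated_deriv_psi hf hreg) hε'0
  obtain ⟨ρ₂, hρ₂, W₂, hW₂, hW₂0, hW₂i, hW₂ε, hlin₂⟩ := exists_linearization_majorant
    hd (continuous_scaleScoreDeriv hf hreg) (locallyDominated_scaleScoreDeriv hf hreg) hε'0
  have hWi : Integrable (fun s => W₁ s + W₂ s) (errorLaw f) := hW₁i.add hW₂i
  refine ⟨min ρ₁ ρ₂ / L, by positivity, fun s => (C + 1 / (2 * σ)) * L * (W₁ s + W₂ s),
    by fun_prop, hWi.const_mul _, ?_, ?_⟩
  · rw [integral_const_mul, integral_add hW₁i hW₂i]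
    have : (C + 1 / (2 * σ)) * L * (2 * ε') = ε := by rw [hε']; field_simp
    nlinarith
  intro x s hx φ φ' hφ hφ' i
  rw [le_div_iff₀ hL0] at hφ hφ'
  have hbound : ∀ d : Fin (n + 1) ⊕ Unit → ℝ,
      |(d ∘ Sum.inl) ⬝ᵥ x| + |d (Sum.inr ()) / (2 * σ)| ≤ ‖d‖ * L := fun d => by
    have h1 := abs_comp_dotProduct_le d hx
    have h2 : |d (Sum.inr ())| ≤ ‖d‖ := norm_le_pi_norm d (Sum.inr ())
    have h3 : |d (Sum.inr ()) / (2 * σ)| ≤ ‖d‖ * (1 / (2 * σ)) := by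
      rw [abs_div, abs_of_pos (by positivity : 0 < 2 * σ), div_eq_mul_one_div]
      gcongr
    rw [hL]; nlinarith
  have hsmall : ∀ d : Fin (n + 1) ⊕ Unit → ℝ, ‖d‖ * L ≤ min ρ₁ ρ₂ →
      |(d ∘ Sum.inl) ⬝ᵥ x| ≤ min ρ₁ ρ₂ ∧ |d (Sum.inr ()) / (2 * σ)| ≤ min ρ₁ ρ₂ := fun d hd => by
    have := hbound d
    constructor <;>
      linarith [abs_nonneg ((d ∘ Sum.inl) ⬝ᵥ x), abs_nonneg (d (Sum.inr ()) / (2 * σ))]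
  have hsub : (φ ∘ Sum.inl) ⬝ᵥ x - (φ' ∘ Sum.inl) ⬝ᵥ x = ((φ - φ') ∘ Sum.inl) ⬝ᵥ x := by
    rw [← sub_dotProduct]; rfl
  have hsub' : φ (Sum.inr ()) / (2 * σ) - φ' (Sum.inr ()) / (2 * σ) =
      (φ - φ') (Sum.inr ()) / (2 * σ) := by rw [← sub_div]; rfl
  have hb := hbound (φ - φ')
  obtain ⟨hs1, hs2⟩ := hsmall φ hφ
  obtain ⟨hs1', hs2'⟩ := hsmall φ' hφ'
  have hW₁s := hW₁0 s
  have hW₂s := hW₂0 s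
  have hσ2 : (0 : ℝ) ≤ 1 / (2 * σ) := by positivity
  have hd0 := norm_nonneg (φ - φ')
  rcases i with j | ⟨⟩
  · have h := hlin₁ s _ _ _ _ (hs1.trans (min_le_left _ _)) (hs2.trans (min_le_left _ _))
      (hs1'.trans (min_le_left _ _)) (hs2'.trans (min_le_left _ _))
    rw [hsub, hsub'] at h
    rw [scoreDeriv_mulVec_inl]
    simp only [scoreTerm, Sum.elim_inl, localResid]
    rw [← sub_mul, ← sub_mul, abs_mul]
    calc _ ≤ W₁ s * (‖φ - φ'‖ * L) * C :=
          mul_le_mul (h.trans (mul_le_mul_of_nonneg_left hb hW₁s)) (hx j) (abs_nonneg _)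
            (by positivity)
      _ = (C * L * W₁ s) * ‖φ - φ'‖ := by ring
      _ ≤ _ := by gcongr <;> linarith
  · have h := hlin₂ s _ _ _ _ (hs1.trans (min_le_right _ _)) (hs2.trans (min_le_right _ _))
      (hs1'.trans (min_le_right _ _)) (hs2'.trans (min_le_right _ _))
    rw [hsub, hsub'] at h
    rw [scoreDeriv_mulVec_inr]
    simp only [scoreTerm, Sum.elim_inr, localResid]
    rw [← sub_div, ← sub_div, abs_div, abs_of_pos (by positivity : 0 < 2 * σ),
      div_eq_mul_one_div]
    calc _ ≤ W₂ s * (‖φ - φ'‖ * L) * (1 / (2 * σ)) :=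
          mul_le_mul_of_nonneg_right (h.trans (mul_le_mul_of_nonneg_left hb hW₂s)) hσ2
      _ = ((1 / (2 * σ)) * L * W₂ s) * ‖φ - φ'‖ := by ring
      _ ≤ _ := by gcongr <;> linarith

end LocalScore

/-! ### The stochastic setting -/

/-- Bounded random regressors `x_t` with convergent first and second empirical moments,
independent of the iid errors `s_t` with density `f`. -/
structure IsRegressionDesign {Ω : Type*} [MeasurableSpace Ω] (P : Measure Ω) {n : ℕ}
    (x : ℕ → Ω → Fin (n + 1) → ℝ) (s : ℕ → Ω → ℝ) (f : ℝ → ℝ) (C : ℝ)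
    (S : Matrix (Fin (n + 1)) (Fin (n + 1)) ℝ) (m : Fin (n + 1) → ℝ) : Prop where
  measurable_x : ∀ t, Measurable (x t)
  measurable_s : ∀ t, Measurable (s t)
  law : ∀ t, P.map (s t) = errorLaw f
  indep : iIndepFun s P
  exo : IndepFun (fun ω t => x t ω) (fun ω t => s t ω) P
  bound : ∀ t, ∀ᵐ ω ∂P, ∀ j, |x t ω j| ≤ C
  second : ∀ j k, TendstoInMeasure P
    (fun (T : ℕ) ω => (T : ℝ)⁻¹ * ∑ t ∈ Finset.range T, x t ω j * x t ω k) atTop fun _ => S j k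
  first : ∀ j, TendstoInMeasure P
    (fun (T : ℕ) ω => (T : ℝ)⁻¹ * ∑ t ∈ Finset.range T, x t ω j) atTop fun _ => m j

/-- The score in local coordinates. -/
def localScore (f : ℝ → ℝ) (α σ : ℝ) {n : ℕ} (T : ℕ) (x : ℕ → Fin (n + 1) → ℝ) (s : ℕ → ℝ)
    (φ : Fin (n + 1) ⊕ Unit → ℝ) : Fin (n + 1) ⊕ Unit → ℝ :=
  (T : ℝ)⁻¹ • ∑ t ∈ Finset.range T, scoreTerm f α σ (x t) (s t) φ

/-- One step of the simplified Newton iteration for the root of the score. -/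
def newtonStep (A : Matrix (Fin n ⊕ Unit) (Fin n ⊕ Unit) ℝ)
    (S : (Fin n ⊕ Unit → ℝ) → Fin n ⊕ Unit → ℝ) (φ : Fin n ⊕ Unit → ℝ) : Fin n ⊕ Unit → ℝ :=
  φ + A⁻¹ *ᵥ S φ

/-! ### Convergence of the score derivative and contraction of the Newton map. -/

section Lipschitz

variable {Ω : Type*} [MeasurableSpace Ω] {P : Measure Ω} [IsProbabilityMeasure P] {n : ℕ}
  {x : ℕ → Ω → Fin (n + 1) → ℝ} {s : ℕ → Ω → ℝ} {f : ℝ → ℝ} {α σ C : ℝ}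
  {S : Matrix (Fin (n + 1)) (Fin (n + 1)) ℝ} {m : Fin (n + 1) → ℝ}

lemma norm_mulVec_le {ι : Type*} [Fintype ι] (A : Matrix ι ι ℝ) (v : ι → ℝ) :
    ‖A *ᵥ v‖ ≤ (∑ i, ∑ j, |A i j|) * ‖v‖ := by
  refine (pi_norm_le_iff_of_nonneg (by positivity)).2 fun i => ?_
  calc ‖(A *ᵥ v) i‖ ≤ ∑ j, |A i j| * ‖v‖ := by
        refine (norm_sum_le _ _).trans (Finset.sum_le_sum fun j _ => ?_)
        rw [norm_mul]
        exact mul_le_mul_of_nonneg_left (norm_le_pi_norm v j) (abs_nonneg _)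
    _ = (∑ j, |A i j|) * ‖v‖ := by rw [Finset.sum_mul]
    _ ≤ _ := by
        refine mul_le_mul_of_nonneg_right ?_ (norm_nonneg _)
        exact Finset.single_le_sum (f := fun i => ∑ j, |A i j|)
          (fun i _ => Finset.sum_nonneg fun j _ => abs_nonneg _) (Finset.mem_univ i)

lemma tendstoInMeasure_abs_sub {Z : ℕ → Ω → ℝ} {c : ℝ}
    (hZ : TendstoInMeasure P Z atTop fun _ => c) :
    TendstoInMeasure P (fun T ω => |Z T ω - c|) atTop fun _ => 0 := by
  rw [tendstoInMeasure_real_iff] at *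
  simpa using hZ

namespace IsRegressionDesign

variable (hd : IsRegressionDesign P x s f C S m)
include hd

lemma nonneg_bound : 0 ≤ C := by
  obtain ⟨ω, h⟩ := (hd.bound 0).exists
  exact (abs_nonneg _).trans (h 0)

lemma measurable_x_apply (t : ℕ) (j : Fin (n + 1)) : Measurable fun ω => x t ω j :=
  (measurable_pi_apply j).comp (hd.measurable_x t)

lemma average_const (c : ℝ) : TendstoInMeasure P
    (fun (T : ℕ) (_ : Ω) => (T : ℝ)⁻¹ * ∑ _t ∈ Finset.range T, c) atTop fun _ => c := by
  refine (tendstoInMeasure_const c).congr' ?_ (by rfl)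
  filter_upwards [eventually_gt_atTop 0] with T hT
  refine ae_of_all _ fun ω => ?_
  have : (T : ℝ) ≠ 0 := by exact_mod_cast hT.ne'
  simp [this]

variable (hf : IsErrorDensity f α) (hreg : IsRegularDensity f α)
include hf

lemma weighted_first {k : ℝ → ℝ} (hk : Measurable k) (hki : Integrable k (errorLaw f))
    (j : Fin (n + 1)) : TendstoInMeasure P (fun (T : ℕ) ω =>
      (T : ℝ)⁻¹ * ∑ t ∈ Finset.range T, x t ω j * k (s t ω)) atTop
      fun _ => m j * ∫ r, k r ∂(errorLaw f) := by
  have := hf.isProbabilityMeasure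
  refine tendstoInMeasure_weighted hd.measurable_s hd.law hd.indep
    (fun t => hd.measurable_x_apply t j) ?_ (fun t => (hd.bound t).mono fun ω h => h j) hk hki
    (hd.first j)
  exact hd.exo.comp (φ := fun (a : ℕ → Fin (n + 1) → ℝ) t => a t j) (ψ := id)
    (by fun_prop) measurable_id

lemma weighted_second {k : ℝ → ℝ} (hk : Measurable k) (hki : Integrable k (errorLaw f))
    (i j : Fin (n + 1)) : TendstoInMeasure P (fun (T : ℕ) ω =>
      (T : ℝ)⁻¹ * ∑ t ∈ Finset.range T, x t ω i * x t ω j * k (s t ω)) atTop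
      fun _ => S i j * ∫ r, k r ∂(errorLaw f) := by
  have := hf.isProbabilityMeasure
  refine tendstoInMeasure_weighted (C := C * C) hd.measurable_s hd.law hd.indep
    (fun t => (hd.measurable_x_apply t i).mul (hd.measurable_x_apply t j)) ?_
    (fun t => (hd.bound t).mono fun ω h => ?_) hk hki (hd.second i j)
  · exact hd.exo.comp (φ := fun (a : ℕ → Fin (n + 1) → ℝ) t => a t i * a t j) (ψ := id)
      (by fun_prop) measurable_id
  · simp only [Pi.mul_apply, abs_mul]
    exact mul_le_mul (h i) (h j) (abs_nonneg _) hd.nonneg_bound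

lemma average_errors {k : ℝ → ℝ} (hk : Measurable k) (hki : Integrable k (errorLaw f)) :
    TendstoInMeasure P (fun (T : ℕ) ω => (T : ℝ)⁻¹ * ∑ t ∈ Finset.range T, k (s t ω)) atTop
      fun _ => ∫ r, k r ∂(errorLaw f) := by
  have := hf.isProbabilityMeasure
  have h := tendstoInMeasure_weighted (P := P) (p := fun _ _ => 1) (C := 1) hd.measurable_s hd.law
    hd.indep (fun t => measurable_const) (indepFun_const_left _ _) (by simp) hk hki
    (hd.average_const 1)
  simpa using h

include hreg

/-- The averaged derivative of the score converges to `-Ψ`. -/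
lemma tendstoInMeasure_scoreDeriv (i j : Fin (n + 1) ⊕ Unit) :
    TendstoInMeasure P (fun (T : ℕ) ω => (T : ℝ)⁻¹ * ∑ t ∈ Finset.range T,
      scoreDeriv f α σ (x t ω) (s t ω) i j) atTop fun _ => -(Psi f α σ S m i j) := by
  have hψ := (continuous_deriv_psi hf hreg).measurable
  have hh := (continuous_scaleScoreDeriv hf hreg).measurable
  have i0 := integrable_deriv_psi_errorLaw hf hreg 0 (by norm_num)
  have i1 := integrable_deriv_psi_errorLaw hf hreg 1 (by norm_num)
  have j0 := integrable_scaleScoreDeriv_errorLaw hf hreg 0 (by norm_num)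
  have j1 := integrable_scaleScoreDeriv_errorLaw hf hreg 1 (by norm_num)
  simp only [pow_zero, pow_one, one_mul] at i0 i1 j0 j1
  rcases i with i | ⟨⟩ <;> rcases j with j | ⟨⟩
  · convert! hd.weighted_second hf hψ i0 i j using 2
    rw [integral_deriv_psi_errorLaw hf hreg]
    simp [Psi]; ring
  · convert! hd.weighted_first hf (k := fun r => r * deriv (psi f α) r / (2 * σ))
      (by fun_prop) (i1.div_const _) i using 2
    rw [integral_div, integral_mul_deriv_psi_errorLaw hf hreg]
    simp [Psi]; ring
  · convert! hd.weighted_first hf (k := fun r => scaleScoreDeriv f α r / (2 * σ))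
      (by fun_prop) (j0.div_const _) j using 2
    rw [integral_div, integral_scaleScoreDeriv_zero hf hreg]
    simp [Psi]; ring
  · convert! hd.average_errors hf (k := fun r => r * scaleScoreDeriv f α r / (4 * σ ^ 2))
      (by fun_prop) (j1.div_const _) using 2
    rw [integral_div, integral_scaleScoreDeriv_one hf hreg]
    simp [Psi]; ring

/-- The simplified Newton iteration is locally a contraction, with probability tending to one. -/
theorem exists_tendsto_lipschitzNearZero (hσ : 0 < σ) (hΨ : (Psi f α σ S m).det ≠ 0) (K : ℝ)
    (hK : 0 < K) :
    ∃ ρ > 0, Tendsto (fun T => P {ω | ¬ LipschitzNearZero (newtonStep (Psi f α σ S m)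
      (localScore f α σ T (fun t => x t ω) fun t => s t ω)) ρ K}) atTop (𝓝 0) := by
  set Ψ := Psi f α σ S m with hΨdef
  set a := ∑ i, ∑ j, |Ψ⁻¹ i j| with ha
  have ha0 : 0 ≤ a := Finset.sum_nonneg fun i _ => Finset.sum_nonneg fun j _ => abs_nonneg _
  obtain ⟨ρ, hρ, W, hW, hWi, hWε, hlin⟩ := exists_scoreTerm_majorant (n := n) hf hreg hσ
    hd.nonneg_bound (ε := K / (2 * (a + 1))) (by positivity)
  refine ⟨ρ, hρ, ?_⟩
  set H : ℕ → Ω → Matrix (Fin (n + 1) ⊕ Unit) (Fin (n + 1) ⊕ Unit) ℝ := fun T ω i j =>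
    (T : ℝ)⁻¹ * ∑ t ∈ Finset.range T, scoreDeriv f α σ (x t ω) (s t ω) i j with hH
  -- `Λ` is a Lipschitz constant of `Ψφ + S(φ)` on the ball: the distance of the averaged derivative
  -- from `-Ψ`, plus the averaged linearization error. Its limit `∫ W` is below `K/(2(a+1))`.
  set Λ : ℕ → Ω → ℝ := fun T ω => (∑ i, ∑ j, |H T ω i j - -(Ψ i j)|) +
    (T : ℝ)⁻¹ * ∑ t ∈ Finset.range T, W (s t ω) with hΛ
  have hlim : TendstoInMeasure P Λ atTop fun _ => ∫ r, W r ∂(errorLaw f) := by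
    have h1 := tendstoInMeasure_sum (P := P) Finset.univ
      (X := fun i T ω => ∑ j, |H T ω i j - -(Ψ i j)|) (c := fun _ => 0) fun i _ => by
        have := tendstoInMeasure_sum (P := P) Finset.univ
          (X := fun j T ω => |H T ω i j - -(Ψ i j)|) (c := fun _ => 0) fun j _ =>
            tendstoInMeasure_abs_sub (hd.tendstoInMeasure_scoreDeriv hf hreg i j)
        simpa only [Finset.sum_const_zero] using this
    have h2 := tendstoInMeasure_add h1 (hd.average_errors hf hW.measurable hWi)
    simpa only [Finset.sum_const_zero, zero_add] using h2
  have hbad := tendstoInMeasure_real_iff.1 hlim (K / (2 * (a + 1))) (by positivity)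
  -- The failure event quantifies over all pairs in the ball; an almost sure inclusion bounds its
  -- outer measure, so its measurability is not needed.
  refine tendsto_of_tendsto_of_tendsto_of_le_of_le tendsto_const_nhds hbad (fun _ => zero_le)
    fun T => measure_mono_ae ?_
  filter_upwards [ae_all_iff.2 hd.bound] with ω hω hnot
  by_contra hgood
  refine hnot fun φ φ' hφ hφ' => ?_
  have hΛK : Λ T ω ≤ K / (a + 1) := by
    have h1 : |Λ T ω - ∫ r, W r ∂(errorLaw f)| < K / (2 * (a + 1)) := not_le.1 hgood
    have h2 : K / (2 * (a + 1)) + K / (2 * (a + 1)) = K / (a + 1) := by field_simp; ring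
    linarith [(abs_lt.1 h1).2]
  set Sc := localScore f α σ T (fun t => x t ω) fun t => s t ω with hSc
  set d := φ - φ' with hddef
  have hv : ∀ i, |(Ψ *ᵥ d + (Sc φ - Sc φ')) i| ≤ Λ T ω * ‖d‖ := fun i => by
    have hdec : (Ψ *ᵥ d + (Sc φ - Sc φ')) i = (∑ j, (H T ω i j - -(Ψ i j)) * d j) +
        (T : ℝ)⁻¹ * ∑ t ∈ Finset.range T, (scoreTerm f α σ (x t ω) (s t ω) φ i
          - scoreTerm f α σ (x t ω) (s t ω) φ' i
          - (scoreDeriv f α σ (x t ω) (s t ω) *ᵥ d) i) := by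
      have h1 : ∑ j, H T ω i j * d j = (T : ℝ)⁻¹ * ∑ t ∈ Finset.range T,
          (scoreDeriv f α σ (x t ω) (s t ω) *ᵥ d) i := by
        simp only [hH, Matrix.mulVec, dotProduct, mul_assoc, Finset.sum_mul]
        rw [← Finset.mul_sum, Finset.sum_comm]
      simp only [Pi.add_apply, Pi.sub_apply, hSc, localScore, Pi.smul_apply, Finset.sum_apply,
        smul_eq_mul, Finset.sum_sub_distrib, mul_sub, sub_neg_eq_add, add_mul,
        Finset.sum_add_distrib]
      rw [h1, Matrix.mulVec, dotProduct]
      ring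
    have h1 : |∑ j, (H T ω i j - -(Ψ i j)) * d j| ≤ (∑ i, ∑ j, |H T ω i j - -(Ψ i j)|) * ‖d‖ := by
      calc _ ≤ ∑ j, |H T ω i j - -(Ψ i j)| * ‖d‖ := by
            refine (Finset.abs_sum_le_sum_abs _ _).trans (Finset.sum_le_sum fun j _ => ?_)
            rw [abs_mul]
            exact mul_le_mul_of_nonneg_left (norm_le_pi_norm d j) (abs_nonneg _)
        _ = (∑ j, |H T ω i j - -(Ψ i j)|) * ‖d‖ := by rw [Finset.sum_mul]
        _ ≤ _ := by
            refine mul_le_mul_of_nonneg_right ?_ (norm_nonneg _)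
            exact Finset.single_le_sum (f := fun i => ∑ j, |H T ω i j - -(Ψ i j)|)
              (fun i _ => Finset.sum_nonneg fun j _ => abs_nonneg _) (Finset.mem_univ i)
    rw [hdec]
    refine (abs_add_le _ _).trans ?_
    rw [hΛ, add_mul]
    refine add_le_add h1 ?_
    rw [abs_mul, abs_of_nonneg (by positivity : (0 : ℝ) ≤ (T : ℝ)⁻¹), mul_assoc, Finset.sum_mul]
    refine mul_le_mul_of_nonneg_left ?_ (by positivity)
    exact (Finset.abs_sum_le_sum_abs _ _).trans (Finset.sum_le_sum fun t _ =>
      hlin _ _ (hω t) φ φ' hφ hφ' i)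
  have hΛ0 : 0 ≤ Λ T ω * ‖d‖ := (abs_nonneg _).trans (hv (Sum.inr ()))
  have heq : newtonStep Ψ Sc φ - newtonStep Ψ Sc φ' = Ψ⁻¹ *ᵥ (Ψ *ᵥ d + (Sc φ - Sc φ')) := by
    rw [Matrix.mulVec_add, Matrix.mulVec_mulVec,
      Matrix.nonsing_inv_mul _ (isUnit_iff_ne_zero.2 hΨ), Matrix.one_mulVec, Matrix.mulVec_sub]
    simp only [newtonStep, hddef]
    abel
  rw [heq]
  calc _ ≤ a * ‖Ψ *ᵥ d + (Sc φ - Sc φ')‖ := norm_mulVec_le _ _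
    _ ≤ a * (Λ T ω * ‖d‖) := mul_le_mul_of_nonneg_left
        ((pi_norm_le_iff_of_nonneg hΛ0).2 hv) ha0
    _ ≤ a * (K / (a + 1) * ‖d‖) := by gcongr
    _ = (a / (a + 1)) * (K * ‖d‖) := by field_simp
    _ ≤ 1 * (K * ‖d‖) := by
        refine mul_le_mul_of_nonneg_right ?_ (by positivity)
        rw [div_le_one (by positivity)]; linarith
    _ = K * ‖d‖ := one_mul _

end IsRegressionDesign

end Lipschitz

/-! ### Asymptotic normality of the score -/

section ScoreCLT

variable {Ω : Type*} [MeasurableSpace Ω] {P : Measure Ω} [IsProbabilityMeasure P] {n : ℕ}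
  {x : ℕ → Ω → Fin (n + 1) → ℝ} {s : ℕ → Ω → ℝ} {f : ℝ → ℝ} {α σ C : ℝ}
  {S : Matrix (Fin (n + 1)) (Fin (n + 1)) ℝ} {m : Fin (n + 1) → ℝ}

namespace IsRegressionDesign

variable (hd : IsRegressionDesign P x s f C S m)
include hd

lemma tendstoInMeasure_dotProduct (a : Fin (n + 1) → ℝ) :
    TendstoInMeasure P (fun (T : ℕ) ω => (T : ℝ)⁻¹ * ∑ t ∈ Finset.range T, a ⬝ᵥ x t ω) atTop
      fun _ => a ⬝ᵥ m := by
  have h := tendstoInMeasure_sum (P := P) Finset.univ fun j _ =>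
    tendstoInMeasure_const_mul (a j) (hd.first j)
  refine h.congr_left fun T => ae_of_all _ fun ω => ?_
  simp only [dotProduct]
  rw [Finset.sum_comm, Finset.mul_sum]
  refine Finset.sum_congr rfl fun j _ => ?_
  rw [← Finset.mul_sum]; ring

lemma tendstoInMeasure_dotProduct_sq (a : Fin (n + 1) → ℝ) :
    TendstoInMeasure P (fun (T : ℕ) ω =>
      (T : ℝ)⁻¹ * ∑ t ∈ Finset.range T, (a ⬝ᵥ x t ω) ^ 2) atTop fun _ => a ⬝ᵥ S *ᵥ a := by
  have h := tendstoInMeasure_sum (P := P) Finset.univ fun j _ =>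
    tendstoInMeasure_sum (P := P) Finset.univ fun k _ =>
      tendstoInMeasure_const_mul (a j * a k) (hd.second j k)
  have hlim : a ⬝ᵥ S *ᵥ a = ∑ j, ∑ k, a j * a k * S j k := by
    simp only [dotProduct, Matrix.mulVec, Finset.mul_sum]
    exact Finset.sum_congr rfl fun j _ => Finset.sum_congr rfl fun k _ => by ring
  rw [hlim]
  refine h.congr_left fun T => ae_of_all _ fun ω => ?_
  have hsq : ∀ t, (a ⬝ᵥ x t ω) ^ 2 = ∑ j, ∑ k, a j * a k * (x t ω j * x t ω k) := fun t => by
    rw [sq]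
    simp only [dotProduct, Fintype.sum_mul_sum]
    exact Finset.sum_congr rfl fun j _ => Finset.sum_congr rfl fun k _ => by ring
  symm
  simp only [hsq, Finset.mul_sum]
  rw [Finset.sum_comm]
  refine Finset.sum_congr rfl fun j _ => ?_
  rw [Finset.sum_comm]
  refine Finset.sum_congr rfl fun k _ => Finset.sum_congr rfl fun t _ => ?_
  ring

variable (hf : IsErrorDensity f α) (hreg : IsRegularDensity f α)
include hf hreg

/-- Convergence of the characteristic function of the normalized score. -/
theorem tendsto_charFun_localScore (hα : 0 ≤ α) (l : Fin (n + 1) ⊕ Unit → ℝ) :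
    Tendsto (fun T : ℕ => ∫ ω, Complex.exp (Complex.I * ((√(T : ℝ) * (l ⬝ᵥ
      localScore f α σ T (fun t => x t ω) (fun t => s t ω) 0) : ℝ) : ℂ)) ∂P) atTop
      (𝓝 (Complex.exp (-((l ⬝ᵥ Omega f α σ S m *ᵥ l) / 2 : ℝ)))) := by
  have := hf.isProbabilityMeasure
  set a := l ∘ Sum.inl with ha
  set q := l (Sum.inr ()) / (2 * σ) with hq
  have hψ := (continuous_psi hf hreg).measurable
  have hh := (continuous_centredScaleScore hf hreg).measurable
  set z : (Fin (n + 1) → ℝ) → ℝ → ℝ := fun x r =>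
    (a ⬝ᵥ x) * psi f α r + q * centredScaleScore f α r with hz
  have hdot : Measurable fun x : Fin (n + 1) → ℝ => a ⬝ᵥ x := by
    simp only [dotProduct]; fun_prop
  have iψ := integrable_psi_errorLaw hf hreg 0 (by norm_num)
  simp only [pow_zero, one_mul] at iψ
  have ih := integrable_centredScaleScore_errorLaw hf hreg
  have iψ2 := integrable_psi_sq hf hreg
  have ih2 := integrable_centredScaleScore_sq hf hreg
  have iψh := integrable_psi_mul_centredScaleScore hf hreg
  set V : (Fin (n + 1) → ℝ) → ℝ := fun x => (a ⬝ᵥ x) ^ 2 * zeta11 f (2 * α) +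
    2 * q * (a ⬝ᵥ x) * (2 * (zeta12 f (2 * α) - phi1 f α * phi2 f α)) +
    q ^ 2 * (4 * (zeta22 f (2 * α) - phi2 f α ^ 2)) with hV
  have hVeq : ∀ x, ∫ r, z x r ^ 2 ∂(errorLaw f) = V x := fun x => by
    have h1 : ∀ r, z x r ^ 2 = ((a ⬝ᵥ x) ^ 2 * psi f α r ^ 2 +
        2 * q * (a ⬝ᵥ x) * (psi f α r * centredScaleScore f α r)) +
        q ^ 2 * centredScaleScore f α r ^ 2 := fun r => by simp only [hz]; ring
    have i12 : Integrable (fun r => (a ⬝ᵥ x) ^ 2 * psi f α r ^ 2 +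
        2 * q * (a ⬝ᵥ x) * (psi f α r * centredScaleScore f α r)) (errorLaw f) :=
      (iψ2.const_mul _).add (iψh.const_mul _)
    simp only [h1]
    rw [integral_add i12 (ih2.const_mul _), integral_add (iψ2.const_mul _) (iψh.const_mul _),
      integral_const_mul, integral_const_mul, integral_const_mul, integral_psi_sq hf hreg,
      integral_psi_mul_centredScaleScore hf hreg hα, integral_centredScaleScore_sq hf hreg hα]
  have hlim : TendstoInMeasure P (fun (T : ℕ) ω =>
      (T : ℝ)⁻¹ * ∑ t ∈ Finset.range T, ∫ r, z (x t ω) r ^ 2 ∂(errorLaw f)) atTop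
      fun _ => l ⬝ᵥ Omega f α σ S m *ᵥ l := by
    have h1 := tendstoInMeasure_const_mul (zeta11 f (2 * α)) (hd.tendstoInMeasure_dotProduct_sq a)
    have h2 := tendstoInMeasure_const_mul
      (2 * q * (2 * (zeta12 f (2 * α) - phi1 f α * phi2 f α))) (hd.tendstoInMeasure_dotProduct a)
    have h3 := hd.average_const (q ^ 2 * (4 * (zeta22 f (2 * α) - phi2 f α ^ 2)))
    convert! tendstoInMeasure_add (tendstoInMeasure_add h1 h2) h3 using 3 with T ω
    · simp only [hVeq, hV, Finset.sum_add_distrib, mul_add]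
      congr 1
      congr 1
      · rw [← Finset.sum_mul]; ring
      · rw [← Finset.sum_mul, ← Finset.mul_sum]; ring
    · rw [Omega, dotProduct_block_mulVec, phi1, M_zero_one hf hreg hα]
      simp only [← ha, hq]
      field_simp
      ring
  -- This `G` dominates `z x` for every `x` in the box `|x j| ≤ C`, where the regressors lie almost
  -- surely.
  have hclt := tendsto_integral_exp_weighted_sum (G := fun r =>
      (∑ j, |a j|) * C * |psi f α r| + |q| * |centredScaleScore f α r|)
    (K := {x | ∀ j, |x j| ≤ C}) hd.measurable_s hd.law hd.indep hd.measurable_x hd.exo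
    (z := z) ?_ ?_ ?_ ?_ hd.bound ?_ hlim
  · refine hclt.congr fun T => ?_
    congr 1; ext ω
    congr 3
    have h1 : ∀ t, l ⬝ᵥ scoreTerm f α σ (x t ω) (s t ω) 0 = z (x t ω) (s t ω) := fun t => by
      simp only [hz, scoreTerm, localResid_zero, dotProduct, Fintype.sum_sum_type, Sum.elim_inl,
        Sum.elim_inr, Finset.univ_unique, Finset.sum_singleton, PUnit.default_eq_unit,
        Finset.sum_mul, ha, hq, Function.comp_apply]
      congr 1
      · exact Finset.sum_congr rfl fun j _ => by ring
      · ring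
    rw [localScore, dotProduct_smul, dotProduct_sum, smul_eq_mul, ← mul_assoc]
    simp only [h1]
    congr 1
    rcases Nat.eq_zero_or_pos T with rfl | hT
    · simp
    · have : (0 : ℝ) < T := by exact_mod_cast hT
      rw [← div_eq_mul_inv, Real.sqrt_div_self', one_div]
  · simp only [hz, Function.uncurry_def]
    have : Measurable fun p : (Fin (n + 1) → ℝ) × ℝ => a ⬝ᵥ p.1 := hdot.comp measurable_fst
    fun_prop
  · fun_prop
  · refine (((iψ2.const_mul (2 * ((∑ j, |a j|) * C) ^ 2)).add
      (ih2.const_mul (2 * q ^ 2)))).mono' (by fun_prop) (ae_of_all _ fun r => ?_)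
    rw [Real.norm_of_nonneg (sq_nonneg _)]
    simp only [Pi.add_apply]
    rw [← sq_abs (psi f α r), ← sq_abs (centredScaleScore f α r), ← sq_abs q]
    nlinarith [sq_nonneg ((∑ j, |a j|) * C * |psi f α r| - |q| * |centredScaleScore f α r|)]
  · intro x hx r
    refine (abs_add_le _ _).trans ?_
    rw [abs_mul, abs_mul]
    gcongr
    exact abs_dotProduct_le hx
  · intro x
    simp only [hz]
    rw [integral_add (iψ.const_mul _) (ih.const_mul _), integral_const_mul, integral_const_mul,
      integral_psi_errorLaw hf hreg hα, integral_centredScaleScore_errorLaw hf hreg hα]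
    simp

end IsRegressionDesign

end ScoreCLT

/-! ### Convergence in distribution and stochastic boundedness. -/

section Distribution

variable {Ω : Type*} [MeasurableSpace Ω] {P : Measure Ω} [IsProbabilityMeasure P]
  {ι : Type*} [Fintype ι] [DecidableEq ι]

/-- The Lévy continuity theorem for a multivariate normal limit. -/
lemma tendstoInDistribution_multivariateGaussian {V : ℕ → Ω → ι → ℝ} (hV : ∀ T, Measurable (V T))
    {Q : Matrix ι ι ℝ} (hQ : Q.PosSemidef)
    (h : ∀ l : ι → ℝ, Tendsto
      (fun T => ∫ ω, Complex.exp (Complex.I * ((l ⬝ᵥ V T ω : ℝ) : ℂ)) ∂P) atTop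
      (𝓝 (Complex.exp (-((l ⬝ᵥ Q *ᵥ l) / 2 : ℝ))))) :
    TendstoInDistribution (fun T ω => (WithLp.toLp 2 (V T ω) : EuclideanSpace ℝ ι)) atTop
      (id : EuclideanSpace ℝ ι → EuclideanSpace ℝ ι) (fun _ => P) (multivariateGaussian 0 Q) := by
  have hm : ∀ T, Measurable fun ω => (WithLp.toLp 2 (V T ω) : EuclideanSpace ℝ ι) := fun T => by
    have := hV T
    fun_prop
  refine ⟨fun T => (hm T).aemeasurable, aemeasurable_id, ?_⟩
  refine ProbabilityMeasure.tendsto_iff_tendsto_charFun.2 fun u => ?_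
  simp only [ProbabilityMeasure.coe_mk, Measure.map_id]
  rw [charFun_multivariateGaussian hQ]
  have := h u
  convert! this using 2 with T
  · rw [charFun_apply, integral_map (hm T).aemeasurable (by fun_prop)]
    congr 1; ext ω
    rw [mul_comm]
    congr 3
  · simp

/-- A sequence that converges in distribution is bounded in probability. -/
lemma boundedInProbability_norm_of_tendstoInDistribution {E : Type*} [NormedAddCommGroup E]
    [MeasurableSpace E] [BorelSpace E] {V : ℕ → Ω → E} {μ : Measure E}
    [IsProbabilityMeasure μ]
    (h : TendstoInDistribution V atTop (id : E → E) (fun _ => P) μ) :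
    BoundedInProbability P fun T ω => ‖V T ω‖ := by
  intro ε hε
  have hclosed : ∀ k : ℕ, IsClosed {x : E | (k : ℝ) ≤ ‖x‖} := fun k =>
    isClosed_le continuous_const continuous_norm
  have hlim : Tendsto (fun k : ℕ => μ {x : E | (k : ℝ) ≤ ‖x‖}) atTop (𝓝 0) := by
    have := tendsto_measure_iInter_atTop (μ := μ) (s := fun k : ℕ => {x : E | (k : ℝ) ≤ ‖x‖})
      (fun k => (hclosed k).measurableSet.nullMeasurableSet)
      (fun k k' hk x hx => by
        have : (k : ℝ) ≤ k' := by exact_mod_cast hk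
        exact this.trans hx) ⟨0, measure_ne_top _ _⟩
    have hempty : ⋂ k : ℕ, {x : E | (k : ℝ) ≤ ‖x‖} = ∅ := by
      ext x
      simp only [Set.mem_iInter, Set.mem_ofPred_eq, Set.mem_empty_iff_false, iff_false, not_forall,
        not_le]
      exact exists_nat_gt ‖x‖
    rwa [hempty, measure_empty] at this
  obtain ⟨k, hk⟩ := (hlim.eventually_lt_const hε).exists
  -- Portmanteau for the closed sets `{k ≤ ‖x‖}`: a tail level that is good for the limit law is
  -- eventually good for the sequence.
  have hls := ProbabilityMeasure.limsup_measure_closed_le_of_tendsto h.tendsto (hclosed k)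
  simp only [ProbabilityMeasure.coe_mk, Measure.map_id] at hls
  have hev := eventually_lt_of_limsup_lt (hls.trans_lt hk)
  refine ⟨k, ?_⟩
  filter_upwards [hev] with T hT
  rw [Measure.map_apply_of_aemeasurable (h.forall_aemeasurable T) (hclosed k).measurableSet] at hT
  refine (measure_mono fun ω hω => ?_).trans hT.le
  simp only [Set.mem_ofPred_eq, abs_norm] at hω
  exact hω.le

lemma BoundedInProbability.mono {Z Y : ℕ → Ω → ℝ} (hZ : BoundedInProbability P Z) {c : ℝ}
    (hc : 0 ≤ c) (h : ∀ T ω, |Y T ω| ≤ c * |Z T ω|) : BoundedInProbability P Y := by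
  intro ε hε
  obtain ⟨K, hK⟩ := hZ ε hε
  refine ⟨c * K, hK.mono fun T hT => (measure_mono fun ω hω => ?_).trans hT⟩
  simp only [Set.mem_ofPred_eq] at *
  by_contra! hcon
  exact absurd (hω.trans_le (h T ω)) (not_lt.2 (mul_le_mul_of_nonneg_left hcon hc))

/-- If `√T Z_T = O_p(1)`, then `√T Z_T² = o_p(1)`. -/
lemma BoundedInProbability.tendsto_measure_sqrt_mul_sq {Z : ℕ → Ω → ℝ}
    (hZ : BoundedInProbability P fun T ω => √(T : ℝ) * Z T ω) {ε : ℝ} (hε : 0 < ε) :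
    Tendsto (fun T : ℕ => P {ω | ε ≤ √(T : ℝ) * Z T ω ^ 2}) atTop (𝓝 0) := by
  rw [ENNReal.tendsto_nhds_zero]
  intro δ hδ
  obtain ⟨M, hM⟩ := hZ (δ / 2) (ENNReal.half_pos hδ.ne')
  have h2 := ENNReal.tendsto_nhds_zero.1 (hZ.tendsto_measure_lt
    (ρ := ε / (|M| + 1)) (by positivity)) (δ / 2) (ENNReal.half_pos hδ.ne')
  filter_upwards [hM, h2] with T hT h2T
  rw [← ENNReal.add_halves δ]
  refine (measure_mono (t := {ω | M < |√(T : ℝ) * Z T ω|} ∪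
    {ω | ε / (|M| + 1) ≤ |Z T ω|}) fun ω hω => ?_).trans
    ((measure_union_le _ _).trans (add_le_add hT h2T))
  simp only [Set.mem_union, Set.mem_ofPred_eq] at *
  by_contra! hcon
  have h3 : |Z T ω| * (|M| + 1) < ε := by
    rw [← lt_div_iff₀ (by positivity)]; exact hcon.2
  have h4 := hcon.1.trans (le_abs_self M)
  rw [abs_mul, abs_of_nonneg (Real.sqrt_nonneg _)] at h4
  rw [← sq_abs] at hω
  nlinarith [mul_le_mul_of_nonneg_right h4 (abs_nonneg (Z T ω)), abs_nonneg (Z T ω)]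

end Distribution

/-! ### The estimator -/

section Estimator

variable {n : ℕ} {f : ℝ → ℝ} {α σ : ℝ}

/-- The score in local coordinates as a function of the data. -/
def dataScore (f : ℝ → ℝ) (α σ : ℝ) {T : ℕ} (β : Fin (n + 1) → ℝ) (D : Fin T → Fin (n + 1) → ℝ)
    (φ : Fin (n + 1) ⊕ Unit → ℝ) : Fin (n + 1) ⊕ Unit → ℝ :=
  (T : ℝ)⁻¹ • ∑ t, scoreTerm f α σ (regressor (D t)) (resid β (σ ^ 2) (D t)) φ

/-- The local parameter estimated by the simplified Newton iteration. -/
def localEstimate (f : ℝ → ℝ) (α σ : ℝ) {T : ℕ} (β : Fin (n + 1) → ℝ)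
    (A : Matrix (Fin (n + 1) ⊕ Unit) (Fin (n + 1) ⊕ Unit) ℝ) (D : Fin T → Fin (n + 1) → ℝ) :
    Fin (n + 1) ⊕ Unit → ℝ :=
  iterLimit (newtonStep A (dataScore f α σ β D))

/-- The regression coefficients belonging to a local parameter. -/
def coefOfLocal (σ : ℝ) (β : Fin (n + 1) → ℝ) (φ : Fin (n + 1) ⊕ Unit → ℝ) : Fin (n + 1) → ℝ :=
  fun j => β j - σ / (1 + φ (Sum.inr ()) / (2 * σ)) * φ (Sum.inl j)

/-- The variance belonging to a local parameter. -/
def varOfLocal (σ : ℝ) (φ : Fin (n + 1) ⊕ Unit → ℝ) : ℝ :=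
  (σ / (1 + φ (Sum.inr ()) / (2 * σ))) ^ 2

/-- Dividing `σs + σ/(1+κ) γ'x` by `√v = σ/(1+κ)` gives `γ'x + (1+κ)s`. Positivity of `1 + κ` is
what identifies the square root. -/
lemma resid_ofLocal (hσ : 0 < σ) (β : Fin (n + 1) → ℝ) {φ : Fin (n + 1) ⊕ Unit → ℝ}
    (hφ : 0 < 1 + φ (Sum.inr ()) / (2 * σ)) (w : Fin (n + 1) → ℝ) :
    resid (coefOfLocal σ β φ) (varOfLocal σ φ) w =
      localResid σ (regressor w) (resid β (σ ^ 2) w) φ := by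
  have hdot : coefOfLocal σ β φ ⬝ᵥ regressor w = β ⬝ᵥ regressor w -
      σ / (1 + φ (Sum.inr ()) / (2 * σ)) * ((φ ∘ Sum.inl) ⬝ᵥ regressor w) := by
    simp only [coefOfLocal, dotProduct, sub_mul, Finset.sum_sub_distrib, Finset.mul_sum,
      Function.comp_apply, mul_assoc]
  simp only [resid, localResid]
  rw [hdot, varOfLocal, Real.sqrt_sq (by positivity), Real.sqrt_sq hσ.le]
  set k := 1 + φ (Sum.inr ()) / (2 * σ)
  field_simp
  ring

/-- A fixed point satisfies `A⁻¹S = 0`, hence `S = 0`. Its regressor coordinates are the intercept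
and slope equations, and its last one is the scale equation. -/
lemma isMDPDERoot_ofLocal (hσ : 0 < σ) {T : ℕ} (hT : 0 < T) {β : Fin (n + 1) → ℝ}
    {D : Fin T → Fin (n + 1) → ℝ} {A : Matrix (Fin (n + 1) ⊕ Unit) (Fin (n + 1) ⊕ Unit) ℝ}
    (hA : A.det ≠ 0) {φ : Fin (n + 1) ⊕ Unit → ℝ}
    (hfix : newtonStep A (dataScore f α σ β D) φ = φ) (hφ : 0 < 1 + φ (Sum.inr ()) / (2 * σ)) :
    IsMDPDERoot f α D (coefOfLocal σ β φ) (varOfLocal σ φ) := by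
  have hscore : dataScore f α σ β D φ = 0 := by
    have h1 : A⁻¹ *ᵥ dataScore f α σ β D φ = 0 := by simpa [newtonStep] using hfix
    have h2 := congrArg (A *ᵥ ·) h1
    simpa [Matrix.mulVec_mulVec, Matrix.mul_nonsing_inv _ (isUnit_iff_ne_zero.2 hA)] using h2
  have hT0 : (T : ℝ) ≠ 0 := by exact_mod_cast hT.ne'
  have hcoef : ∀ j, ∑ t, psi f α (resid (coefOfLocal σ β φ) (varOfLocal σ φ) (D t)) *
      regressor (D t) j = 0 := fun j => by
    have := congrFun hscore (Sum.inl j)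
    simpa [dataScore, scoreTerm, hT0, resid_ofLocal hσ β hφ] using this
  have hscale := congrFun hscore (Sum.inr ())
  refine ⟨?_, ?_, ?_, ?_⟩
  · rw [varOfLocal]; positivity
  · simpa [regressor, psi] using hcoef 0
  · ext j
    simpa [regressor, psi] using hcoef j.succ
  · simp only [resid_ofLocal hσ β hφ]
    simp only [dataScore, scoreTerm, Pi.smul_apply, Finset.sum_apply, Sum.elim_inr, smul_eq_mul,
      Pi.zero_apply, ← Finset.sum_div, centredScaleScore, Finset.sum_sub_distrib,
      Finset.sum_const, Finset.card_univ, Fintype.card_fin, nsmul_eq_mul, scaleScore] at hscale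
    field_simp at hscale ⊢
    linear_combination hscale

lemma measurable_regressor : Measurable (regressor (n := n)) := by
  refine measurable_pi_iff.2 fun j => ?_
  refine Fin.cases ?_ (fun j => ?_) j
  · simp only [regressor, Fin.cons_zero]; exact measurable_const
  · simp only [regressor, Fin.cons_succ, Fin.tail]; fun_prop

lemma measurable_dotProduct_comp {ι X : Type*} [Fintype ι] [MeasurableSpace X] {a b : X → ι → ℝ}
    (ha : Measurable a) (hb : Measurable b) : Measurable fun ω => a ω ⬝ᵥ b ω := by
  simp only [dotProduct]
  fun_prop

lemma measurable_resid (β : Fin (n + 1) → ℝ) (v : ℝ) : Measurable (resid β v) := by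
  have := measurable_dotProduct_comp (measurable_const (a := β)) (measurable_regressor (n := n))
  unfold resid
  fun_prop

variable (hf : IsErrorDensity f α) (hreg : IsRegularDensity f α)
include hf hreg

lemma measurable_scoreTerm_comp {X : Type*} [MeasurableSpace X] {x : X → Fin (n + 1) → ℝ}
    {s : X → ℝ} {φ : X → Fin (n + 1) ⊕ Unit → ℝ} (hx : Measurable x) (hs : Measurable s)
    (hφ : Measurable φ) : Measurable fun ω => scoreTerm f α σ (x ω) (s ω) (φ ω) := by
  have hψ := (continuous_psi hf hreg).measurable
  have hh := (continuous_centredScaleScore hf hreg).measurable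
  have hr : Measurable fun ω => localResid σ (x ω) (s ω) (φ ω) := by
    have : Measurable fun ω => φ ω ∘ Sum.inl :=
      measurable_pi_iff.2 fun j => (measurable_pi_apply (Sum.inl j)).comp hφ
    have := measurable_dotProduct_comp this hx
    simp only [localResid]
    fun_prop
  refine measurable_pi_iff.2 fun i => ?_
  rcases i with j | ⟨⟩
  · simp only [scoreTerm, Sum.elim_inl]; fun_prop
  · simp only [scoreTerm, Sum.elim_inr]; fun_prop

lemma measurable_dataScore_comp {T : ℕ} (β : Fin (n + 1) → ℝ)
    {φ : (Fin T → Fin (n + 1) → ℝ) → Fin (n + 1) ⊕ Unit → ℝ} (hφ : Measurable φ) :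
    Measurable fun D => dataScore f α σ β D (φ D) := by
  have : ∀ t, Measurable fun D : Fin T → Fin (n + 1) → ℝ =>
      scoreTerm f α σ (regressor (D t)) (resid β (σ ^ 2) (D t)) (φ D) := fun t =>
    measurable_scoreTerm_comp hf hreg (measurable_regressor.comp (measurable_pi_apply t))
      ((measurable_resid _ _).comp (measurable_pi_apply t)) hφ
  simp only [dataScore]
  exact (Finset.measurable_sum _ fun t _ => this t).const_smul (T : ℝ)⁻¹

/-- Each iterate is measurable in the data, and `limUnder` preserves measurability even where the
iterates diverge and it takes an arbitrary value. No measurable selection of a root is needed. -/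
lemma measurable_localEstimate {T : ℕ} (β : Fin (n + 1) → ℝ)
    (A : Matrix (Fin (n + 1) ⊕ Unit) (Fin (n + 1) ⊕ Unit) ℝ) :
    Measurable fun D : Fin T → Fin (n + 1) → ℝ => localEstimate f α σ β A D := by
  have hiter : ∀ k, Measurable fun D : Fin T → Fin (n + 1) → ℝ =>
      (newtonStep A (dataScore f α σ β D))^[k] 0 := fun k => by
    induction k with
    | zero => exact measurable_const
    | succ k ih =>
      simp only [Function.iterate_succ_apply', newtonStep]
      have hA : Measurable fun v : Fin (n + 1) ⊕ Unit → ℝ => A⁻¹ *ᵥ v :=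
        (Continuous.matrix_mulVec continuous_const continuous_id).measurable
      exact ih.add (hA.comp (measurable_dataScore_comp hf hreg β ih))
  exact (StronglyMeasurable.limUnder fun k => (hiter k).stronglyMeasurable).measurable

end Estimator

/-! ### Return to the original parameters with a quadratic remainder. -/

section Remainder

variable {n : ℕ} {σ : ℝ}

lemma measurable_coefOfLocal (β : Fin (n + 1) → ℝ) : Measurable (coefOfLocal σ β) := by
  refine measurable_pi_iff.2 fun j => ?_
  simp only [coefOfLocal]
  fun_prop

lemma measurable_varOfLocal : Measurable (varOfLocal (n := n) σ) := by
  unfold varOfLocal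
  fun_prop

lemma abs_inr_div_le (hσ : 0 < σ) {φ : Fin (n + 1) ⊕ Unit → ℝ} (hφ : ‖φ‖ ≤ σ) :
    |φ (Sum.inr ()) / (2 * σ)| ≤ 1 / 2 := by
  have h1 : |φ (Sum.inr ())| ≤ ‖φ‖ := norm_le_pi_norm φ (Sum.inr ())
  rw [abs_div, abs_of_pos (by positivity : 0 < 2 * σ), div_le_div_iff₀ (by positivity) two_pos]
  linarith

/-- The parameter is, up to a quadratic remainder, linear in the local parameter. -/
lemma norm_ofLocal_sub_le (hσ : 0 < σ) (β : Fin (n + 1) → ℝ) {φ : Fin (n + 1) ⊕ Unit → ℝ}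
    (hφ : ‖φ‖ ≤ σ) (g : Fin (n + 1) ⊕ Unit → ℝ) :
    ‖(Sum.elim (fun j => coefOfLocal σ β φ j - β j) (fun _ => varOfLocal σ φ - σ ^ 2) -
      (-σ) • g : Fin (n + 1) ⊕ Unit → ℝ)‖ ≤ 4 * ‖φ‖ ^ 2 + σ * ‖φ - g‖ := by
  refine (pi_norm_le_iff_of_nonneg (by positivity)).2 fun i => ?_
  have hk := abs_le.1 (abs_inr_div_le hσ hφ)
  have hd : |φ (Sum.inr ())| ≤ ‖φ‖ := norm_le_pi_norm φ (Sum.inr ())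
  obtain ⟨k, hkφ⟩ : ∃ k, φ (Sum.inr ()) / (2 * σ) = k := ⟨_, rfl⟩
  have hd2 : φ (Sum.inr ()) = 2 * σ * k := by rw [← hkφ]; field_simp
  rw [hkφ] at hk
  have hkpos : 0 < 1 + k := by linarith
  rw [hd2, abs_mul, abs_of_pos (by positivity : 0 < 2 * σ)] at hd
  have hi : |φ i - g i| ≤ ‖φ - g‖ := norm_le_pi_norm (φ - g) i
  have hi' := mul_le_mul_of_nonneg_left hi hσ.le
  rw [Real.norm_eq_abs]
  rcases i with j | ⟨⟩
  · have hj : |φ (Sum.inl j)| ≤ ‖φ‖ := norm_le_pi_norm φ (Sum.inl j)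
    have heq : (Sum.elim (fun j => coefOfLocal σ β φ j - β j) (fun _ => varOfLocal σ φ - σ ^ 2) -
        (-σ) • g : Fin (n + 1) ⊕ Unit → ℝ) (Sum.inl j) =
        φ (Sum.inl j) * (σ * k) * (1 + k)⁻¹ + -(σ * (φ (Sum.inl j) - g (Sum.inl j))) := by
      simp only [Pi.sub_apply, Sum.elim_inl, coefOfLocal, hkφ, Pi.smul_apply, smul_eq_mul]
      field_simp
      ring
    rw [heq]
    refine (abs_add_le _ _).trans (add_le_add ?_ ?_)
    · have h1 : |(1 + k)⁻¹| ≤ 2 := by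
        rw [abs_of_pos (by positivity), inv_le_comm₀ hkpos two_pos]; linarith
      have h2 : |σ * k| ≤ ‖φ‖ := by
        rw [abs_mul, abs_of_pos hσ]
        nlinarith [abs_nonneg k]
      rw [abs_mul, abs_mul]
      calc _ ≤ ‖φ‖ * ‖φ‖ * 2 := by gcongr
        _ ≤ _ := by nlinarith [norm_nonneg φ]
    · rw [abs_neg, abs_mul, abs_of_pos hσ]
      exact hi'
  -- Here `σ²((1+k)⁻² - 1 + 2k) = σ²k²(3 + 2k)/(1+k)²`, and `|k| ≤ 1/2` bounds `(3+2k)/4` by `1` and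
  -- `(1+k)⁻¹` by `2`.
  · have heq : (Sum.elim (fun j => coefOfLocal σ β φ j - β j) (fun _ => varOfLocal σ φ - σ ^ 2) -
        (-σ) • g : Fin (n + 1) ⊕ Unit → ℝ) (Sum.inr ()) =
        (2 * σ * |k|) ^ 2 * ((3 + 2 * k) / 4 * ((1 + k)⁻¹) ^ 2) +
          -(σ * (φ (Sum.inr ()) - g (Sum.inr ()))) := by
      simp only [Pi.sub_apply, Sum.elim_inr, varOfLocal, Pi.smul_apply, smul_eq_mul, hd2,
        mul_pow, sq_abs]
      field_simp
      ring
    rw [heq]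
    refine (abs_add_le _ _).trans (add_le_add ?_ ?_)
    · have h1 : (1 + k)⁻¹ ≤ 2 := by rw [inv_le_comm₀ hkpos two_pos]; linarith
      have h0 : 0 ≤ (3 + 2 * k) / 4 := by linarith
      rw [abs_of_nonneg (by positivity)]
      calc _ ≤ ‖φ‖ ^ 2 * (1 * 2 ^ 2) := by gcongr; linarith
        _ = _ := by ring
    · rw [abs_neg, abs_mul, abs_of_pos hσ]
      exact hi'

end Remainder

/-! ### Asymptotic normality of the estimator -/

section Normality

variable {Ω : Type*} [MeasurableSpace Ω] {P : Measure Ω} [IsProbabilityMeasure P] {n : ℕ}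
  {x : ℕ → Ω → Fin (n + 1) → ℝ} {s : ℕ → Ω → ℝ} {f : ℝ → ℝ} {α σ C : ℝ}
  {S : Matrix (Fin (n + 1)) (Fin (n + 1)) ℝ} {m : Fin (n + 1) → ℝ}

lemma exists_norm_toLp_le (ι : Type*) [Fintype ι] :
    ∃ c > 0, ∀ v : ι → ℝ, ‖(WithLp.toLp 2 v : EuclideanSpace ℝ ι)‖ ≤ c * ‖v‖ := by
  set e := (EuclideanSpace.equiv ι ℝ).symm.toContinuousLinearMap with he
  refine ⟨‖e‖ + 1, by positivity, fun v => (e.le_opNorm v).trans ?_⟩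
  gcongr
  linarith

lemma norm_le_norm_toLp {ι : Type*} [Fintype ι] (v : ι → ℝ) :
    ‖v‖ ≤ ‖(WithLp.toLp 2 v : EuclideanSpace ℝ ι)‖ :=
  (pi_norm_le_iff_of_nonneg (norm_nonneg _)).2 fun i =>
    PiLp.norm_apply_le (WithLp.toLp 2 v : EuclideanSpace ℝ ι) i

namespace IsRegressionDesign

variable (hd : IsRegressionDesign P x s f C S m) (hf : IsErrorDensity f α)
  (hreg : IsRegularDensity f α)
include hd hf hreg

lemma measurable_localScore_zero (T : ℕ) :
    Measurable fun ω => localScore f α σ T (fun t => x t ω) (fun t => s t ω) 0 := by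
  simp only [localScore]
  exact (Finset.measurable_sum _ fun t _ => measurable_scoreTerm_comp hf hreg (hd.measurable_x t)
    (hd.measurable_s t) measurable_const).const_smul (T : ℝ)⁻¹

/-- The first Newton step is asymptotically normal. -/
lemma tendstoInDistribution_newtonStep (hα : 0 ≤ α) (hS : S.IsSymm)
    (hQ : (asympCov f α σ S m).PosSemidef) :
    TendstoInDistribution (fun (T : ℕ) ω => (WithLp.toLp 2 (√(T : ℝ) • (-σ) •
      newtonStep (Psi f α σ S m) (localScore f α σ T (fun t => x t ω) fun t => s t ω) 0) :
        EuclideanSpace ℝ (Fin (n + 1) ⊕ Unit))) atTop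
      (id : EuclideanSpace ℝ (Fin (n + 1) ⊕ Unit) → EuclideanSpace ℝ (Fin (n + 1) ⊕ Unit))
      (fun _ => P) (multivariateGaussian 0 (asympCov f α σ S m)) := by
  have hsymm : (Psi f α σ S m).IsSymm := isSymm_block hS _ _ _
  have hisymm : ((Psi f α σ S m)⁻¹)ᵀ = (Psi f α σ S m)⁻¹ := by
    rw [Matrix.transpose_nonsing_inv, hsymm.eq]
  have hdot : ∀ u v, u ⬝ᵥ (Psi f α σ S m)⁻¹ *ᵥ v = ((Psi f α σ S m)⁻¹ *ᵥ u) ⬝ᵥ v := fun u v => by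
    rw [Matrix.dotProduct_mulVec, ← Matrix.mulVec_transpose, hisymm]
  refine tendstoInDistribution_multivariateGaussian (fun T => ?_) hQ fun l => ?_
  · have hA : Measurable fun v : Fin (n + 1) ⊕ Unit → ℝ => (Psi f α σ S m)⁻¹ *ᵥ v :=
      (Continuous.matrix_mulVec continuous_const continuous_id).measurable
    have := hA.comp (hd.measurable_localScore_zero (σ := σ) hf hreg T)
    exact (((measurable_const (a := (0 : Fin (n + 1) ⊕ Unit → ℝ))).add this).const_smul
      (-σ)).const_smul √(T : ℝ)
  -- By symmetry of `Ψ⁻¹`, testing the Newton step against `l` is testing the score against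
  -- `-σΨ⁻¹l`.
  · have h := hd.tendsto_charFun_localScore (σ := σ) hf hreg hα ((-σ) • (Psi f α σ S m)⁻¹ *ᵥ l)
    convert! h using 2 with T
    · congr 1; ext ω
      congr 3
      simp only [newtonStep, zero_add, dotProduct_smul, smul_dotProduct, smul_eq_mul, hdot]
    · congr 4
      simp only [asympCov, Matrix.smul_mulVec, Matrix.mulVec_smul, dotProduct_smul,
        smul_dotProduct, smul_eq_mul, ← Matrix.mulVec_mulVec, hdot]
      ring

lemma boundedInProbability_newtonStep_zero (hσ : 0 < σ) (hα : 0 ≤ α) (hS : S.IsSymm)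
    (hQ : (asympCov f α σ S m).PosSemidef) :
    BoundedInProbability P fun T ω => √(T : ℝ) *
      ‖newtonStep (Psi f α σ S m) (localScore f α σ T (fun t => x t ω) fun t => s t ω) 0‖ := by
  refine (boundedInProbability_norm_of_tendstoInDistribution
    (hd.tendstoInDistribution_newtonStep hf hreg hα hS hQ)).mono (inv_pos.2 hσ).le fun T ω => ?_
  have h := norm_le_norm_toLp (√(T : ℝ) • (-σ) •
      newtonStep (Psi f α σ S m) (localScore f α σ T (fun t => x t ω) fun t => s t ω) 0)
  rw [norm_smul, norm_smul, norm_neg, Real.norm_of_nonneg hσ.le,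
    Real.norm_of_nonneg (Real.sqrt_nonneg _)] at h
  rw [abs_of_nonneg (by positivity), abs_norm, le_inv_mul_iff₀ hσ]
  linarith

/-- The fixed point of the Newton iteration, in the original parametrization, is asymptotically
normal. -/
theorem tendstoInDistribution_ofLocal (hσ : 0 < σ) (hα : 0 ≤ α) (hS : S.IsSymm)
    (hΨ : (Psi f α σ S m).det ≠ 0) (hQ : (asympCov f α σ S m).PosSemidef)
    (β : Fin (n + 1) → ℝ) {φ : ℕ → Ω → Fin (n + 1) ⊕ Unit → ℝ}
    (hφ : ∀ T ω, φ T ω = iterLimit (newtonStep (Psi f α σ S m)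
      (localScore f α σ T (fun t => x t ω) fun t => s t ω))) (hφm : ∀ T, Measurable (φ T)) :
    TendstoInDistribution (fun (T : ℕ) ω =>
        scaledError T (coefOfLocal σ β (φ T ω)) β (varOfLocal σ (φ T ω)) σ) atTop
      (id : EuclideanSpace ℝ (Fin (n + 1) ⊕ Unit) → EuclideanSpace ℝ (Fin (n + 1) ⊕ Unit))
      (fun _ => P) (multivariateGaussian 0 (asympCov f α σ S m)) := by
  set G : ℕ → Ω → (Fin (n + 1) ⊕ Unit → ℝ) → Fin (n + 1) ⊕ Unit → ℝ := fun T ω =>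
    newtonStep (Psi f α σ S m) (localScore f α σ T (fun t => x t ω) fun t => s t ω) with hG
  have hLip := fun K hK => hd.exists_tendsto_lipschitzNearZero hf hreg hσ hΨ K hK
  have hO := hd.boundedInProbability_newtonStep_zero hf hreg hσ hα hS hQ
  have hbd := boundedInProbability_iterLimit hLip hO
  simp only [← hφ] at hbd
  have hmeas : ∀ T, Measurable fun ω =>
      scaledError T (coefOfLocal σ β (φ T ω)) β (varOfLocal σ (φ T ω)) σ := fun T => by
    have h1 : ∀ j, Measurable fun ω => coefOfLocal σ β (φ T ω) j := fun j =>
      (measurable_pi_apply j).comp ((measurable_coefOfLocal β).comp (hφm T))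
    have h2 : Measurable fun ω => varOfLocal σ (φ T ω) := measurable_varOfLocal.comp (hφm T)
    have h3 : Measurable fun ω => (Sum.elim (fun j => √(T : ℝ) * (coefOfLocal σ β (φ T ω) j - β j))
        (fun _ => √(T : ℝ) * (varOfLocal σ (φ T ω) - σ ^ 2)) : Fin (n + 1) ⊕ Unit → ℝ) := by
      refine measurable_pi_iff.2 fun i => ?_
      rcases i with j | ⟨⟩
      · simp only [Sum.elim_inl]; fun_prop
      · simp only [Sum.elim_inr]; fun_prop
    simp only [scaledError]
    fun_prop
  -- Slutsky's argument: the scaled error differs from `-σ√T G(0)` by a term that vanishes in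
  -- probability.
  refine tendstoInDistribution_of_tendstoInMeasure_sub _ _
    (hd.tendstoInDistribution_newtonStep hf hreg hα hS hQ) ?_ fun T => (hmeas T).aemeasurable
  obtain ⟨c, hc, hcle⟩ := exists_norm_toLp_le (Fin (n + 1) ⊕ Unit)
  rw [tendstoInMeasure_iff_norm]
  intro ε hε
  -- Off the three bad events the difference has norm below `c(4·ε/(8c) + σ·ε/(2cσ)) = ε`, where `c`
  -- compares the Euclidean norm with the sup norm.
  have hbad1 := hbd.tendsto_measure_lt hσ
  have hbad2 := hbd.tendsto_measure_sqrt_mul_sq (ε := ε / (8 * c)) (by positivity)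
  have hbad3 := tendsto_measure_iterLimit_sub hLip hO (ε := ε / (2 * c * σ)) (by positivity)
  simp only [← hφ] at hbad3
  refine tendsto_measure_zero_of_subset_union hbad1
    (tendsto_measure_zero_of_subset_union hbad2 hbad3 fun T => subset_rfl) fun T ω hω => ?_
  simp only [Set.mem_union, Set.mem_ofPred_eq, abs_norm] at *
  by_contra! hcon
  obtain ⟨h1, h2, h3⟩ := hcon
  have hlin := norm_ofLocal_sub_le hσ β h1.le (G T ω 0)
  have heq : scaledError T (coefOfLocal σ β (φ T ω)) β (varOfLocal σ (φ T ω)) σ -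
      WithLp.toLp 2 (√(T : ℝ) • (-σ) • G T ω 0) = WithLp.toLp 2 (√(T : ℝ) •
        (Sum.elim (fun j => coefOfLocal σ β (φ T ω) j - β j)
          (fun _ => varOfLocal σ (φ T ω) - σ ^ 2) - (-σ) • G T ω 0 :
            Fin (n + 1) ⊕ Unit → ℝ)) := by
    ext i
    rcases i with j | ⟨⟩ <;> simp [scaledError] <;> ring
  have hω' : ε ≤ ‖scaledError T (coefOfLocal σ β (φ T ω)) β (varOfLocal σ (φ T ω)) σ -
      WithLp.toLp 2 (√(T : ℝ) • (-σ) • G T ω 0)‖ := by simpa using hω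
  rw [heq] at hω'
  have h4 := hω'.trans (hcle _)
  rw [norm_smul, Real.norm_of_nonneg (Real.sqrt_nonneg _)] at h4
  have h5 := mul_le_mul_of_nonneg_left hlin (Real.sqrt_nonneg T)
  rw [lt_div_iff₀ (by positivity)] at h2 h3
  have h6 := mul_le_mul_of_nonneg_left h5 hc.le
  linarith

end IsRegressionDesign

end Normality

/-! ### The regression model as a regression design -/

section Model

variable {Ω : Type*} [MeasurableSpace Ω] {P : Measure Ω} [IsProbabilityMeasure P] {n : ℕ}

lemma map_div_withDensity {f : ℝ → ℝ} (hf : Measurable f) {σ : ℝ} (hσ : 0 < σ) :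
    (volume.withDensity fun e => ENNReal.ofReal (1 / σ * f (e / σ))).map (· / σ) = errorLaw f := by
  have hg : Measurable fun e : ℝ => e * σ⁻¹ := by fun_prop
  simp only [div_eq_mul_inv, one_mul]
  ext A hA
  rw [Measure.map_apply hg hA, withDensity_apply _ (hg hA), errorLaw, withDensity_apply _ hA,
    ← setLIntegral_map (f := fun r => ENNReal.ofReal (σ⁻¹ * f r)) hA (by fun_prop) hg,
    Real.map_volume_mul_right (inv_ne_zero hσ.ne'), inv_inv, abs_of_pos hσ,
    Measure.restrict_smul, lintegral_smul_measure]
  simp only [ENNReal.ofReal_mul (inv_pos.2 hσ).le]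
  rw [lintegral_const_mul _ (by fun_prop), smul_eq_mul, ← mul_assoc,
    ← ENNReal.ofReal_mul hσ.le, mul_inv_cancel₀ hσ.ne', ENNReal.ofReal_one, one_mul]

lemma dataScore_firstPeriods (f : ℝ → ℝ) (α σ : ℝ) (T : ℕ) (β : Fin (n + 1) → ℝ)
    (w : ℕ → Fin (n + 1) → ℝ) : dataScore f α σ β (firstPeriods w T) =
      localScore f α σ T (fun t => regressor (w t)) fun t => resid β (σ ^ 2) (w t) := by
  ext1 φ
  simp only [dataScore, localScore, firstPeriods]
  rw [Fin.sum_univ_eq_sum_range fun t =>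
    scoreTerm f α σ (regressor (w t)) (resid β (σ ^ 2) (w t)) φ]

/-- A property of one period that holds with probability tending to one as more periods are
observed holds almost surely. -/
lemma ae_of_tendsto_measure_one {A : ℕ → Set Ω} {B : Set Ω} (hB : MeasurableSet B)
    (hA : Tendsto (fun T => P (A T)) atTop (𝓝 1)) (h : ∀ᶠ T in atTop, A T ⊆ B) :
    ∀ᵐ ω ∂P, ω ∈ B := by
  refine (mem_ae_iff_prob_eq_one hB).2 (le_antisymm prob_le_one ?_)
  exact le_of_tendsto hA (h.mono fun T hT => measure_mono hT)

lemma tendsto_measure_one_of_compl {A B : ℕ → Set Ω}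
    (hB : Tendsto (fun T => P (B T)) atTop (𝓝 0)) (h : ∀ᶠ T in atTop, (A T)ᶜ ⊆ B T) :
    Tendsto (fun T => P (A T)) atTop (𝓝 1) := by
  have h1 : Tendsto (fun T => 1 - P (B T)) atTop (𝓝 1) := by
    simpa using ENNReal.Tendsto.sub (tendsto_const_nhds (x := (1 : ENNReal))) hB (by simp)
  refine tendsto_of_tendsto_of_tendsto_of_le_of_le' h1 tendsto_const_nhds ?_
    (Eventually.of_forall fun T => prob_le_one)
  filter_upwards [h] with T hT
  rw [tsub_le_iff_right, ← measure_univ (μ := P), ← Set.union_compl_self (A T)]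
  exact (measure_union_le _ _).trans (add_le_add_right (measure_mono hT) _)

lemma eq_of_tendstoInMeasure {Z : ℕ → Ω → ℝ} {a b : ℝ}
    (ha : TendstoInMeasure P Z atTop fun _ => a) (hb : TendstoInMeasure P Z atTop fun _ => b) :
    a = b := by
  obtain ⟨ω, h⟩ := (tendstoInMeasure_ae_unique ha hb).exists
  exact h

variable {y : ℕ → Ω → Fin (n + 1) → ℝ} {η : ℕ → Ω → ℝ} {β : Fin (n + 1) → ℝ} {σ : ℝ}
  {f : ℝ → ℝ} {α : ℝ} {Sx : Matrix (Fin (n + 1)) (Fin (n + 1)) ℝ} {mx : Fin (n + 1) → ℝ}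
  {C c : ℝ}

lemma resid_of_model (hσ : 0 < σ)
    (hmodel : ∀ t ω, y t ω 0 = β ⬝ᵥ regressor (y t ω) + η t ω) (t : ℕ) (ω : Ω) :
    resid β (σ ^ 2) (y t ω) = η t ω / σ := by
  rw [resid, Real.sqrt_sq hσ.le, hmodel t ω, add_sub_cancel_left]

theorem isRegressionDesign (hσ : 0 < σ) (hy : ∀ t, Measurable (y t)) (hη : ∀ t, Measurable (η t))
    (hmodel : ∀ t ω, y t ω 0 = β ⬝ᵥ regressor (y t ω) + η t ω) (hf : IsErrorDensity f α)
    (hiid : iIndepFun η P)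
    (hlaw : ∀ t, P.map (η t) = volume.withDensity (fun e => ENNReal.ofReal (1 / σ * f (e / σ))))
    (hexo : IndepFun (fun ω t => Fin.tail (y t ω)) (fun ω t => η t ω) P)
    (hdesign : Tendsto
      (fun T => P {ω | DesignBounds C c (firstPeriods (fun t => y t ω) T)}) atTop (𝓝 1))
    (hSx : ∀ j k, TendstoInMeasure P
      (fun T ω => gram (firstPeriods (fun t => y t ω) T) j k) atTop (fun _ => Sx j k))
    (hmx : ∀ j, TendstoInMeasure P
      (fun T ω => regressorMean (firstPeriods (fun t => y t ω) T) j) atTop (fun _ => mx j)) :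
    IsRegressionDesign P (fun t ω => regressor (y t ω)) (fun t ω => resid β (σ ^ 2) (y t ω)) f C
      Sx mx where
  measurable_x t := measurable_regressor.comp (hy t)
  measurable_s t := (measurable_resid _ _).comp (hy t)
  law t := by
    simp only [resid_of_model hσ hmodel]
    rw [← map_div_withDensity hf.measurable hσ, ← hlaw t,
      Measure.map_map (by fun_prop) (hη t)]
    rfl
  indep := by
    simp only [resid_of_model hσ hmodel]
    exact hiid.comp (fun _ e => e / σ) fun _ => by fun_prop
  exo := by
    simp only [resid_of_model hσ hmodel]
    refine hexo.comp (φ := fun (w : ℕ → Fin n → ℝ) t => (Fin.cons 1 (w t) : Fin (n + 1) → ℝ))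
      (ψ := fun (e : ℕ → ℝ) t => e t / σ) ?_ (by fun_prop)
    refine measurable_pi_iff.2 fun t => measurable_pi_iff.2 fun j => ?_
    refine Fin.cases ?_ (fun j => ?_) j
    · simp only [Fin.cons_zero]; exact measurable_const
    · simp only [Fin.cons_succ]; fun_prop
  bound t := by
    have hm : ∀ j, Measurable fun ω => regressor (y t ω) j := fun j =>
      (measurable_pi_apply j).comp (measurable_regressor.comp (hy t))
    -- The design event for any `T > t` already contains the bound for period `t`, so that bound has
    -- probability one.
    refine ae_of_tendsto_measure_one (B := {ω | ∀ j, |regressor (y t ω) j| ≤ C}) ?_ hdesign ?_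
    · simp only [Set.ofPred_forall]
      exact MeasurableSet.iInter fun j => measurableSet_le (hm j).abs measurable_const
    · filter_upwards [eventually_gt_atTop t] with T hT ω hω j
      exact hω.entries ⟨t, hT⟩ j
  second j k := by
    refine (hSx j k).congr_left fun T => ae_of_all _ fun ω => ?_
    beta_reduce
    rw [gram_apply, ← Fin.sum_univ_eq_sum_range fun t =>
      regressor (y t ω) j * regressor (y t ω) k]
    rfl
  first j := by
    refine (hmx j).congr_left fun T => ae_of_all _ fun ω => ?_
    beta_reduce
    rw [regressorMean_apply, ← Fin.sum_univ_eq_sum_range fun t => regressor (y t ω) j]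
    rfl

lemma isSymm_of_tendstoInMeasure_gram (hSx : ∀ j k, TendstoInMeasure P
    (fun T ω => gram (firstPeriods (fun t => y t ω) T) j k) atTop (fun _ => Sx j k)) :
    Sx.IsSymm := by
  ext j k
  refine eq_of_tendstoInMeasure (hSx k j) ?_
  simpa only [gram_symm _ k j] using hSx j k

lemma limit_gram_zero (hSx : ∀ j k, TendstoInMeasure P
      (fun T ω => gram (firstPeriods (fun t => y t ω) T) j k) atTop (fun _ => Sx j k))
    (hmx : ∀ j, TendstoInMeasure P
      (fun T ω => regressorMean (firstPeriods (fun t => y t ω) T) j) atTop (fun _ => mx j))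
    (j : Fin (n + 1)) : Sx j 0 = mx j := by
  refine eq_of_tendstoInMeasure (hSx j 0) ?_
  simpa only [gram_zero] using hmx j

lemma limit_regressorMean_zero (hmx : ∀ j, TendstoInMeasure P
      (fun T ω => regressorMean (firstPeriods (fun t => y t ω) T) j) atTop (fun _ => mx j)) :
    mx 0 = 1 := by
  refine eq_of_tendstoInMeasure (hmx 0) ((tendstoInMeasure_const 1).congr' ?_ (by rfl))
  filter_upwards [eventually_gt_atTop 0] with T hT
  exact ae_of_all _ fun ω => by beta_reduce; rw [← gram_zero, gram_zero_zero _ hT]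

/-- The quadratic forms of the Gram matrices converge in probability, so a lower bound on events of
probability tending to one survives in the limit. -/
lemma le_dotProduct_limit_gram (hSx : ∀ j k, TendstoInMeasure P
      (fun T ω => gram (firstPeriods (fun t => y t ω) T) j k) atTop (fun _ => Sx j k))
    (hdesign : Tendsto
      (fun T => P {ω | DesignBounds C c (firstPeriods (fun t => y t ω) T)}) atTop (𝓝 1))
    (a : Fin (n + 1) → ℝ) : c * (a ⬝ᵥ a) ≤ a ⬝ᵥ Sx *ᵥ a := by
  have h := tendstoInMeasure_sum (P := P) Finset.univ fun j _ =>
    tendstoInMeasure_const_mul (a j) (tendstoInMeasure_sum (P := P) Finset.univ fun k _ =>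
      tendstoInMeasure_const_mul (a k) (hSx j k))
  have hlim : ∀ A : Matrix (Fin (n + 1)) (Fin (n + 1)) ℝ,
      ∑ j, a j * ∑ k, a k * A j k = a ⬝ᵥ A *ᵥ a := fun A => by
    simp only [dotProduct, Matrix.mulVec, mul_comm]
  simp only [hlim] at h
  exact le_of_tendstoInMeasure h hdesign fun T ω hω =>
    le_dotProduct_mulVec_of_spectrum (isHermitian_gram _) hω.eigenvalues a

end Model

end HCW

end

/-! ### Assembly of the main result. -/

theorem theorem1 {Ω : Type*} [MeasurableSpace Ω] (P : Measure Ω) [IsProbabilityMeasure P]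
    {n : ℕ} (y : ℕ → Ω → Fin (n + 1) → ℝ) (η : ℕ → Ω → ℝ)
    (β : Fin (n + 1) → ℝ) (σ : ℝ) (hσ : 0 < σ) (f : ℝ → ℝ) (α : ℝ) (hα : 0 ≤ α)
    (hy : ∀ t, Measurable (y t)) (hη : ∀ t, Measurable (η t))
    -- the regression model
    (hmodel : ∀ t ω, y t ω 0 = β ⬝ᵥ HCW.regressor (y t ω) + η t ω)
    -- the errors are iid with density `f(·/σ)/σ`, independent of the control outcomes
    (hf : HCW.IsErrorDensity f α) (hreg : HCW.IsRegularDensity f α)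
    (hiid : iIndepFun η P)
    (hlaw : ∀ t, P.map (η t) = volume.withDensity (fun e => ENNReal.ofReal (1 / σ * f (e / σ))))
    (hexo : IndepFun (fun ω t => Fin.tail (y t ω)) (fun ω t => η t ω) P)
    -- the bounds on the regressors, with probability tending to one
    (hdesign : ∃ C c : ℝ, 0 < c ∧ Tendsto
      (fun T => P {ω | HCW.DesignBounds C c (HCW.firstPeriods (fun t => y t ω) T)}) atTop (𝓝 1))
    -- the limits in probability `Σₓ` and `μₓ`
    (Sx : Matrix (Fin (n + 1)) (Fin (n + 1)) ℝ) (mx : Fin (n + 1) → ℝ)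
    (hSx : ∀ j k, TendstoInMeasure P
      (fun T ω => HCW.gram (HCW.firstPeriods (fun t => y t ω) T) j k) atTop (fun _ => Sx j k))
    (hmx : ∀ j, TendstoInMeasure P
      (fun T ω => HCW.regressorMean (HCW.firstPeriods (fun t => y t ω) T) j) atTop
      (fun _ => mx j)) :
    -- the limiting matrices are non-degenerate
    (HCW.Psi f α σ Sx mx).det ≠ 0 ∧ (HCW.asympCov f α σ Sx mx).PosSemidef ∧
    -- estimators, as measurable functions of the data of the first `T` periods
    ∃ (bhat : (T : ℕ) → (Fin T → Fin (n + 1) → ℝ) → Fin (n + 1) → ℝ)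
      (vhat : (T : ℕ) → (Fin T → Fin (n + 1) → ℝ) → ℝ),
      (∀ T, Measurable (bhat T)) ∧ (∀ T, Measurable (vhat T)) ∧
      -- roots of the estimating equations with probability tending to one
      Tendsto (fun T => P {ω | HCW.IsMDPDERoot f α (HCW.firstPeriods (fun t => y t ω) T)
        (bhat T (HCW.firstPeriods (fun t => y t ω) T))
        (vhat T (HCW.firstPeriods (fun t => y t ω) T))}) atTop (𝓝 1) ∧
      -- consistency
      TendstoInMeasure P (fun T ω => bhat T (HCW.firstPeriods (fun t => y t ω) T)) atTop
        (fun _ => β) ∧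
      TendstoInMeasure P (fun T ω => vhat T (HCW.firstPeriods (fun t => y t ω) T)) atTop
        (fun _ => σ ^ 2) ∧
      -- consistency at the rate `√T`
      (∀ j, HCW.BoundedInProbability P (fun T ω => √(T : ℝ) *
        (bhat T (HCW.firstPeriods (fun t => y t ω) T) j - β j))) ∧
      HCW.BoundedInProbability P (fun T ω => √(T : ℝ) *
        (vhat T (HCW.firstPeriods (fun t => y t ω) T) - σ ^ 2)) ∧
      -- asymptotic normality
      TendstoInDistribution
        (fun T ω => HCW.scaledError T (bhat T (HCW.firstPeriods (fun t => y t ω) T)) β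
          (vhat T (HCW.firstPeriods (fun t => y t ω) T)) σ) atTop
        (id : EuclideanSpace ℝ (Fin (n + 1) ⊕ Unit) → EuclideanSpace ℝ (Fin (n + 1) ⊕ Unit))
        (fun _ => P) (multivariateGaussian 0 (HCW.asympCov f α σ Sx mx)) := by
  obtain ⟨C, c, hc, hdesign⟩ := hdesign
  have hd := HCW.isRegressionDesign hσ hy hη hmodel hf hiid hlaw hexo hdesign hSx hmx
  have hS := HCW.isSymm_of_tendstoInMeasure_gram hSx
  have hm := HCW.limit_gram_zero hSx hmx
  have h1 := HCW.limit_regressorMean_zero hmx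
  have hle := HCW.le_dotProduct_limit_gram hSx hdesign
  have hpos : ∀ a, a ≠ 0 → 0 < a ⬝ᵥ Sx *ᵥ a := fun a ha =>
    (mul_pos hc ((Matrix.dotProduct_self_star_pos_iff (v := a)).2 ha)).trans_le (hle a)
  have hpos' : ∀ a, 0 ≤ a ⬝ᵥ Sx *ᵥ a := fun a => by
    rcases eq_or_ne a 0 with rfl | ha
    · simp
    · exact (hpos a ha).le
  have hΨ : (HCW.Psi f α σ Sx mx).det ≠ 0 :=
    (HCW.posDef_Psi hf hreg hσ hS hm h1 hpos).det_pos.ne'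
  have hQ : (HCW.asympCov f α σ Sx mx).PosSemidef :=
    HCW.posSemidef_asympCov hf hreg hα hS hm h1 hpos'
  set φ : ℕ → Ω → Fin (n + 1) ⊕ Unit → ℝ := fun T ω =>
    HCW.localEstimate f α σ β (HCW.Psi f α σ Sx mx) (HCW.firstPeriods (fun t => y t ω) T) with hφdef
  have hφ : ∀ T ω, φ T ω = HCW.iterLimit (HCW.newtonStep (HCW.Psi f α σ Sx mx)
      (HCW.localScore f α σ T (fun t => HCW.regressor (y t ω))
        fun t => HCW.resid β (σ ^ 2) (y t ω))) := fun T ω => by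
    simp only [hφdef, HCW.localEstimate, HCW.dataScore_firstPeriods]
  have hφm : ∀ T, Measurable (φ T) := fun T =>
    (HCW.measurable_localEstimate hf hreg β _).comp (measurable_pi_iff.2 fun t => hy t)
  have hCLT := hd.tendstoInDistribution_ofLocal hf hreg hσ hα hS hΨ hQ β hφ hφm
  have hO := HCW.boundedInProbability_norm_of_tendstoInDistribution hCLT
  have hb : ∀ j, HCW.BoundedInProbability P fun T ω =>
      √(T : ℝ) * (HCW.coefOfLocal σ β (φ T ω) j - β j) := fun j =>
    hO.mono zero_le_one fun T ω => by
      rw [abs_norm, one_mul]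
      exact PiLp.norm_apply_le (HCW.scaledError T (HCW.coefOfLocal σ β (φ T ω)) β
        (HCW.varOfLocal σ (φ T ω)) σ) (Sum.inl j)
  have hv : HCW.BoundedInProbability P fun T ω =>
      √(T : ℝ) * (HCW.varOfLocal σ (φ T ω) - σ ^ 2) :=
    hO.mono zero_le_one fun T ω => by
      rw [abs_norm, one_mul]
      exact PiLp.norm_apply_le (HCW.scaledError T (HCW.coefOfLocal σ β (φ T ω)) β
        (HCW.varOfLocal σ (φ T ω)) σ) (Sum.inr ())
  have hbn : HCW.BoundedInProbability P fun T ω =>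
      √(T : ℝ) * ‖HCW.coefOfLocal σ β (φ T ω) - β‖ :=
    hO.mono zero_le_one fun T ω => by
      rw [abs_norm, one_mul, abs_of_nonneg (by positivity),
        ← Real.norm_of_nonneg (Real.sqrt_nonneg (T : ℝ)), ← norm_smul]
      exact (pi_norm_le_iff_of_nonneg (norm_nonneg _)).2 fun j =>
        PiLp.norm_apply_le (HCW.scaledError T (HCW.coefOfLocal σ β (φ T ω)) β
          (HCW.varOfLocal σ (φ T ω)) σ) (Sum.inl j)
  -- The iteration is centred at the true `β` and `σ` and uses the limiting `Ψ`; these are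
  -- constants, so the estimators remain functions of the data.
  refine ⟨hΨ, hQ,
    fun T D => HCW.coefOfLocal σ β (HCW.localEstimate f α σ β (HCW.Psi f α σ Sx mx) D),
    fun T D => HCW.varOfLocal σ (HCW.localEstimate f α σ β (HCW.Psi f α σ Sx mx) D),
    fun T => (HCW.measurable_coefOfLocal β).comp (HCW.measurable_localEstimate hf hreg β _),
    fun T => HCW.measurable_varOfLocal.comp (HCW.measurable_localEstimate hf hreg β _),
    ?_, ?_, ?_, hb, hv, hCLT⟩
  · have hLip := fun K hK => hd.exists_tendsto_lipschitzNearZero hf hreg hσ hΨ K hK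
    have hO0 := hd.boundedInProbability_newtonStep_zero hf hreg hσ hα hS hQ
    have hbd := HCW.boundedInProbability_iterLimit hLip hO0
    simp only [← hφ] at hbd
    have hfix := HCW.tendsto_measure_not_isGoodFixedPoint hLip hO0 (K := 1 / 2) (by norm_num) le_rfl
    -- When the iterates reach a fixed point of norm below `σ`, the factor `1 + κ` is at least
    -- `1/2`, so the point is a root with positive variance.
    refine HCW.tendsto_measure_one_of_compl (HCW.tendsto_measure_zero_of_subset_union
      (hbd.tendsto_measure_lt hσ) hfix fun T => subset_rfl) ?_
    filter_upwards [eventually_gt_atTop 0] with T hT ω hω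
    simp only [Set.mem_union, Set.mem_ofPred_eq, abs_norm, Set.mem_compl_iff] at *
    by_contra! hcon
    refine hω (HCW.isMDPDERoot_ofLocal hσ hT hΨ ?_ ?_)
    · rw [HCW.localEstimate, HCW.dataScore_firstPeriods]
      exact hcon.2.fixed
    · have := abs_le.1 (HCW.abs_inr_div_le hσ hcon.1.le)
      simp only [hφdef] at this
      linarith [this.1]
  · rw [tendstoInMeasure_iff_norm]
    intro ε hε
    simpa only [abs_norm] using hbn.tendsto_measure_lt hε
  · rw [HCW.tendstoInMeasure_real_iff]
    intro ε hε
    exact hv.tendsto_measure_lt hε
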